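/- Let $\mathbf{k}$ be a field of characteristic $0$. A braiding on a vector space $V$ is a linear map $\sigma:V\otimes V\to V\otimes V$ (not necessarily invertible) with $\sigma_1\sigma_2\sigma_1=\sigma_2\sigma_1\sigma_2$ on $V^{\otimes 3}$, where $\sigma_i$ denotes $\sigma$ acting on the $i$-th and $(i+1)$-st factors; $(V,\sigma)$ is then a braided vector space. A subspace $W\subseteq V$ is a braided subspace if $\sigma(W\otimes V+V\otimes W)\subseteq W\otimes V+V\otimes W$. A linear map $\mu:V\otimes V\to V$ is compatible with $\sigma$ if $\sigma(\mathrm{id}\otimes\mu)=(\mu\otimes\mathrm{id})\sigma_2\sigma_1$ and $\sigma(\mu\otimes\mathrm{id})=(\mathrm{id}\otimes\mu)\sigma_1\sigma_2$. A braided algebra is an associative (not necessarily unital) algebra with a braiding compatible with its product. A braided tridendriform algebra $(R,\prec,\succ,\cdot,\sigma)$ is a braided vector space $(R,\sigma)$ with three bilinear operations compatible with $\sigma$ such that, with $*:=\prec+\succ+\,\cdot$, $$(x\prec y)\prec z=x\prec(y*z),\quad (x\succ y)\prec z=x\succ(y\prec z),\quad x\succ(y\succ z)=(x*y)\succ z,\quad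 (x\cdot y)\prec z=x\cdot(y\prec z),$$ $$(x\prec y)\cdot z=x\cdot(y\succ z),\quad (x\succ y)\cdot z=x\succ(y\cdot z),\quad (x\cdot y)\cdot z=x\cdot(y\cdot z).$$ A homomorphism is a linear map $f$ that preserves the three operations and satisfies $(f\otimes f)\sigma=\sigma'(f\otimes f)$. A tridendriform ideal is a subspace $I$ with $R\circ I\subseteq I$ and $I\circ R\subseteq I$ for $\circ\in\{\prec,\succ,\cdot\}$; it is braided if it is also a braided subspace, and then $R/I$ carries the induced operations and braiding. Let $\mathcal D_n$ be the set of planar rooted trees with $n+1$ leaves in which every internal vertex has at least two branches, so that such a tree has $n$ angles; $\mathcal D_0=\{\,|\,\}$. For a vector space $V$ put $\mathcal P(V)=\bigoplus_{n\ge0}\mathbf{k}\mathcal D_n\otimes V^{\otimes n}$ and $\overline{\mathcal P(V)}=\bigoplus_{n\ge1}\mathbf{k}\mathcal D_n\otimes V^{\otimes n}$, where $T\otimes v_1\otimes\cdots\otimes v_n=(T;v_1,\dots,v_n)$ is viewed as $T$ with its angles decorated by $v_1,\dots,v_n$ from left to right. Write $T_0\vee_{v_1}\cdots\vee_{v_k}T_k$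 ($k\ge1$) for the tree obtained by joining the branches $T_0,\dots,T_k$ to a new vertex with angles decorated by $v_1,\dots,v_k$, and $T[v]=|\vee_v|$. On $\overline{\mathcal P(V)}$ define recursively, for $T=T_0\vee_{v_1}\cdots\vee_{v_k}T_k$ and $T'=T'_0\vee_{v_{k+1}}\cdots\vee_{v_{k+l}}T'_l$, $$T\prec T'=T_0\vee_{v_1}\cdots\vee_{v_k}(T_k*T'),\qquad T\succ T'=(T*T'_0)\vee_{v_{k+1}}\cdots\vee_{v_{k+l}}T'_l,$$ $$T\cdot T'=T_0\vee_{v_1}\cdots\vee_{v_k}(T_k*T'_0)\vee_{v_{k+1}}\cdots\vee_{v_{k+l}}T'_l,$$ where $*=\prec+\succ+\,\cdot$ is extended to $\mathcal P(V)$ with unit $|$. If $\sigma$ is a braiding on $V$, let $\sigma_{AT}$ be the map on $\mathcal P(V)\otimes\mathcal P(V)$ given by $$\sigma_{AT}\big((T;v_1,\dots,v_m)\otimes(T';v_{m+1},\dots,v_{m+n})\big)=(T'\otimes T)\,\beta_{mn}(v_1\otimes\cdots\otimes v_{m+n}),$$ where $\beta_{mn}:V^{\otimes m}\otimes V^{\otimes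 n}\to V^{\otimes n}\otimes V^{\otimes m}$ is the product of operators $\sigma_i$ along a reduced expression of the permutation exchanging the block of the first $m$ factors with the block of the last $n$ (the identity if $m=0$ or $n=0$). Now let $(A,\sigma)$ be a braided algebra. A tree is lush if, at each vertex, a branch that is neither the leftmost nor the rightmost one is never a leaf. Let $\mathcal G_n\subseteq\mathcal D_n$ be the set of lush trees, $\mathcal P_A(A)=\bigoplus_{n\ge0}\mathbf{k}\mathcal G_n\otimes A^{\otimes n}\subseteq\mathcal P(A)$ and $\overline{\mathcal P_A(A)}=\bigoplus_{n\ge1}\mathbf{k}\mathcal G_n\otimes A^{\otimes n}\subseteq\overline{\mathcal P(A)}$. Equip $\overline{\mathcal P_A(A)}$ with $\sigma_{AT}$ and with operations defined by the same recursion, except that $$T\cdot T'=T_0\vee_{a_1}\cdots\vee_{a_{k-1}}T_{k-1}\vee_{a_ka_{k+1}}T'_1\vee_{a_{k+2}}\cdots\vee_{a_{k+l}}T'_l\qquad\text{if }T_k=T'_0=|\,.$$ Let $I_A$ be the tridendriform ideal of $\overline{\mathcal P(A)}$ generated by the elements $T[a]\cdot T[b]-T[ab]$, $a,b\in A$. Then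 $\overline{\mathcal P(A)}$ and $\overline{\mathcal P_A(A)}$ are braided tridendriform algebras, $I_A$ is a braided tridendriform ideal of $\overline{\mathcal P(A)}$ (so that $\overline{\mathcal P(A)}/I_A$ is a braided tridendriform algebra), and $\overline{\mathcal P_A(A)}$ is isomorphic to $\overline{\mathcal P(A)}/I_A$ as a braided tridendriform algebra. Moreover $$\overline{\mathcal P(A)}=\overline{\mathcal P_A(A)}\oplus I_A\qquad\text{and}\qquad \mathcal P(A)=\mathcal P_A(A)\oplus I_A$$ as braided vector spaces: in each case the whole space with $\sigma_{AT}$ is a braided vector space, both summands $U,W$ are braided subspaces, and $\sigma_{AT}(X\otimes Y)\subseteq Y\otimes X$ for all $X,Y\in\{U,W\}$. -/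

import Mathlib

open scoped TensorProduct DirectSum

noncomputable section

namespace BraidedTree

/-! ### Braided vector spaces, braided algebras, braided tridendriform algebras -/

section General

variable {k : Type*} [Field k]

/-- `σ ⊗ id` on the triple tensor power `V ⊗ (V ⊗ V)`. -/
def act₁ {V : Type*} [AddCommGroup V] [Module k V] (σ : V ⊗[k] V →ₗ[k] V ⊗[k] V) :
    V ⊗[k] (V ⊗[k] V) →ₗ[k] V ⊗[k] (V ⊗[k] V) :=
  (TensorProduct.assoc k V V V).toLinearMap ∘ₗ TensorProduct.map σ LinearMap.id ∘ₗ
    (TensorProduct.assoc k V V V).symm.toLinearMap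

/-- `id ⊗ σ` on the triple tensor power `V ⊗ (V ⊗ V)`. -/
def act₂ {V : Type*} [AddCommGroup V] [Module k V] (σ : V ⊗[k] V →ₗ[k] V ⊗[k] V) :
    V ⊗[k] (V ⊗[k] V) →ₗ[k] V ⊗[k] (V ⊗[k] V) :=
  TensorProduct.map LinearMap.id σ

/-- A braiding (Yang-Baxter operator); it is not required to be invertible. -/
def IsBraiding {V : Type*} [AddCommGroup V] [Module k V]
    (σ : V ⊗[k] V →ₗ[k] V ⊗[k] V) : Prop :=
  act₁ σ ∘ₗ act₂ σ ∘ₗ act₁ σ = act₂ σ ∘ₗ act₁ σ ∘ₗ act₂ σ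

/-- Compatibility of a product `μ` with `σ`:
`σ (id ⊗ μ) = (μ ⊗ id) σ₂ σ₁` and `σ (μ ⊗ id) = (id ⊗ μ) σ₁ σ₂`. -/
structure IsBraidCompatible {V : Type*} [AddCommGroup V] [Module k V]
    (σ : V ⊗[k] V →ₗ[k] V ⊗[k] V) (μ : V ⊗[k] V →ₗ[k] V) : Prop where
  right : σ ∘ₗ TensorProduct.map LinearMap.id μ =
    TensorProduct.map μ LinearMap.id ∘ₗ (TensorProduct.assoc k V V V).symm.toLinearMap ∘ₗ
      act₂ σ ∘ₗ act₁ σ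
  left : σ ∘ₗ TensorProduct.map μ LinearMap.id ∘ₗ
      (TensorProduct.assoc k V V V).symm.toLinearMap =
    TensorProduct.map LinearMap.id μ ∘ₗ act₁ σ ∘ₗ act₂ σ

/-- `(A, σ)` is a braided algebra (associative, not necessarily unital). -/
structure IsBraidedAlgebra {A : Type*} [NonUnitalRing A] [Module k A] [IsScalarTower k A A]
    [SMulCommClass k A A] (σ : A ⊗[k] A →ₗ[k] A ⊗[k] A) : Prop where
  isBraiding : IsBraiding σ
  compat : IsBraidCompatible σ (LinearMap.mul' k A)

/-- The subspace `U ⊗ W` of `V ⊗ V`. -/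
def tensorSub {V : Type*} [AddCommGroup V] [Module k V] (U W : Submodule k V) :
    Submodule k (V ⊗[k] V) :=
  LinearMap.range (TensorProduct.map U.subtype W.subtype)

/-- The subspace `W ⊗ V + V ⊗ W` of `V ⊗ V`. -/
def tensorSum {V : Type*} [AddCommGroup V] [Module k V] (W : Submodule k V) :
    Submodule k (V ⊗[k] V) :=
  LinearMap.range (TensorProduct.map W.subtype LinearMap.id) ⊔
    LinearMap.range (TensorProduct.map LinearMap.id W.subtype)

/-- `W` is a braided subspace: `σ (W ⊗ V + V ⊗ W) ⊆ W ⊗ V + V ⊗ W`. -/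
def IsBraidedSubspace {V : Type*} [AddCommGroup V] [Module k V]
    (σ : V ⊗[k] V →ₗ[k] V ⊗[k] V) (W : Submodule k V) : Prop :=
  tensorSum W ≤ (tensorSum W).comap σ

/-- `V = U ⊕ W` as braided vector spaces: `(V, σ)` is a braided vector space which is the direct
sum of its braided subspaces `U` and `W`, and `σ` is the sum of its four blocks
`U ⊗ U → U ⊗ U`, `U ⊗ W → W ⊗ U`, `W ⊗ U → U ⊗ W` and `W ⊗ W → W ⊗ W`. -/
structure IsBraidedDirectSum {V : Type*} [AddCommGroup V] [Module k V]
    (σ : V ⊗[k] V →ₗ[k] V ⊗[k] V) (U W : Submodule k V) : Prop where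
  isBraiding : IsBraiding σ
  isCompl : IsCompl U W
  fst_braided : IsBraidedSubspace σ U
  snd_braided : IsBraidedSubspace σ W
  fst_fst : (tensorSub U U).map σ ≤ tensorSub U U
  fst_snd : (tensorSub U W).map σ ≤ tensorSub W U
  snd_fst : (tensorSub W U).map σ ≤ tensorSub U W
  snd_snd : (tensorSub W W).map σ ≤ tensorSub W W

/-- The data `(≺, ≻, ·, σ)` on a vector space `R`; the axioms are stated in
`IsBraidedTridendriform`. -/
structure TriData (k R : Type*) [Field k] [AddCommGroup R] [Module k R] where
  prec : R ⊗[k] R →ₗ[k] R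
  succ : R ⊗[k] R →ₗ[k] R
  dot : R ⊗[k] R →ₗ[k] R
  braid : R ⊗[k] R →ₗ[k] R ⊗[k] R

/-- `* = ≺ + ≻ + ·`. -/
def TriData.star {R : Type*} [AddCommGroup R] [Module k R] (D : TriData k R) :
    R ⊗[k] R →ₗ[k] R :=
  D.prec + D.succ + D.dot

/-- `(R, ≺, ≻, ·, σ)` is a braided tridendriform algebra. -/
structure IsBraidedTridendriform {R : Type*} [AddCommGroup R] [Module k R]
    (D : TriData k R) : Prop where
  prec_prec : ∀ x y z : R, D.prec (D.prec (x ⊗ₜ y) ⊗ₜ z) = D.prec (x ⊗ₜ D.star (y ⊗ₜ z))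
  succ_prec : ∀ x y z : R, D.prec (D.succ (x ⊗ₜ y) ⊗ₜ z) = D.succ (x ⊗ₜ D.prec (y ⊗ₜ z))
  succ_succ : ∀ x y z : R, D.succ (x ⊗ₜ D.succ (y ⊗ₜ z)) = D.succ (D.star (x ⊗ₜ y) ⊗ₜ z)
  dot_prec : ∀ x y z : R, D.prec (D.dot (x ⊗ₜ y) ⊗ₜ z) = D.dot (x ⊗ₜ D.prec (y ⊗ₜ z))
  prec_dot : ∀ x y z : R, D.dot (D.prec (x ⊗ₜ y) ⊗ₜ z) = D.dot (x ⊗ₜ D.succ (y ⊗ₜ z))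
  succ_dot : ∀ x y z : R, D.dot (D.succ (x ⊗ₜ y) ⊗ₜ z) = D.succ (x ⊗ₜ D.dot (y ⊗ₜ z))
  dot_dot : ∀ x y z : R, D.dot (D.dot (x ⊗ₜ y) ⊗ₜ z) = D.dot (x ⊗ₜ D.dot (y ⊗ₜ z))
  isBraiding : IsBraiding D.braid
  compat_prec : IsBraidCompatible D.braid D.prec
  compat_succ : IsBraidCompatible D.braid D.succ
  compat_dot : IsBraidCompatible D.braid D.dot

/-- `f` is a homomorphism of braided tridendriform algebras. -/
structure IsTriHom {R R' : Type*} [AddCommGroup R] [Module k R] [AddCommGroup R'] [Module k R']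
    (D : TriData k R) (D' : TriData k R') (f : R →ₗ[k] R') : Prop where
  prec : f ∘ₗ D.prec = D'.prec ∘ₗ TensorProduct.map f f
  succ : f ∘ₗ D.succ = D'.succ ∘ₗ TensorProduct.map f f
  dot : f ∘ₗ D.dot = D'.dot ∘ₗ TensorProduct.map f f
  braid : TensorProduct.map f f ∘ₗ D.braid = D'.braid ∘ₗ TensorProduct.map f f

/-- `I` absorbs the product `μ` on both sides. -/
def IsIdealFor {R : Type*} [AddCommGroup R] [Module k R] (μ : R ⊗[k] R →ₗ[k] R)
    (I : Submodule k R) : Prop :=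
  ∀ x y : R, y ∈ I → μ (x ⊗ₜ y) ∈ I ∧ μ (y ⊗ₜ x) ∈ I

/-- `I` is a tridendriform ideal. -/
structure IsTriIdeal {R : Type*} [AddCommGroup R] [Module k R] (D : TriData k R)
    (I : Submodule k R) : Prop where
  prec : IsIdealFor D.prec I
  succ : IsIdealFor D.succ I
  dot : IsIdealFor D.dot I

/-- `I` is a braided tridendriform ideal. -/
structure IsBraidedTriIdeal {R : Type*} [AddCommGroup R] [Module k R] (D : TriData k R)
    (I : Submodule k R) : Prop extends IsTriIdeal D I where
  braided : IsBraidedSubspace D.braid I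

/-- The tridendriform ideal generated by a set. -/
def triIdealSpan {R : Type*} [AddCommGroup R] [Module k R] (D : TriData k R) (s : Set R) :
    Submodule k R :=
  sInf {I | IsTriIdeal D I ∧ s ⊆ I}

theorem IsIdealFor.tensorSum_le {R : Type*} [AddCommGroup R] [Module k R]
    {μ : R ⊗[k] R →ₗ[k] R} {I : Submodule k R} (h : IsIdealFor μ I) :
    tensorSum I ≤ I.comap μ := by
  refine sup_le ?_ ?_
  · rintro _ ⟨t, rfl⟩
    induction t using TensorProduct.induction_on with
    | zero => simp
    | tmul x y => exact (h y x x.2).2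
    | add a b ha hb => rw [map_add]; exact add_mem ha hb
  · rintro _ ⟨t, rfl⟩
    induction t using TensorProduct.induction_on with
    | zero => simp
    | tmul x y => exact (h x y y.2).1
    | add a b ha hb => rw [map_add]; exact add_mem ha hb

/-- The identification `(R / I) ⊗ (R / I) = (R ⊗ R) / (I ⊗ R + R ⊗ I)`. -/
def quotTensorEquiv {R : Type*} [AddCommGroup R] [Module k R] (I : Submodule k R) :
    (R ⧸ I) ⊗[k] (R ⧸ I) ≃ₗ[k] (R ⊗[k] R) ⧸ tensorSum I :=
  TensorProduct.quotientTensorQuotientEquiv I I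

/-- The operations and the braiding induced on the quotient by a braided tridendriform ideal. -/
def quotientData {R : Type*} [AddCommGroup R] [Module k R] (D : TriData k R)
    (I : Submodule k R) (h : IsBraidedTriIdeal D I) : TriData k (R ⧸ I) where
  prec := (tensorSum I).mapQ I D.prec h.prec.tensorSum_le ∘ₗ (quotTensorEquiv I).toLinearMap
  succ := (tensorSum I).mapQ I D.succ h.succ.tensorSum_le ∘ₗ (quotTensorEquiv I).toLinearMap
  dot := (tensorSum I).mapQ I D.dot h.dot.tensorSum_le ∘ₗ (quotTensorEquiv I).toLinearMap
  braid := (quotTensorEquiv I).symm.toLinearMap ∘ₗ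
    (tensorSum I).mapQ (tensorSum I) D.braid h.braided ∘ₗ (quotTensorEquiv I).toLinearMap

end General

/-! ### Operators on tensor powers -/

section Tensor

variable {k : Type*} [Field k] {V : Type*} [AddCommGroup V] [Module k V]

/-- `id ⊗ f ⊗ id`, for `f : V^{⊗a} → V^{⊗b}` placed after the first `p` and before the last `q`
tensor factors. -/
def applyAt {a b : ℕ} (p q : ℕ) (f : ⨂[k]^a V →ₗ[k] ⨂[k]^b V) :
    ⨂[k]^(p + a + q) V →ₗ[k] ⨂[k]^(p + b + q) V :=
  TensorPower.mulEquiv.toLinearMap ∘ₗ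
    TensorProduct.map
      (TensorPower.mulEquiv.toLinearMap ∘ₗ TensorProduct.map LinearMap.id f ∘ₗ
        TensorPower.mulEquiv.symm.toLinearMap)
      LinearMap.id ∘ₗ
    TensorPower.mulEquiv.symm.toLinearMap

/-- The identification `V^{⊗1} = V`. -/
def powOne : ⨂[k]^1 V ≃ₗ[k] V :=
  PiTensorProduct.subsingletonEquiv (0 : Fin 1)

/-- The identification `V^{⊗2} = V ⊗ V`. -/
def powTwo : ⨂[k]^(1 + 1) V ≃ₗ[k] V ⊗[k] V :=
  TensorPower.mulEquiv.symm ≪≫ₗ TensorProduct.congr powOne powOne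

/-- `σ` applied to the tensor factors in positions `i` and `i + 1` of `V^{⊗N}`, positions being
counted from `0` (only used for `i + 2 ≤ N`). -/
def braidAt (σ : V ⊗[k] V →ₗ[k] V ⊗[k] V) (N i : ℕ) : ⨂[k]^N V →ₗ[k] ⨂[k]^N V :=
  if h : i + 2 ≤ N then
    (TensorPower.cast k V (show i + (1 + 1) + (N - i - 2) = N by omega)).toLinearMap ∘ₗ
      applyAt i (N - i - 2) (powTwo.symm.toLinearMap ∘ₗ σ ∘ₗ powTwo.toLinearMap) ∘ₗ
      (TensorPower.cast k V (show N = i + (1 + 1) + (N - i - 2) by omega)).toLinearMap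
  else LinearMap.id

/-- `σ_{a+n-1} ∘ ⋯ ∘ σ_{a+1} ∘ σ_a`: the factor in position `a` is moved past the `n` factors that
follow it. -/
def braidPast (σ : V ⊗[k] V →ₗ[k] V ⊗[k] V) (N a : ℕ) : ℕ → (⨂[k]^N V →ₗ[k] ⨂[k]^N V)
  | 0 => LinearMap.id
  | n + 1 => braidAt σ N (a + n) ∘ₗ braidPast σ N a n

/-- The braid operator `T_χ` of the permutation `χ` that exchanges the block of the first `m`
factors with the block of the `n` factors after it, computed from the reduced expression of length
`m * n` in which the factors in positions `m - 1, …, 1, 0` are moved, in this order, past the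
second block. -/
def braidBlocks (σ : V ⊗[k] V →ₗ[k] V ⊗[k] V) (N n : ℕ) : ℕ → (⨂[k]^N V →ₗ[k] ⨂[k]^N V)
  | 0 => LinearMap.id
  | m + 1 => braidBlocks σ N n m ∘ₗ braidPast σ N m n

/-- The braiding `β_{m,n} : V^{⊗m} ⊗ V^{⊗n} → V^{⊗n} ⊗ V^{⊗m}` of the tensor algebra. -/
def beta (σ : V ⊗[k] V →ₗ[k] V ⊗[k] V) (m n : ℕ) :
    ⨂[k]^m V ⊗[k] ⨂[k]^n V →ₗ[k] ⨂[k]^n V ⊗[k] ⨂[k]^m V :=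
  TensorPower.mulEquiv.symm.toLinearMap ∘ₗ
    (TensorPower.cast k V (Nat.add_comm m n)).toLinearMap ∘ₗ
    braidBlocks σ (m + n) n m ∘ₗ TensorPower.mulEquiv.toLinearMap

/-- Concatenation of tensors `V^{⊗m} ⊗ V^{⊗n} → V^{⊗N}`, `N = m + n`. -/
def concat {m n N : ℕ} (h : N = m + n) : ⨂[k]^m V →ₗ[k] ⨂[k]^n V →ₗ[k] ⨂[k]^N V :=
  (TensorProduct.mk k _ _).compr₂
    ((TensorPower.cast k V h.symm).toLinearMap ∘ₗ TensorPower.mulEquiv.toLinearMap)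

/-- Concatenation of tensors over an algebra, in which the last factor of the first tensor and the
first factor of the second one are multiplied:
`(a₁ ⊗ ⋯ ⊗ a_m) ⊗ (b₁ ⊗ ⋯ ⊗ b_n) ↦ a₁ ⊗ ⋯ ⊗ a_{m-1} ⊗ a_m b₁ ⊗ b₂ ⊗ ⋯ ⊗ b_n`. -/
def concatMul {A : Type*} [NonUnitalRing A] [Module k A] [IsScalarTower k A A]
    [SMulCommClass k A A] {m n N : ℕ} (h : 0 < m ∧ 0 < n ∧ N + 1 = m + n) :
    ⨂[k]^m A →ₗ[k] ⨂[k]^n A →ₗ[k] ⨂[k]^N A :=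
  (TensorProduct.mk k _ _).compr₂
    ((TensorPower.cast k A (show (m - 1) + 1 + (n - 1) = N by omega)).toLinearMap ∘ₗ
      applyAt (m - 1) (n - 1)
        (powOne.symm.toLinearMap ∘ₗ LinearMap.mul' k A ∘ₗ powTwo.toLinearMap) ∘ₗ
      (TensorPower.cast k A
        (show m + n = (m - 1) + (1 + 1) + (n - 1) by omega)).toLinearMap ∘ₗ
      TensorPower.mulEquiv.toLinearMap)

end Tensor

/-! ### Planar rooted trees -/

/-- Planar rooted trees all of whose internal vertices have at least two branches (valency greater
than two, the root edge included). `node T₀ [T₁, …, T_{k-1}] T_k` is the tree `T₀ ∨ ⋯ ∨ T_k`,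
`k ≥ 1`, obtained by joining the `k + 1` branches to a new vertex. -/
inductive PTree : Type
  | leaf : PTree
  | node (first : PTree) (mid : List PTree) (last : PTree) : PTree

namespace PTree

mutual
/-- The number of angles, that is, the number of leaves minus one. -/
def angles : PTree → ℕ
  | leaf => 0
  | node f m l => f.angles + (m.length + 1) + anglesList m + l.angles
/-- The total number of angles of a list of trees. -/
def anglesList : List PTree → ℕ
  | [] => 0
  | t :: ts => t.angles + anglesList ts
end

/-- A tree is lush if a branch of a vertex that is neither its leftmost nor its rightmost branch
is never a leaf. -/
inductive IsLush : PTree → Prop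
  | leaf : IsLush leaf
  | node {f : PTree} {m : List PTree} {l : PTree} (hf : IsLush f) (hl : IsLush l)
      (hm : ∀ t ∈ m, IsLush t) (hne : ∀ t ∈ m, t ≠ PTree.leaf) : IsLush (node f m l)

instance : DecidableEq PTree := Classical.decEq _

instance (T : PTree) : Decidable (T = leaf) := Classical.dec _

/-- The shapes of the terms of `S * T` in the free case, by the recursion
`S * T = S ≺ T + S ≻ T + S · T`, the leaf being the unit. The three summands for `S = S₀ ∨ ⋯ ∨ S_k`
and `T = T₀ ∨ ⋯ ∨ T_l` are
`S ≺ T = S₀ ∨ ⋯ ∨ (S_k * T)`, `S ≻ T = (S * T₀) ∨ ⋯ ∨ T_l` and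
`S · T = S₀ ∨ ⋯ ∨ (S_k * T₀) ∨ ⋯ ∨ T_l`.
In each term the angular decorations, read from left to right, are those of `S` followed by those
of `T`, so that only the shapes need to be recorded. -/
def starShapes : PTree → PTree → List PTree
  | leaf, T => [T]
  | node f m l, leaf => [node f m l]
  | node f m l, node f' m' l' =>
      (starShapes l (node f' m' l')).map (fun U => node f m U) ++
      (starShapes (node f m l) f').map (fun U => node U m' l') ++
      (starShapes l f').map (fun U => node f (m ++ U :: m') l')
termination_by S T => sizeOf S + sizeOf T

/-- The shapes of the terms of `S ≺ T` in the free case. -/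
def precShapes : PTree → PTree → List PTree
  | leaf, _ => []
  | node f m l, T => (starShapes l T).map (fun U => node f m U)

/-- The shapes of the terms of `S ≻ T` in the free case. -/
def succShapes : PTree → PTree → List PTree
  | _, leaf => []
  | S, node f' m' l' => (starShapes S f').map (fun U => node U m' l')

/-- The shapes of the terms of `S · T` in the free case. -/
def dotShapes : PTree → PTree → List PTree
  | leaf, _ => []
  | node _ _ _, leaf => []
  | node f m l, node f' m' l' => (starShapes l f').map (fun U => node f (m ++ U :: m') l')

/-- The terms of `S * T` for lush trees decorated by an algebra. The recursion is that of
`starShapes`, except that for `S = S₀ ∨_{a₁} ⋯ ∨_{a_k} S_k` and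
`T = T₀ ∨_{a_{k+1}} ⋯ ∨_{a_{k+l}} T_l` with `S_k` and `T₀` both equal to the leaf one has
`S · T = S₀ ∨_{a₁} ⋯ ∨_{a_k a_{k+1}} ⋯ ∨_{a_{k+l}} T_l`.
A term `(U, false)` is the shape `U` decorated by the decorations of `S` followed by those of `T`;
a term `(U, true)` is the shape `U` with the same decorations, except that the last one of `S` and
the first one of `T` (necessarily those of the angles merged above, since the last decoration of
`S_k` is the last one of `S`, and the first decoration of `T₀` the first one of `T`) are multiplied
into one. -/
def starTerms : PTree → PTree → List (PTree × Bool)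
  | leaf, T => [(T, false)]
  | node f m l, leaf => [(node f m l, false)]
  | node f m l, node f' m' l' =>
      (starTerms l (node f' m' l')).map (fun u => (node f m u.1, u.2)) ++
      (starTerms (node f m l) f').map (fun u => (node u.1 m' l', u.2)) ++
      (if l = leaf ∧ f' = leaf then [(node f (m ++ m') l', true)]
       else (starTerms l f').map (fun u => (node f (m ++ u.1 :: m') l', u.2)))
termination_by S T => sizeOf S + sizeOf T

/-- The terms of `S ≺ T` for lush trees decorated by an algebra. -/
def precTerms : PTree → PTree → List (PTree × Bool)
  | leaf, _ => []
  | node f m l, T => (starTerms l T).map (fun u => (node f m u.1, u.2))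

/-- The terms of `S ≻ T` for lush trees decorated by an algebra. -/
def succTerms : PTree → PTree → List (PTree × Bool)
  | _, leaf => []
  | S, node f' m' l' => (starTerms S f').map (fun u => (node u.1 m' l', u.2))

/-- The terms of `S · T` for lush trees decorated by an algebra. -/
def dotTerms : PTree → PTree → List (PTree × Bool)
  | leaf, _ => []
  | node _ _ _, leaf => []
  | node f m l, node f' m' l' =>
      if l = leaf ∧ f' = leaf then [(node f (m ++ m') l', true)]
      else (starTerms l f').map (fun u => (node f (m ++ u.1 :: m') l', u.2))

theorem anglesList_append (s t : List PTree) :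
    anglesList (s ++ t) = anglesList s + anglesList t := by
  induction s with
  | nil => simp [anglesList]
  | cons a s ih => simp [anglesList, ih]; omega

/-- The number `N` of angles of a term fits the numbers `m`, `n` of angles of the two arguments. -/
def Fits (m n N : ℕ) : Bool → Prop
  | false => N = m + n
  | true => 0 < m ∧ 0 < n ∧ N + 1 = m + n

theorem angles_starShapes (S T : PTree) :
    ∀ U ∈ starShapes S T, U.angles = S.angles + T.angles := by
  fun_induction starShapes S T with
  | case1 T => simp [angles]
  | case2 f m l => simp [angles]
  | case3 f m l f' m' l' ih1 ih2 ih3 =>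
    intro U hU
    simp only [List.mem_append, List.mem_map] at hU
    rcases hU with (⟨u, hu, rfl⟩ | ⟨u, hu, rfl⟩) | ⟨u, hu, rfl⟩
    · have := ih1 u hu
      simp only [angles] at this ⊢; omega
    · have := ih2 u hu
      simp only [angles] at this ⊢; omega
    · have := ih3 u hu
      simp only [angles, anglesList_append, anglesList, List.length_append, List.length_cons]
      omega

theorem fits_starTerms (S T : PTree) :
    ∀ u ∈ starTerms S T, Fits S.angles T.angles u.1.angles u.2 := by
  fun_induction starTerms S T with
  | case1 T => simp [angles, Fits]
  | case2 f m l => simp [angles, Fits]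
  | case3 f m l f' m' l' ih1 ih2 ih3 =>
    intro U hU
    simp only [List.mem_append, List.mem_map] at hU
    rcases hU with (⟨⟨u, b⟩, hu, rfl⟩ | ⟨⟨u, b⟩, hu, rfl⟩) | hU
    · have := ih1 _ hu
      cases b <;> simp only [angles, Fits] at this ⊢ <;> omega
    · have := ih2 _ hu
      cases b <;> simp only [angles, Fits] at this ⊢ <;> omega
    · split_ifs at hU with h
      · obtain ⟨rfl, rfl⟩ := h
        simp only [List.mem_singleton] at hU
        subst hU
        simp only [angles, Fits, anglesList_append, List.length_append]
        omega
      · simp only [List.mem_map] at hU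
        obtain ⟨⟨u, b⟩, hu, rfl⟩ := hU
        have := ih3 _ hu
        cases b <;> simp only [angles, Fits, anglesList_append, anglesList, List.length_append,
          List.length_cons] at this ⊢ <;> omega

theorem mem_precShapes {S T U : PTree} (hU : U ∈ precShapes S T) :
    U ≠ leaf ∧ U.angles = S.angles + T.angles := by
  cases S with
  | leaf => simp [precShapes] at hU
  | node f m l =>
    simp only [precShapes, List.mem_map] at hU
    obtain ⟨u, hu, rfl⟩ := hU
    have := angles_starShapes _ _ u hu
    refine ⟨by simp, ?_⟩
    simp only [angles]; omega

theorem mem_succShapes {S T U : PTree} (hU : U ∈ succShapes S T) :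
    U ≠ leaf ∧ U.angles = S.angles + T.angles := by
  cases T with
  | leaf => simp [succShapes] at hU
  | node f m l =>
    simp only [succShapes, List.mem_map] at hU
    obtain ⟨u, hu, rfl⟩ := hU
    have := angles_starShapes _ _ u hu
    refine ⟨by simp, ?_⟩
    simp only [angles]; omega

theorem mem_dotShapes {S T U : PTree} (hU : U ∈ dotShapes S T) :
    U ≠ leaf ∧ U.angles = S.angles + T.angles := by
  cases S with
  | leaf => simp [dotShapes] at hU
  | node f m l =>
    cases T with
    | leaf => simp [dotShapes] at hU
    | node f' m' l' =>
      simp only [dotShapes, List.mem_map] at hU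
      obtain ⟨u, hu, rfl⟩ := hU
      have := angles_starShapes _ _ u hu
      refine ⟨by simp, ?_⟩
      simp only [angles, anglesList_append, anglesList, List.length_append, List.length_cons]
      omega

theorem isLush_node_iff {f : PTree} {m : List PTree} {l : PTree} :
    IsLush (node f m l) ↔
      IsLush f ∧ IsLush l ∧ (∀ t ∈ m, IsLush t) ∧ ∀ t ∈ m, t ≠ leaf :=
  ⟨fun | .node a b c d => ⟨a, b, c, d⟩, fun ⟨a, b, c, d⟩ => .node a b c d⟩

theorem starTerms_ne_leaf {S T : PTree} (h : ¬(S = leaf ∧ T = leaf)) :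
    ∀ u ∈ starTerms S T, u.1 ≠ leaf := by
  cases S with
  | leaf => simp_all [starTerms]
  | node f m l =>
    cases T with
    | leaf => simp [starTerms]
    | node f' m' l' =>
      intro u hu
      simp only [starTerms, List.mem_append, List.mem_map] at hu
      rcases hu with (⟨v, hv, rfl⟩ | ⟨v, hv, rfl⟩) | hu
      · simp
      · simp
      · split_ifs at hu
        · simp only [List.mem_singleton] at hu
          simp [hu]
        · simp only [List.mem_map] at hu
          obtain ⟨v, hv, rfl⟩ := hu
          simp

theorem isLush_join {f l l' : PTree} {m m' : List PTree} {f' : PTree} {U : PTree}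
    (hS : IsLush (node f m l)) (hT : IsLush (node f' m' l')) (hU : IsLush U) (hne : U ≠ leaf) :
    IsLush (node f (m ++ U :: m') l') := by
  rw [isLush_node_iff] at hS hT ⊢
  refine ⟨hS.1, hT.2.1, ?_, ?_⟩ <;> intro t ht <;>
    simp only [List.mem_append, List.mem_cons] at ht <;> rcases ht with ht | rfl | ht
  · exact hS.2.2.1 t ht
  · exact hU
  · exact hT.2.2.1 t ht
  · exact hS.2.2.2 t ht
  · exact hne
  · exact hT.2.2.2 t ht

theorem isLush_merge {f l l' : PTree} {m m' : List PTree} {f' : PTree}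
    (hS : IsLush (node f m l)) (hT : IsLush (node f' m' l')) :
    IsLush (node f (m ++ m') l') := by
  rw [isLush_node_iff] at hS hT ⊢
  refine ⟨hS.1, hT.2.1, ?_, ?_⟩ <;> intro t ht <;>
    simp only [List.mem_append] at ht <;> rcases ht with ht | ht
  · exact hS.2.2.1 t ht
  · exact hT.2.2.1 t ht
  · exact hS.2.2.2 t ht
  · exact hT.2.2.2 t ht

theorem isLush_starTerms (S T : PTree) (hS : IsLush S) (hT : IsLush T) :
    ∀ u ∈ starTerms S T, IsLush u.1 := by
  fun_induction starTerms S T with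
  | case1 T => simpa using hT
  | case2 f m l => simpa using hS
  | case3 f m l f' m' l' ih1 ih2 ih3 =>
    intro U hU
    have hS' := isLush_node_iff.1 hS
    have hT' := isLush_node_iff.1 hT
    simp only [List.mem_append, List.mem_map] at hU
    rcases hU with (⟨u, hu, rfl⟩ | ⟨u, hu, rfl⟩) | hU
    · exact .node hS'.1 (ih1 hS'.2.1 hT u hu) hS'.2.2.1 hS'.2.2.2
    · exact .node (ih2 hS hT'.1 u hu) hT'.2.1 hT'.2.2.1 hT'.2.2.2
    · split_ifs at hU with h
      · simp only [List.mem_singleton] at hU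
        subst hU
        exact isLush_merge hS hT
      · simp only [List.mem_map] at hU
        obtain ⟨u, hu, rfl⟩ := hU
        exact isLush_join hS hT (ih3 hS'.2.1 hT'.1 u hu) (starTerms_ne_leaf h u hu)

theorem mem_precTerms {S T : PTree} (hS : IsLush S) (hT : IsLush T) {u : PTree × Bool}
    (hu : u ∈ precTerms S T) :
    (IsLush u.1 ∧ u.1 ≠ leaf) ∧ Fits S.angles T.angles u.1.angles u.2 := by
  cases S with
  | leaf => simp [precTerms] at hu
  | node f m l =>
    simp only [precTerms, List.mem_map] at hu
    obtain ⟨⟨v, b⟩, hv, rfl⟩ := hu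
    have h1 := fits_starTerms _ _ _ hv
    have hS' := isLush_node_iff.1 hS
    refine ⟨⟨.node hS'.1 (isLush_starTerms _ _ hS'.2.1 hT _ hv) hS'.2.2.1 hS'.2.2.2, by simp⟩, ?_⟩
    cases b <;> simp only [angles, Fits] at h1 ⊢ <;> omega

theorem mem_succTerms {S T : PTree} (hS : IsLush S) (hT : IsLush T) {u : PTree × Bool}
    (hu : u ∈ succTerms S T) :
    (IsLush u.1 ∧ u.1 ≠ leaf) ∧ Fits S.angles T.angles u.1.angles u.2 := by
  cases T with
  | leaf => simp [succTerms] at hu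
  | node f m l =>
    simp only [succTerms, List.mem_map] at hu
    obtain ⟨⟨v, b⟩, hv, rfl⟩ := hu
    have h1 := fits_starTerms _ _ _ hv
    have hT' := isLush_node_iff.1 hT
    refine ⟨⟨.node (isLush_starTerms _ _ hS hT'.1 _ hv) hT'.2.1 hT'.2.2.1 hT'.2.2.2, by simp⟩, ?_⟩
    cases b <;> simp only [angles, Fits] at h1 ⊢ <;> omega

theorem mem_dotTerms {S T : PTree} (hS : IsLush S) (hT : IsLush T) {u : PTree × Bool}
    (hu : u ∈ dotTerms S T) :
    (IsLush u.1 ∧ u.1 ≠ leaf) ∧ Fits S.angles T.angles u.1.angles u.2 := by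
  cases S with
  | leaf => simp [dotTerms] at hu
  | node f m l =>
    cases T with
    | leaf => simp [dotTerms] at hu
    | node f' m' l' =>
      have hmem : u ∈ starTerms (node f m l) (node f' m' l') := by
        simp only [starTerms, List.mem_append]
        exact Or.inr hu
      exact ⟨⟨isLush_starTerms _ _ hS hT _ hmem, starTerms_ne_leaf (by simp) _ hmem⟩,
        fits_starTerms _ _ _ hmem⟩

end PTree

/-! ### Spaces of decorated trees -/

section Spaces

variable (k : Type*) [Field k]

/-- The space spanned by the trees with shape in `X` and angular decorations in `V`:
`⨁_{T ∈ X} V^{⊗ T.angles}`, that is, `⨁_n k X_n ⊗ V^{⊗ n}` with `X_n` the set of the `T ∈ X` with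
`n` angles. The summand of `T` consists of the tensors `T ⊗ (v₁ ⊗ ⋯ ⊗ v_n) = (T; v₁, …, v_n)`. -/
abbrev TreeSpace (V : Type*) [AddCommGroup V] [Module k V] (X : Set PTree) : Type _ :=
  ⨁ T : X, ⨂[k]^(T.1.angles) V

variable {k} {V : Type*} [AddCommGroup V] [Module k V]

/-- `T ⊗ -`: the inclusion of the summand of the shape `T`. -/
def ofShape {X : Set PTree} (T : PTree) (hT : T ∈ X) : ⨂[k]^(T.angles) V →ₗ[k] TreeSpace k V X :=
  DirectSum.lof k X (fun T : X => ⨂[k]^(T.1.angles) V) ⟨T, hT⟩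

/-- Extends a family of bilinear maps on the summands to the spaces of trees. -/
def liftPair {X Y : Set PTree} {M : Type*} [AddCommMonoid M] [Module k M]
    (b : ∀ (S : X) (T : Y), ⨂[k]^(S.1.angles) V →ₗ[k] ⨂[k]^(T.1.angles) V →ₗ[k] M) :
    TreeSpace k V X ⊗[k] TreeSpace k V Y →ₗ[k] M :=
  TensorProduct.lift (DirectSum.toModule k X _ fun S =>
    (DirectSum.toModule k Y _ fun T => (b S T).flip).flip)

/-- The inclusion of spaces of trees for an inclusion of sets of shapes. -/
def incl {X Y : Set PTree} (h : X ⊆ Y) : TreeSpace k V X →ₗ[k] TreeSpace k V Y :=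
  DirectSum.toModule k X _ fun T => ofShape T.1 (h T.2)

/-- The braiding `σ_AT`:
`(S; v₁, …, v_m) ⊗ (T; v_{m+1}, …, v_{m+n}) ↦ (T ⊗ S) β_{m,n} (v₁ ⊗ ⋯ ⊗ v_{m+n})`. -/
def treeBraid (σ : V ⊗[k] V →ₗ[k] V ⊗[k] V) (X : Set PTree) :
    TreeSpace k V X ⊗[k] TreeSpace k V X →ₗ[k] TreeSpace k V X ⊗[k] TreeSpace k V X :=
  liftPair fun S T => TensorProduct.curry
    (TensorProduct.map (ofShape T.1 T.2) (ofShape S.1 S.2) ∘ₗ beta σ S.1.angles T.1.angles)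

/-- All trees. -/
def allShapes : Set PTree := Set.univ

/-- All trees except the leaf, that is, the trees with at least one angle. -/
def posShapes : Set PTree := {T | T ≠ PTree.leaf}

/-- All lush trees. -/
def lushShapes : Set PTree := {T | T.IsLush}

/-- All lush trees except the leaf. -/
def posLushShapes : Set PTree := {T | T.IsLush ∧ T ≠ PTree.leaf}

theorem posShapes_subset : posShapes ⊆ allShapes := fun _ _ => trivial
theorem lushShapes_subset : lushShapes ⊆ allShapes := fun _ _ => trivial
theorem posLushShapes_subset : posLushShapes ⊆ posShapes := fun _ h => h.2

/-- The product that sends `(S; u) ⊗ (T; w)` to the sum of the `(U; u ⊗ w)` over the shapes `U` of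
the list `L S T`. -/
def freeOp (L : PTree → PTree → List PTree)
    (hL : ∀ {S T U}, U ∈ L S T → U ≠ PTree.leaf ∧ U.angles = S.angles + T.angles) :
    TreeSpace k V posShapes ⊗[k] TreeSpace k V posShapes →ₗ[k] TreeSpace k V posShapes :=
  liftPair fun S T => ((L S.1 T.1).attach.map fun U =>
    (concat (hL U.2).2).compr₂ (ofShape U.1 (hL U.2).1)).sum

/-- `(≺, ≻, ·, σ_AT)` on the space of trees other than the leaf, decorated by `(V, σ)`. -/
def freeTri (σ : V ⊗[k] V →ₗ[k] V ⊗[k] V) : TriData k (TreeSpace k V posShapes) where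
  prec := freeOp PTree.precShapes PTree.mem_precShapes
  succ := freeOp PTree.succShapes PTree.mem_succShapes
  dot := freeOp PTree.dotShapes PTree.mem_dotShapes
  braid := treeBraid σ posShapes

variable {A : Type*} [NonUnitalRing A] [Module k A] [IsScalarTower k A A] [SMulCommClass k A A]

/-- The two ways in which the decorations of two trees are joined in a term, see
`PTree.starTerms`. -/
def join {m n N : ℕ} : (b : Bool) → PTree.Fits m n N b →
    (⨂[k]^m A →ₗ[k] ⨂[k]^n A →ₗ[k] ⨂[k]^N A)
  | false, h => concat h
  | true, h => concatMul h

/-- The product that sends `(S; u) ⊗ (T; w)` to the sum of the `(U; u ⊗ w)` over the terms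
`(U, false)` of the list `L S T`, and of the `(U; u')`, with `u'` obtained from `u ⊗ w` by
multiplying the last factor of `u` and the first factor of `w`, over its terms `(U, true)`. -/
def lushOp (L : PTree → PTree → List (PTree × Bool))
    (hL : ∀ {S T}, S.IsLush → T.IsLush → ∀ {u}, u ∈ L S T →
      (u.1.IsLush ∧ u.1 ≠ PTree.leaf) ∧ PTree.Fits S.angles T.angles u.1.angles u.2) :
    TreeSpace k A posLushShapes ⊗[k] TreeSpace k A posLushShapes →ₗ[k]
      TreeSpace k A posLushShapes :=
  liftPair fun S T => ((L S.1 T.1).attach.map fun u =>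
    (join u.1.2 (hL S.2.1 T.2.1 u.2).2).compr₂ (ofShape u.1.1 (hL S.2.1 T.2.1 u.2).1)).sum

/-- `(≺, ≻, ·, σ_AT)` on the space of lush trees other than the leaf, decorated by the braided
algebra `(A, σ)`. -/
def lushTri (σ : A ⊗[k] A →ₗ[k] A ⊗[k] A) : TriData k (TreeSpace k A posLushShapes) where
  prec := lushOp PTree.precTerms PTree.mem_precTerms
  succ := lushOp PTree.succTerms PTree.mem_succTerms
  dot := lushOp PTree.dotTerms PTree.mem_dotTerms
  braid := treeBraid σ posLushShapes

/-- The tree `T[v] = | ∨_v |`. -/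
def corolla (v : V) : TreeSpace k V posShapes :=
  ofShape (X := posShapes) (PTree.node PTree.leaf [] PTree.leaf) (PTree.noConfusion)
    (PiTensorProduct.tprod k fun _ => v)

/-- The tridendriform ideal `I_A` generated by the elements `T[a] · T[b] - T[ab]`. -/
def idealA (σ : A ⊗[k] A →ₗ[k] A ⊗[k] A) : Submodule k (TreeSpace k A posShapes) :=
  triIdealSpan (freeTri σ)
    {x | ∃ a b : A, x = (freeTri σ).dot (corolla a ⊗ₜ corolla b) - corolla (a * b)}

end Spaces

end BraidedTree

end

-- The two algebras are linked by the collapse of a tree: every leaf that is an inner branch of a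
-- vertex is deleted, and the two decorations that it separated are multiplied. The result is lush,
-- and a lush tree is left unchanged, so collapse is a linear retraction of the space of all trees
-- onto the space of lush ones. Three properties of it carry the theorem.
--
-- It is a homomorphism. The recursions for the free and the lush products run in parallel, and the
-- terms of a free product of two trees correspond one by one to the terms of the lush product of
-- their collapses; the exceptional rule with `a_k a_{k+1}` is the collapse of the inner leaf
-- created where two leaves meet (`PTree.starShapes_matches`, `collapsePos_freeOp`). So the seven
-- axioms need a direct proof only for the free products, where they are identities between
-- multisets of shapes (`PTree.starAssoc`, `freeOp_assoc`); they descend along surjections to lush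
-- trees and to the quotient (`IsBraidedTridendriform.of_surjective`).
--
-- Its kernel is `I_A` (`idealA_eq_ker`). The kernel is an ideal that contains the generators;
-- conversely every tree is congruent to its collapse modulo `I_A`, because a tree is built by
-- grafting smaller ones and each deletion of an inner leaf is a product of a generator with other
-- trees (`merge_sub_mem`, `dec_sub_collapse_mem`).
--
-- It slides through `σ_AT` in each tensor factor separately. The maps between tensor powers that
-- slide past every `β` (`IsNatural`) are closed under composition and, by the hexagon identities
-- `beta_concat_left` and `beta_concat_right`, under concatenation. The Yang-Baxter equation says
-- that `σ` is such a map, whence `beta_yang_baxter` and the fact that `σ_AT` is a braiding;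
-- compatibility says the same of the product of `A`, whence `isNatural_collapseMap`. An idempotent
-- that slides through a braiding in each factor splits the space into image and kernel as a braided
-- direct sum (`isBraidedDirectSum_of_idempotent`). This gives both decompositions, and also that
-- `I_A` is a braided ideal.

noncomputable section

namespace BraidedTree

-- Tensor powers: words, concatenation and the local action of `σ`.

section Concat

variable {k : Type*} [Field k] {V : Type*} [AddCommGroup V] [Module k V]

variable (k) in
/-- The pure tensor of a list of vectors (zero if the list does not have length `n`). -/
def word (n : ℕ) (u : List V) : ⨂[k]^n V :=
  if h : u.length = n then PiTensorProduct.tprod k (fun i => u.get (i.cast h.symm)) else 0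

theorem word_of_eq {n : ℕ} {u : List V} (h : u.length = n) :
    word k n u = PiTensorProduct.tprod k (fun i => u.get (i.cast h.symm)) := dif_pos h

theorem word_ofFn {n : ℕ} (f : Fin n → V) :
    word k n (List.ofFn f) = PiTensorProduct.tprod k f := by
  rw [word_of_eq (by simp)]
  congr 1
  ext i
  simp

theorem word_induction {n : ℕ} {C : ⨂[k]^n V → Prop} (x : ⨂[k]^n V)
    (hw : ∀ u : List V, u.length = n → C (word k n u))
    (hadd : ∀ x y, C x → C y → C (x + y)) (hsmul : ∀ (r : k) x, C x → C (r • x)) : C x := by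
  induction x using PiTensorProduct.induction_on with
  | smul_tprod r f =>
    rw [← word_ofFn]
    exact hsmul _ _ (hw _ (by simp))
  | add x y hx hy => exact hadd _ _ hx hy

theorem pow_hom_ext {n : ℕ} {M : Type*} [AddCommMonoid M] [Module k M] {f g : ⨂[k]^n V →ₗ[k] M}
    (h : ∀ u : List V, u.length = n → f (word k n u) = g (word k n u)) : f = g := by
  refine PiTensorProduct.ext (MultilinearMap.ext fun u => ?_)
  have := h (List.ofFn u) (by simp)
  rwa [word_ofFn] at this

theorem cast_word {m n : ℕ} (h : m = n) (u : List V) :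
    TensorPower.cast k V h (word k m u) = word k n u := by
  subst h; simp

theorem mulEquiv_word {m n : ℕ} {u w : List V} (hu : u.length = m) (hw : w.length = n) :
    TensorPower.mulEquiv (word k m u ⊗ₜ[k] word k n w) = word k (m + n) (u ++ w) := by
  subst hu hw
  rw [word_of_eq rfl, word_of_eq rfl, word_of_eq (by simp), ← TensorPower.gMul_def,
    TensorPower.tprod_mul_tprod]
  congr 1
  ext i
  refine Fin.addCases (fun i => ?_) (fun i => ?_) i <;> simp

theorem concat_apply {m n N : ℕ} (h : N = m + n) (x : ⨂[k]^m V) (y : ⨂[k]^n V) :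
    concat h x y = TensorPower.cast k V h.symm (TensorPower.mulEquiv (x ⊗ₜ y)) := rfl

theorem concat_word {m n N : ℕ} (h : N = m + n) {u w : List V} (hu : u.length = m)
    (hw : w.length = n) : concat h (word k m u) (word k n w) = word k N (u ++ w) := by
  rw [concat_apply, mulEquiv_word hu hw, cast_word]

theorem concat_assoc {a b c d e N : ℕ} (h₁ : d = a + b) (h₂ : N = d + c) (h₃ : e = b + c)
    (h₄ : N = a + e) (x : ⨂[k]^a V) (y : ⨂[k]^b V) (z : ⨂[k]^c V) :
    concat h₂ (concat h₁ x y) z = concat h₄ x (concat h₃ y z) := by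
  induction x using word_induction with
  | hadd _ _ h h' => simp only [map_add, LinearMap.add_apply, h, h']
  | hsmul _ _ h => simp only [map_smul, LinearMap.smul_apply, h]
  | hw u hu =>
  induction y using word_induction with
  | hadd _ _ h h' => simp only [map_add, LinearMap.add_apply, h, h']
  | hsmul _ _ h => simp only [map_smul, LinearMap.smul_apply, h]
  | hw v hv =>
  induction z using word_induction with
  | hadd _ _ h h' => simp only [map_add, h, h']
  | hsmul _ _ h => simp only [map_smul, h]
  | hw w hw =>
    rw [concat_word _ hu hv, concat_word _ hv hw, concat_word _ (by simp [*]) hw,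
      concat_word _ hu (by simp [*]), List.append_assoc]

/-- Concatenation of tensors as an isomorphism `V^{⊗m} ⊗ V^{⊗n} → V^{⊗N}`. -/
def concatEquiv {m n N : ℕ} (h : N = m + n) : ⨂[k]^m V ⊗[k] ⨂[k]^n V ≃ₗ[k] ⨂[k]^N V :=
  TensorPower.mulEquiv ≪≫ₗ TensorPower.cast k V h.symm

theorem concatEquiv_tmul {m n N : ℕ} (h : N = m + n) (x : ⨂[k]^m V) (y : ⨂[k]^n V) :
    concatEquiv h (x ⊗ₜ y) = concat h x y := rfl

theorem mulEquiv_tmul {m n : ℕ} (x : ⨂[k]^m V) (y : ⨂[k]^n V) :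
    TensorPower.mulEquiv (x ⊗ₜ[k] y) = concat rfl x y := by
  simp [concat_apply]

theorem cast_concat {m n N N' : ℕ} (h : N = m + n) (h' : N = N') (x : ⨂[k]^m V) (y : ⨂[k]^n V) :
    TensorPower.cast k V h' (concat h x y) = concat (h'.symm.trans h) x y := by
  simp [concat_apply]

/-- Concatenation along any splitting of the length is an isomorphism, so an additive property may
be tested on tensors cut at the places where the operators at hand act. -/
theorem concat_induction {m n N : ℕ} (h : N = m + n) {C : ⨂[k]^N V → Prop} (x : ⨂[k]^N V)
    (hw : ∀ (u : ⨂[k]^m V) (w : ⨂[k]^n V), C (concat h u w))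
    (hadd : ∀ x y, C x → C y → C (x + y)) : C x := by
  obtain ⟨t, rfl⟩ := (concatEquiv h).surjective x
  induction t using TensorProduct.induction_on with
  | zero => simpa using hw 0 0
  | tmul x y => exact hw x y
  | add x y hx hy => rw [map_add]; exact hadd _ _ hx hy

theorem powOne_word (v : V) : powOne (word k 1 [v]) = v := by
  rw [word_of_eq (n := 1) (u := [v]) rfl, powOne, PiTensorProduct.subsingletonEquiv_apply_tprod]
  rfl

theorem powOne_symm_apply (v : V) : powOne.symm v = word k 1 [v] := by
  rw [LinearEquiv.symm_apply_eq, powOne_word]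

theorem powTwo_concat (x y : ⨂[k]^1 V) :
    powTwo (concat rfl x y) = powOne x ⊗ₜ[k] powOne y := by
  rw [← mulEquiv_tmul, powTwo]
  simp

theorem applyAt_concat {a b p q : ℕ} (f : ⨂[k]^a V →ₗ[k] ⨂[k]^b V) (x : ⨂[k]^p V) (y : ⨂[k]^a V)
    (z : ⨂[k]^q V) :
    applyAt p q f (concat rfl (concat rfl x y) z) = concat rfl (concat rfl x (f y)) z := by
  simp only [← mulEquiv_tmul]
  simp [applyAt]

variable (σ : V ⊗[k] V →ₗ[k] V ⊗[k] V)

/-- `σ` on the second tensor power. -/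
def powBraid : ⨂[k]^2 V →ₗ[k] ⨂[k]^2 V :=
  powTwo.symm.toLinearMap ∘ₗ σ ∘ₗ powTwo.toLinearMap

/-- The casts in the definition of `braidAt` are dealt with here once and for all. Since `concat`
carries the equation between lengths as an argument, later computations cut a tensor into segments
and need only arithmetic of lengths. -/
theorem braidAt_concat {N i q e : ℕ} (h₁ : N = i + e) (h₂ : e = 2 + q) (x : ⨂[k]^i V)
    (y : ⨂[k]^2 V) (z : ⨂[k]^q V) :
    braidAt σ N i (concat h₁ x (concat h₂ y z)) = concat h₁ x (concat h₂ (powBraid σ y) z) := by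
  obtain rfl : q = N - i - 2 := by omega
  rw [braidAt, dif_pos (by omega)]
  simp only [LinearMap.comp_apply, LinearEquiv.coe_coe]
  rw [cast_concat, ← concat_assoc (d := i + 2) rfl (by omega)]
  -- The two sides differ by `1 + 1` against `2` in the length of the middle segment, which agree
  -- only by unfolding.
  erw [applyAt_concat]
  rw [cast_concat, concat_assoc]
  rfl

/-- Locality: spectator factors on the left shift the position, spectators on the right change
nothing. Both cases follow by cutting out the two factors on which `σ` acts. -/
theorem braidAt_concat_left {m N M i : ℕ} (h : M = m + N) (hi : i + 2 ≤ N) (x : ⨂[k]^m V)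
    (u : ⨂[k]^N V) :
    braidAt σ M (m + i) (concat h x u) = concat h x (braidAt σ N i u) := by
  induction u using concat_induction (N := N) (m := i) (n := N - i) (by omega) with
  | hadd _ _ h h' => simp only [map_add, h, h']
  | hw y w =>
  induction w using concat_induction (N := N - i) (m := 2) (n := N - i - 2) (by omega) with
  | hadd _ _ h h' => simp only [map_add, h, h']
  | hw z w =>
    rw [braidAt_concat, ← concat_assoc (d := m + i) (N := M) rfl (by omega), braidAt_concat,
      concat_assoc]

theorem braidAt_concat_right {m N M i : ℕ} (h : M = N + m) (hi : i + 2 ≤ N) (x : ⨂[k]^m V)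
    (u : ⨂[k]^N V) :
    braidAt σ M i (concat h u x) = concat h (braidAt σ N i u) x := by
  induction u using concat_induction (N := N) (m := i) (n := N - i) (by omega) with
  | hadd _ _ h h' => simp only [map_add, LinearMap.add_apply, h, h']
  | hw y w =>
  induction w using concat_induction (N := N - i) (m := 2) (n := N - i - 2) (by omega) with
  | hadd _ _ h h' => simp only [map_add, LinearMap.add_apply, h, h']
  | hw z w =>
    rw [braidAt_concat, concat_assoc (e := 2 + (N - i - 2) + m) _ _ (by omega) (by omega),
      concat_assoc (e := N - i - 2 + m) _ _ rfl (by omega), braidAt_concat,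
      concat_assoc (e := 2 + (N - i - 2) + m) _ h (by omega) (by omega),
      concat_assoc (e := N - i - 2 + m) _ _ rfl (by omega)]

theorem braidPast_concat_left {m N M : ℕ} (h : M = m + N) (x : ⨂[k]^m V) (i n : ℕ)
    (hi : i + n + 1 ≤ N) (u : ⨂[k]^N V) :
    braidPast σ M (m + i) n (concat h x u) = concat h x (braidPast σ N i n u) := by
  induction n with
  | zero => rfl
  | succ n ih =>
    simp only [braidPast, LinearMap.comp_apply]
    rw [ih (by omega), add_assoc, braidAt_concat_left _ _ (by omega)]

theorem braidPast_concat_right {m N M : ℕ} (h : M = N + m) (x : ⨂[k]^m V) (i n : ℕ)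
    (hi : i + n + 1 ≤ N) (u : ⨂[k]^N V) :
    braidPast σ M i n (concat h u x) = concat h (braidPast σ N i n u) x := by
  induction n with
  | zero => rfl
  | succ n ih =>
    simp only [braidPast, LinearMap.comp_apply]
    rw [ih (by omega), braidAt_concat_right _ _ (by omega)]

theorem braidBlocks_concat_right {m N M : ℕ} (h : M = N + m) (x : ⨂[k]^m V) (n p : ℕ)
    (hi : p + n ≤ N) (u : ⨂[k]^N V) :
    braidBlocks σ M n p (concat h u x) = concat h (braidBlocks σ N n p u) x := by
  induction p generalizing u with
  | zero => rfl
  | succ p ih =>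
    simp only [braidBlocks, LinearMap.comp_apply]
    rw [braidPast_concat_right _ _ _ _ _ (by omega), ih (by omega)]

/-- After concatenation, which is injective, `β` becomes the operator of a reduced expression on a
single tensor power. Identities for `β` are proved there and carried back. -/
theorem concatEquiv_beta {m n N : ℕ} (h : N = m + n) (h' : N = n + m)
    (t : ⨂[k]^m V ⊗[k] ⨂[k]^n V) :
    concatEquiv h' (beta σ m n t) = braidBlocks σ N n m (concatEquiv h t) := by
  subst h
  simp [beta, concatEquiv]

end Concat

-- The hexagon identities for `β`.

section Hexagon

variable {k : Type*} [Field k]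

section Generic

variable {X Y Z X' Y' Z' : Type*} [AddCommMonoid X] [Module k X] [AddCommMonoid Y] [Module k Y]
  [AddCommMonoid Z] [Module k Z] [AddCommMonoid X'] [Module k X'] [AddCommMonoid Y'] [Module k Y']
  [AddCommMonoid Z'] [Module k Z']

variable (Z) in
/-- `f ⊗ id` on a triple tensor product. -/
def map₁₂ (f : X ⊗[k] Y →ₗ[k] Y' ⊗[k] X') : X ⊗[k] (Y ⊗[k] Z) →ₗ[k] Y' ⊗[k] (X' ⊗[k] Z) :=
  (TensorProduct.assoc k Y' X' Z).toLinearMap ∘ₗ TensorProduct.map f LinearMap.id ∘ₗ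
    (TensorProduct.assoc k X Y Z).symm.toLinearMap

theorem map₁₂_tmul (f : X ⊗[k] Y →ₗ[k] Y' ⊗[k] X') (x : X) (y : Y) (z : Z) :
    map₁₂ Z f (x ⊗ₜ (y ⊗ₜ z)) = TensorProduct.assoc k Y' X' Z (f (x ⊗ₜ y) ⊗ₜ z) := rfl

theorem map₁₂_map {X₁ Y₁ Z₁ X₂ Y₂ : Type*} [AddCommMonoid X₁] [Module k X₁] [AddCommMonoid Y₁]
    [Module k Y₁] [AddCommMonoid Z₁] [Module k Z₁] [AddCommMonoid X₂] [Module k X₂]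
    [AddCommMonoid Y₂] [Module k Y₂] {f : X ⊗[k] Y →ₗ[k] Y' ⊗[k] X'} {g : X₁ ⊗[k] Y₁ →ₗ[k] Y₂ ⊗[k] X₂}
    {i : X →ₗ[k] X₁} {j : Y →ₗ[k] Y₁} (l : Z →ₗ[k] Z₁) {i' : X' →ₗ[k] X₂} {j' : Y' →ₗ[k] Y₂}
    (h : ∀ t, g (TensorProduct.map i j t) = TensorProduct.map j' i' (f t))
    (t : X ⊗[k] (Y ⊗[k] Z)) :
    map₁₂ Z₁ g (TensorProduct.map i (TensorProduct.map j l) t) =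
      TensorProduct.map j' (TensorProduct.map i' l) (map₁₂ Z f t) := by
  obtain ⟨t, rfl⟩ := (TensorProduct.assoc k X Y Z).surjective t
  induction t using TensorProduct.induction_on with
  | zero => simp only [map_zero]
  | add x y hx hy => simp only [map_add, hx, hy]
  | tmul t z =>
  induction t using TensorProduct.induction_on with
  | zero => simp only [map_zero, TensorProduct.zero_tmul]
  | add x y hx hy => simp only [map_add, TensorProduct.add_tmul, hx, hy]
  | tmul x y =>
    have e := h (x ⊗ₜ y)
    rw [TensorProduct.map_tmul] at e
    rw [TensorProduct.assoc_tmul, map₁₂_tmul, TensorProduct.map_tmul, TensorProduct.map_tmul,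
      map₁₂_tmul, e]
    generalize f (x ⊗ₜ y) = t
    induction t using TensorProduct.induction_on with
    | zero => simp only [map_zero, TensorProduct.zero_tmul]
    | add x y hx hy => simp only [map_add, TensorProduct.add_tmul, hx, hy]
    | tmul x y => simp

/-- The reassociation in the inductive step of `beta_concat_right`, with the operators abstracted.
The hypothesis `hF` is the hexagon identity for a strand `X` passing `Y` and then `Y'`; the
conclusion is the same passage in the presence of a further strand `W`, which `d` finally joins to
`X`. -/
theorem map₁₂_map_assoc_symm {W U X₂ : Type*} [AddCommMonoid W] [Module k W] [AddCommMonoid U]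
    [Module k U] [AddCommMonoid X₂] [Module k X₂] {c : Y ⊗[k] Y' →ₗ[k] U}
    {F : X ⊗[k] U →ₗ[k] U ⊗[k] X} {b : X ⊗[k] Y →ₗ[k] Y ⊗[k] X} {b' : X ⊗[k] Y' →ₗ[k] Y' ⊗[k] X}
    (hF : ∀ x y y', F (x ⊗ₜ c (y ⊗ₜ y')) = TensorProduct.map c LinearMap.id
      ((TensorProduct.assoc k _ _ _).symm (TensorProduct.map LinearMap.id b'
        (map₁₂ _ b (x ⊗ₜ (y ⊗ₜ y'))))))
    (d : X ⊗[k] W →ₗ[k] X₂) (x : X) (y : Y) (t : Y' ⊗[k] W) :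
    TensorProduct.map LinearMap.id d (map₁₂ _ F (x ⊗ₜ TensorProduct.map c LinearMap.id
        ((TensorProduct.assoc k _ _ _).symm (y ⊗ₜ t)))) =
      TensorProduct.map c LinearMap.id ((TensorProduct.assoc k _ _ _).symm
        (TensorProduct.map LinearMap.id (TensorProduct.map LinearMap.id d ∘ₗ map₁₂ _ b')
          (TensorProduct.assoc k _ _ _ (b (x ⊗ₜ y) ⊗ₜ t)))) := by
  induction t using TensorProduct.induction_on with
  | zero => simp
  | add x y hx hy => simp only [map_add, TensorProduct.tmul_add, hx, hy]
  | tmul y' v =>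
  rw [TensorProduct.assoc_symm_tmul, TensorProduct.map_tmul, map₁₂_tmul, hF, map₁₂_tmul]
  generalize b (x ⊗ₜ y) = s
  induction s using TensorProduct.induction_on with
  | zero => simp
  | add x y hx hy => simp only [map_add, TensorProduct.add_tmul, hx, hy]
  | tmul y x =>
  rw [TensorProduct.assoc_tmul, TensorProduct.map_tmul, TensorProduct.assoc_tmul,
    TensorProduct.map_tmul, LinearMap.comp_apply, map₁₂_tmul]
  generalize b' (x ⊗ₜ y') = s
  induction s using TensorProduct.induction_on with
  | zero => simp
  | add x y hx hy => simp only [map_add, TensorProduct.add_tmul, TensorProduct.tmul_add, hx, hy]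
  | tmul y x => simp

end Generic

variable {V : Type*} [AddCommGroup V] [Module k V] (σ : V ⊗[k] V →ₗ[k] V ⊗[k] V)

theorem concat_word_nil {N : ℕ} (h : N = N + 0) (x : ⨂[k]^N V) :
    concat h x (word k 0 []) = x := by
  induction x using word_induction with
  | hadd _ _ h h' => simp only [map_add, LinearMap.add_apply, h, h']
  | hsmul _ _ h => simp only [map_smul, LinearMap.smul_apply, h]
  | hw u hu => rw [concat_word _ hu (w := []) (n := 0) rfl, List.append_nil]

theorem word_nil_concat {N : ℕ} (h : N = 0 + N) (x : ⨂[k]^N V) :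
    concat h (word k 0 []) x = x := by
  induction x using word_induction with
  | hadd _ _ h h' => simp only [map_add, h, h']
  | hsmul _ _ h => simp only [map_smul, h]
  | hw u hu => rw [concat_word _ (u := []) (m := 0) rfl hu, List.nil_append]

theorem pow_zero_induction {C : ⨂[k]^0 V → Prop} (x : ⨂[k]^0 V) (h1 : C (word k 0 []))
    (hadd : ∀ x y, C x → C y → C (x + y)) (hsmul : ∀ (r : k) x, C x → C (r • x)) : C x := by
  induction x using word_induction with
  | hadd _ _ h h' => exact hadd _ _ h h'
  | hsmul _ _ h => exact hsmul _ _ h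
  | hw u hu => rw [List.length_eq_zero_iff] at hu; rwa [hu]

theorem beta_nil_left {n : ℕ} (y : ⨂[k]^n V) :
    beta σ 0 n (word k 0 [] ⊗ₜ y) = y ⊗ₜ word k 0 [] := by
  apply (concatEquiv (k := k) (V := V) (N := n) rfl).injective
  rw [concatEquiv_beta σ (by omega), braidBlocks, concatEquiv_tmul, concatEquiv_tmul,
    word_nil_concat, concat_word_nil]
  rfl

theorem braidBlocks_zero {N : ℕ} (m : ℕ) (x : ⨂[k]^N V) : braidBlocks σ N 0 m x = x := by
  induction m with
  | zero => rfl
  | succ m ih => simpa [braidBlocks, braidPast] using ih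

theorem beta_nil_right {n : ℕ} (y : ⨂[k]^n V) :
    beta σ n 0 (y ⊗ₜ word k 0 []) = word k 0 [] ⊗ₜ y := by
  apply (concatEquiv (k := k) (V := V) (N := n) (by omega)).injective
  rw [concatEquiv_beta σ (by omega), braidBlocks_zero, concatEquiv_tmul, concatEquiv_tmul,
    word_nil_concat, concat_word_nil]

theorem concatEquiv_assoc {a b c d e N : ℕ} (h₁ : d = a + b) (h₂ : N = d + c) (h₃ : e = b + c)
    (h₄ : N = a + e) (t : ⨂[k]^a V ⊗[k] ⨂[k]^b V) (z : ⨂[k]^c V) :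
    concatEquiv h₄ (TensorProduct.map LinearMap.id (concatEquiv h₃).toLinearMap
      (TensorProduct.assoc k _ _ _ (t ⊗ₜ z))) = concat h₂ (concatEquiv h₁ t) z := by
  induction t using TensorProduct.induction_on with
  | zero => simp
  | add x y hx hy => simp only [map_add, TensorProduct.add_tmul, LinearMap.add_apply, hx, hy]
  | tmul x y => exact (concat_assoc h₁ h₂ h₃ h₄ _ _ _).symm

theorem concatEquiv_assoc_symm {a b c d e N : ℕ} (h₁ : d = a + b) (h₂ : N = d + c) (h₃ : e = b + c)
    (h₄ : N = a + e) (t : ⨂[k]^b V ⊗[k] ⨂[k]^c V) (x : ⨂[k]^a V) :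
    concatEquiv h₂ (TensorProduct.map (concatEquiv h₁).toLinearMap LinearMap.id
      ((TensorProduct.assoc k _ _ _).symm (x ⊗ₜ t))) = concat h₄ x (concatEquiv h₃ t) := by
  induction t using TensorProduct.induction_on with
  | zero => simp
  | add x y hx hy => simp only [map_add, TensorProduct.tmul_add, hx, hy]
  | tmul x y => exact concat_assoc h₁ h₂ h₃ h₄ _ _ _

/-- One step of the recursion for `braidBlocks`: the last factor of the left block crosses the right
block before the other `m` factors do. -/
theorem beta_succ_left {m n M : ℕ} (h : M = m + 1) (x : ⨂[k]^m V) (v : ⨂[k]^1 V) (y : ⨂[k]^n V) :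
    beta σ M n (concat h x v ⊗ₜ y) =
      TensorProduct.map LinearMap.id (concatEquiv h).toLinearMap
        (map₁₂ _ (beta σ m n) (x ⊗ₜ beta σ 1 n (v ⊗ₜ y))) := by
  subst h
  apply (concatEquiv (k := k) (V := V) (N := m + 1 + n) (by omega)).injective
  rw [concatEquiv_beta σ rfl, concatEquiv_tmul, braidBlocks, LinearMap.comp_apply,
    concat_assoc _ _ (rfl : 1 + n = 1 + n) (by omega)]
  have := braidPast_concat_left (M := m + 1 + n) σ (by omega) x 0 n (by omega)
    (concat (rfl : 1 + n = 1 + n) v y)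
  rw [add_zero] at this
  rw [this]
  have : braidPast σ (1 + n) 0 n (concat (rfl : 1 + n = 1 + n) v y) =
      concatEquiv (by omega) (beta σ 1 n (v ⊗ₜ y)) := by
    rw [concatEquiv_beta σ rfl]; rfl
  rw [this]
  generalize beta σ 1 n (v ⊗ₜ y) = t
  induction t using TensorProduct.induction_on with
  | zero => simp
  | add x y hx hy => simp only [map_add, TensorProduct.tmul_add, hx, hy]
  | tmul y v =>
    rw [map₁₂_tmul, concatEquiv_assoc (d := m + n) (by omega) (by omega), concatEquiv_tmul,
      ← concat_assoc (d := m + n) rfl (by omega), braidBlocks_concat_right _ _ _ _ _ le_rfl,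
      concatEquiv_beta σ rfl]
    rfl

/-- The hexagon identity for a concatenation in the first argument. -/
theorem beta_concat_left {m m' n M : ℕ} (h : M = m + m') (x : ⨂[k]^m V) (x' : ⨂[k]^m' V)
    (y : ⨂[k]^n V) :
    beta σ M n (concat h x x' ⊗ₜ y) =
      TensorProduct.map LinearMap.id (concatEquiv h).toLinearMap
        (map₁₂ _ (beta σ m n) (x ⊗ₜ beta σ m' n (x' ⊗ₜ y))) := by
  induction m' generalizing M y with
  | zero =>
    obtain rfl : M = m := h
    induction x' using pow_zero_induction with
    | hadd _ _ h h' => simp only [map_add, TensorProduct.add_tmul, TensorProduct.tmul_add, h, h']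
    | hsmul r _ h =>
      simp only [map_smul, ← TensorProduct.smul_tmul', TensorProduct.tmul_smul, h]
    | h1 =>
      rw [concat_word_nil, beta_nil_left, map₁₂_tmul]
      generalize beta σ M n (x ⊗ₜ y) = t
      induction t using TensorProduct.induction_on with
      | zero => simp
      | add x y hx hy => rw [TensorProduct.add_tmul, map_add, map_add, ← hx, ← hy]
      | tmul c d => exact congrArg (c ⊗ₜ ·) (concat_word_nil rfl d).symm
  | succ m' ih =>
    -- The last strand of `x'` is also the last strand of the whole left block, so splitting it off
    -- lets `beta_succ_left` act on both sides.
    induction x' using concat_induction (N := m' + 1) (m := m') (n := 1) rfl with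
    | hadd _ _ h h' => simp only [map_add, TensorProduct.add_tmul, TensorProduct.tmul_add, h, h']
    | hw x' v =>
    rw [← concat_assoc (rfl : m + m' = m + m') (by omega), beta_succ_left, beta_succ_left]
    generalize beta σ 1 n (v ⊗ₜ y) = t
    induction t using TensorProduct.induction_on with
    | zero => simp
    | add x y hx hy => simp only [map_add, TensorProduct.tmul_add, hx, hy]
    | tmul y v =>
    rw [map₁₂_tmul, map₁₂_tmul, ih]
    generalize beta σ m' n (x' ⊗ₜ y) = t
    induction t using TensorProduct.induction_on with
    | zero => simp
    | add x y hx hy => simp only [map_add, TensorProduct.tmul_add, TensorProduct.add_tmul, hx, hy]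
    | tmul y b =>
    rw [map₁₂_tmul, TensorProduct.assoc_tmul, TensorProduct.map_tmul, map₁₂_tmul]
    generalize beta σ m n (x ⊗ₜ y) = t
    induction t using TensorProduct.induction_on with
    | zero => simp
    | add x y hx hy => simp only [map_add, TensorProduct.add_tmul, hx, hy]
    | tmul c d => exact congrArg (c ⊗ₜ ·) (concat_assoc rfl (by omega) rfl h d b v)

theorem braidPast_add (N a n n' : ℕ) (x : ⨂[k]^N V) :
    braidPast σ N a (n + n') x = braidPast σ N (a + n) n' (braidPast σ N a n x) := by
  induction n' with
  | zero => rfl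
  | succ n' ih => rw [← add_assoc, braidPast, LinearMap.comp_apply, ih, ← add_assoc]; rfl

/-- The hexagon identity for a concatenation in the second argument. -/
theorem beta_concat_right {m n n' N : ℕ} (h : N = n + n') (x : ⨂[k]^m V) (y : ⨂[k]^n V)
    (y' : ⨂[k]^n' V) :
    beta σ m N (x ⊗ₜ concat h y y') =
      TensorProduct.map (concatEquiv h).toLinearMap LinearMap.id
        ((TensorProduct.assoc k _ _ _).symm
          (TensorProduct.map LinearMap.id (beta σ m n')
            (map₁₂ _ (beta σ m n) (x ⊗ₜ (y ⊗ₜ y'))))) := by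
  -- A single strand passes `n + n'` factors by passing `n` of them and then `n'`, which is
  -- `braidPast_add`. The case of `m` strands is then an induction on `m`.
  have one : ∀ (v : ⨂[k]^1 V) (y : ⨂[k]^n V) (y' : ⨂[k]^n' V),
      beta σ 1 N (v ⊗ₜ concat h y y') =
      TensorProduct.map (concatEquiv h).toLinearMap LinearMap.id
        ((TensorProduct.assoc k _ _ _).symm
          (TensorProduct.map LinearMap.id (beta σ 1 n')
            (map₁₂ _ (beta σ 1 n) (v ⊗ₜ (y ⊗ₜ y'))))) := by
    intro v y y'
    subst h
    -- For one strand the product over the left block has a single factor, and `β` is `braidPast`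
    -- started at position `0`.
    have key : ∀ (n N : ℕ) (h : N = 1 + n) (t : ⨂[k]^1 V ⊗[k] ⨂[k]^n V),
        braidPast σ N 0 n (concatEquiv h t) = concatEquiv (by omega) (beta σ 1 n t) := by
      intro n N h t
      rw [concatEquiv_beta σ h]; rfl
    apply (concatEquiv (k := k) (V := V) (N := 1 + (n + n')) (by omega)).injective
    rw [← key _ _ rfl, concatEquiv_tmul, braidPast_add,
      ← concat_assoc (rfl : 1 + n = 1 + n) (by omega),
      braidPast_concat_right _ _ _ _ _ (by omega), ← concatEquiv_tmul rfl v y, key, map₁₂_tmul]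
    generalize beta σ 1 n (v ⊗ₜ y) = t
    induction t using TensorProduct.induction_on with
    | zero => simp
    | add x y hx hy => simp only [map_add, TensorProduct.add_tmul, LinearMap.add_apply, hx, hy]
    | tmul y v =>
    rw [TensorProduct.assoc_tmul, TensorProduct.map_tmul,
      concatEquiv_assoc_symm (e := n' + 1) rfl _ rfl (by omega), ← key _ _ (by omega),
      concatEquiv_tmul, concatEquiv_tmul, concat_assoc (e := n' + 1) _ _ (by omega) (by omega)]
    have := braidPast_concat_left (M := 1 + (n + n')) (N := n' + 1) σ (by omega) y 0 n' (by omega)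
      (concat (by omega) v y')
    rw [add_zero] at this
    rw [zero_add, this]
    rfl
  induction m generalizing y y' with
  | zero =>
    induction x using pow_zero_induction with
    | hadd _ _ h h' => simp only [map_add, TensorProduct.add_tmul, h, h']
    | hsmul r _ h =>
      simp only [map_smul, ← TensorProduct.smul_tmul', h]
    | h1 =>
      rw [beta_nil_left, map₁₂_tmul, beta_nil_left, TensorProduct.assoc_tmul,
        TensorProduct.map_tmul, beta_nil_left]
      rfl
  | succ m ih =>
    induction x using concat_induction (N := m + 1) (m := m) (n := 1) rfl with
    | hadd _ _ h h' => simp only [map_add, TensorProduct.add_tmul, h, h']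
    | hw x v =>
    rw [beta_succ_left, one, map₁₂_tmul, map₁₂_tmul, beta_succ_left]
    generalize beta σ 1 n (v ⊗ₜ y) = t
    induction t using TensorProduct.induction_on with
    | zero => simp
    | add x y hx hy => simp only [map_add, TensorProduct.add_tmul, TensorProduct.tmul_add, hx, hy]
    | tmul y v =>
    rw [TensorProduct.assoc_tmul, TensorProduct.map_tmul, map₁₂_tmul]
    refine (map₁₂_map_assoc_symm (c := (concatEquiv h).toLinearMap) (F := beta σ m N)
      (b := beta σ m n) (b' := beta σ m n') (fun x y y' => ih x y y') _ x y
      (beta σ 1 n' (v ⊗ₜ y'))).trans ?_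
    generalize beta σ m n (x ⊗ₜ y) = s
    induction s using TensorProduct.induction_on with
    | zero => simp
    | add x y hx hy => simp only [map_add, TensorProduct.add_tmul, hx, hy]
    | tmul y x =>
      simp only [TensorProduct.assoc_tmul, TensorProduct.map_tmul, LinearMap.comp_apply,
        LinearEquiv.coe_coe, concatEquiv_tmul]
      rw [beta_succ_left]
      rfl

end Hexagon

-- Maps between tensor powers that slide past all braidings `β`.

section Natural

variable {k : Type*} [Field k] {V : Type*} [AddCommGroup V] [Module k V]
  (σ : V ⊗[k] V →ₗ[k] V ⊗[k] V)

/-- A map between tensor powers that the braidings `β` slide past. -/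
structure IsNatural {a b : ℕ} (f : ⨂[k]^a V →ₗ[k] ⨂[k]^b V) : Prop where
  left : ∀ {m : ℕ} (x : ⨂[k]^a V) (y : ⨂[k]^m V),
    beta σ b m (f x ⊗ₜ y) = TensorProduct.map LinearMap.id f (beta σ a m (x ⊗ₜ y))
  right : ∀ {m : ℕ} (x : ⨂[k]^a V) (y : ⨂[k]^m V),
    beta σ m b (y ⊗ₜ f x) = TensorProduct.map f LinearMap.id (beta σ m a (y ⊗ₜ x))

variable {σ}

theorem IsNatural.id (a : ℕ) : IsNatural σ (LinearMap.id : ⨂[k]^a V →ₗ[k] ⨂[k]^a V) :=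
  ⟨fun x y => by simp, fun x y => by simp⟩

theorem IsNatural.comp {a b c : ℕ} {g : ⨂[k]^b V →ₗ[k] ⨂[k]^c V} {f : ⨂[k]^a V →ₗ[k] ⨂[k]^b V}
    (hg : IsNatural σ g) (hf : IsNatural σ f) : IsNatural σ (g ∘ₗ f) :=
  ⟨fun x y => by
    rw [LinearMap.comp_apply, hg.left, hf.left, ← LinearMap.comp_apply, ← TensorProduct.map_comp,
      LinearMap.id_comp],
  fun x y => by
    rw [LinearMap.comp_apply, hg.right, hf.right, ← LinearMap.comp_apply, ← TensorProduct.map_comp,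
      LinearMap.id_comp]⟩

theorem IsNatural.cast {a b : ℕ} (h : a = b) :
    IsNatural σ (TensorPower.cast k V h).toLinearMap := by
  subst h
  rw [TensorPower.cast_refl]
  exact .id a

/-- By the hexagon identities, crossing a concatenation means crossing its two parts in turn; `f`
and `g` are moved through one crossing each. -/
theorem IsNatural.concat {a a' b b' N N' : ℕ} {f : ⨂[k]^a V →ₗ[k] ⨂[k]^a' V}
    {g : ⨂[k]^b V →ₗ[k] ⨂[k]^b' V} {F : ⨂[k]^N V →ₗ[k] ⨂[k]^N' V} (hf : IsNatural σ f)
    (hg : IsNatural σ g) (h : N = a + b) (h' : N' = a' + b')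
    (hF : ∀ x y, F (BraidedTree.concat h x y) = BraidedTree.concat h' (f x) (g y)) :
    IsNatural σ F := by
  have hF' : F ∘ₗ (concatEquiv h).toLinearMap =
      (concatEquiv h').toLinearMap ∘ₗ TensorProduct.map f g := TensorProduct.ext' hF
  constructor
  · intro m x z
    induction x using concat_induction h with
    | hadd _ _ h h' => simp only [map_add, TensorProduct.add_tmul, h, h']
    | hw x y =>
    rw [hF, beta_concat_left, beta_concat_left, hg.left]
    generalize beta σ b m (y ⊗ₜ z) = t
    induction t using TensorProduct.induction_on with
    | zero => simp
    | add x y hx hy => simp only [map_add, TensorProduct.tmul_add, hx, hy]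
    | tmul z y =>
    rw [TensorProduct.map_tmul, map₁₂_tmul, map₁₂_tmul, LinearMap.id_apply, hf.left]
    generalize beta σ a m (x ⊗ₜ z) = t
    induction t using TensorProduct.induction_on with
    | zero => simp
    | add x y hx hy => simp only [map_add, TensorProduct.add_tmul, hx, hy]
    | tmul z x => exact congrArg (z ⊗ₜ ·) (hF x y).symm
  · intro m x z
    induction x using concat_induction h with
    | hadd _ _ h h' => simp only [map_add, TensorProduct.tmul_add, h, h']
    | hw x y =>
    rw [hF, beta_concat_right, beta_concat_right, map₁₂_tmul, map₁₂_tmul, hf.right]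
    generalize beta σ m a (z ⊗ₜ x) = t
    induction t using TensorProduct.induction_on with
    | zero => simp
    | add x y hx hy => simp only [map_add, TensorProduct.add_tmul, hx, hy]
    | tmul x z =>
    rw [TensorProduct.map_tmul, TensorProduct.assoc_tmul, TensorProduct.assoc_tmul,
      TensorProduct.map_tmul, TensorProduct.map_tmul, LinearMap.id_apply, hg.right]
    generalize beta σ m b (z ⊗ₜ y) = t
    induction t using TensorProduct.induction_on with
    | zero => simp
    | add x y hx hy => simp only [map_add, TensorProduct.tmul_add, hx, hy]
    | tmul y z => exact congrArg (· ⊗ₜ z) (hF x y).symm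

/-- It suffices to slide past one strand: a hexagon identity splits a block of `m + 1` strands into
`m` strands and one. This reduces naturality of `σ` and of a product to their defining identities.
-/
theorem IsNatural.of_one {a b : ℕ} {f : ⨂[k]^a V →ₗ[k] ⨂[k]^b V}
    (left : ∀ (x : ⨂[k]^a V) (y : ⨂[k]^1 V),
      beta σ b 1 (f x ⊗ₜ y) = TensorProduct.map LinearMap.id f (beta σ a 1 (x ⊗ₜ y)))
    (right : ∀ (x : ⨂[k]^a V) (y : ⨂[k]^1 V),
      beta σ 1 b (y ⊗ₜ f x) = TensorProduct.map f LinearMap.id (beta σ 1 a (y ⊗ₜ x))) :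
    IsNatural σ f := by
  constructor
  · intro m x y
    induction m generalizing x with
    | zero =>
      induction y using pow_zero_induction with
      | hadd _ _ h h' => simp only [map_add, TensorProduct.tmul_add, h, h']
      | hsmul r _ h => simp only [map_smul, TensorProduct.tmul_smul, h]
      | h1 => rw [beta_nil_right, beta_nil_right]; rfl
    | succ m ih =>
      induction y using concat_induction (N := m + 1) (m := m) (n := 1) rfl with
      | hadd _ _ h h' => simp only [map_add, TensorProduct.tmul_add, h, h']
      | hw y v =>
      rw [beta_concat_right, beta_concat_right, map₁₂_tmul, map₁₂_tmul, ih]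
      generalize beta σ a m (x ⊗ₜ y) = t
      induction t using TensorProduct.induction_on with
      | zero => simp
      | add x y hx hy => simp only [map_add, TensorProduct.add_tmul, hx, hy]
      | tmul y x =>
      rw [TensorProduct.map_tmul, TensorProduct.assoc_tmul, TensorProduct.assoc_tmul,
        TensorProduct.map_tmul, TensorProduct.map_tmul, left]
      generalize beta σ a 1 (x ⊗ₜ v) = t
      induction t using TensorProduct.induction_on with
      | zero => simp
      | add x y hx hy => simp only [map_add, TensorProduct.tmul_add, hx, hy]
      | tmul v x => rfl
  · intro m x y
    induction m generalizing x with
    | zero =>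
      induction y using pow_zero_induction with
      | hadd _ _ h h' => simp only [map_add, TensorProduct.add_tmul, h, h']
      | hsmul r _ h => simp only [map_smul, ← TensorProduct.smul_tmul', h]
      | h1 => rw [beta_nil_left, beta_nil_left]; rfl
    | succ m ih =>
      induction y using concat_induction (N := m + 1) (m := m) (n := 1) rfl with
      | hadd _ _ h h' => simp only [map_add, TensorProduct.add_tmul, h, h']
      | hw y v =>
      rw [beta_concat_left, beta_concat_left, right]
      generalize beta σ 1 a (v ⊗ₜ x) = t
      induction t using TensorProduct.induction_on with
      | zero => simp
      | add x y hx hy => simp only [map_add, TensorProduct.tmul_add, hx, hy]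
      | tmul x v =>
      rw [TensorProduct.map_tmul, map₁₂_tmul, map₁₂_tmul, ih]
      generalize beta σ m a (y ⊗ₜ x) = t
      induction t using TensorProduct.induction_on with
      | zero => simp
      | add x y hx hy => simp only [map_add, TensorProduct.add_tmul, hx, hy]
      | tmul x y => rfl

theorem IsNatural.applyAt {a b : ℕ} (p q : ℕ) {f : ⨂[k]^a V →ₗ[k] ⨂[k]^b V} (hf : IsNatural σ f) :
    IsNatural σ (applyAt p q f) := by
  let G : ⨂[k]^(p + a) V →ₗ[k] ⨂[k]^(p + b) V :=
    TensorPower.mulEquiv.toLinearMap ∘ₗ TensorProduct.map LinearMap.id f ∘ₗ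
      TensorPower.mulEquiv.symm.toLinearMap
  have hG : IsNatural σ G := by
    refine (IsNatural.id p).concat hf rfl rfl fun x y => ?_
    rw [← mulEquiv_tmul, ← mulEquiv_tmul]
    simp [G]
  refine hG.concat (IsNatural.id q) rfl rfl fun x y => ?_
  rw [← mulEquiv_tmul, ← mulEquiv_tmul]
  simp [BraidedTree.applyAt, G]

theorem beta_concat_left_assoc {m m' n M : ℕ} (h : M = m + m')
    (t : ⨂[k]^m V ⊗[k] (⨂[k]^m' V ⊗[k] ⨂[k]^n V)) :
    beta σ M n (TensorProduct.map (concatEquiv h).toLinearMap LinearMap.id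
        ((TensorProduct.assoc k _ _ _).symm t)) =
      TensorProduct.map LinearMap.id (concatEquiv h).toLinearMap
        (map₁₂ _ (beta σ m n) (TensorProduct.map LinearMap.id (beta σ m' n) t)) := by
  induction t using TensorProduct.induction_on with
  | zero => simp
  | add x y hx hy => simp only [map_add, hx, hy]
  | tmul x t =>
  induction t using TensorProduct.induction_on with
  | zero => simp
  | add x y hx hy => simp only [map_add, TensorProduct.tmul_add, hx, hy]
  | tmul y z => exact beta_concat_left σ h x y z

theorem beta_concat_right_assoc {m n n' N : ℕ} (h : N = n + n')
    (t : ⨂[k]^m V ⊗[k] (⨂[k]^n V ⊗[k] ⨂[k]^n' V)) :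
    beta σ m N (TensorProduct.map LinearMap.id (concatEquiv h).toLinearMap t) =
      TensorProduct.map (concatEquiv h).toLinearMap LinearMap.id
        ((TensorProduct.assoc k _ _ _).symm
          (TensorProduct.map LinearMap.id (beta σ m n') (map₁₂ _ (beta σ m n) t))) := by
  induction t using TensorProduct.induction_on with
  | zero => simp
  | add x y hx hy => simp only [map_add, hx, hy]
  | tmul x t =>
  induction t using TensorProduct.induction_on with
  | zero => simp
  | add x y hx hy => simp only [map_add, TensorProduct.tmul_add, hx, hy]
  | tmul y z => exact beta_concat_right σ h x y z

theorem powTwo_concatEquiv (t : ⨂[k]^1 V ⊗[k] ⨂[k]^1 V) :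
    powTwo (concatEquiv rfl t) =
      TensorProduct.map powOne.toLinearMap powOne.toLinearMap t := by
  induction t using TensorProduct.induction_on with
  | zero => simp
  | add x y hx hy => simp only [map_add, hx, hy]
  | tmul x y => exact powTwo_concat x y

-- On two strands the reduced expression is the single letter `σ`; empty words on both sides bring
-- `braidAt_concat` to this case.
variable (σ) in
theorem powBraid_concatEquiv (t : ⨂[k]^1 V ⊗[k] ⨂[k]^1 V) :
    powBraid σ (concatEquiv rfl t) = concatEquiv rfl (beta σ 1 1 t) := by
  rw [concatEquiv_beta σ rfl]
  have := braidAt_concat σ (N := 2) (i := 0) (q := 0) rfl rfl (word k 0 [])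
    (concatEquiv rfl t) (word k 0 [])
  rw [word_nil_concat, word_nil_concat, concat_word_nil, concat_word_nil] at this
  exact this.symm

variable (σ) in
theorem map_powOne_beta (t : ⨂[k]^1 V ⊗[k] ⨂[k]^1 V) :
    σ (TensorProduct.map powOne.toLinearMap powOne.toLinearMap t) =
      TensorProduct.map powOne.toLinearMap powOne.toLinearMap (beta σ 1 1 t) := by
  rw [← powTwo_concatEquiv, ← powTwo_concatEquiv, ← powBraid_concatEquiv]
  simp [powBraid]

end Natural

-- The Yang-Baxter equation for blocks; naturality of `σ` and of a compatible product.

section YangBaxter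

variable {k : Type*} [Field k] {V : Type*} [AddCommGroup V] [Module k V]
  {σ : V ⊗[k] V →ₗ[k] V ⊗[k] V}

theorem map_map_apply {X Y Z X' Y' Z' : Type*} [AddCommMonoid X] [Module k X] [AddCommMonoid Y]
    [Module k Y] [AddCommMonoid Z] [Module k Z] [AddCommMonoid X'] [Module k X'] [AddCommMonoid Y']
    [Module k Y'] [AddCommMonoid Z'] [Module k Z'] (f : X →ₗ[k] Y) (g : Y →ₗ[k] Z)
    (f' : X' →ₗ[k] Y') (g' : Y' →ₗ[k] Z') (t : X ⊗[k] X') :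
    TensorProduct.map g g' (TensorProduct.map f f' t) =
      TensorProduct.map (g ∘ₗ f) (g' ∘ₗ f') t := by
  rw [TensorProduct.map_comp]; rfl

theorem assoc_symm_map₁₂ {X Y Z X' Y' : Type*} [AddCommMonoid X] [Module k X] [AddCommMonoid Y]
    [Module k Y] [AddCommMonoid Z] [Module k Z] [AddCommMonoid X'] [Module k X'] [AddCommMonoid Y']
    [Module k Y'] (f : X ⊗[k] Y →ₗ[k] Y' ⊗[k] X') (t : X ⊗[k] (Y ⊗[k] Z)) :
    (TensorProduct.assoc k Y' X' Z).symm (map₁₂ Z f t) =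
      TensorProduct.map f LinearMap.id ((TensorProduct.assoc k X Y Z).symm t) := by
  simp [map₁₂]

theorem map_powOne_injective : Function.Injective
    (TensorProduct.map (powOne (k := k) (V := V)).toLinearMap
      (powOne (k := k) (V := V)).toLinearMap) :=
  (TensorProduct.congr powOne powOne).injective

theorem map_powOne_powOne_injective : Function.Injective
    (TensorProduct.map (powOne (k := k) (V := V)).toLinearMap
      (TensorProduct.map (powOne (k := k) (V := V)).toLinearMap
        (powOne (k := k) (V := V)).toLinearMap)) :=
  (TensorProduct.congr powOne (TensorProduct.congr powOne powOne)).injective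

variable (σ) in
theorem act₁_map_powOne (t : ⨂[k]^1 V ⊗[k] (⨂[k]^1 V ⊗[k] ⨂[k]^1 V)) :
    act₁ σ (TensorProduct.map powOne.toLinearMap
        (TensorProduct.map powOne.toLinearMap powOne.toLinearMap) t) =
      TensorProduct.map powOne.toLinearMap
        (TensorProduct.map powOne.toLinearMap powOne.toLinearMap) (map₁₂ _ (beta σ 1 1) t) :=
  map₁₂_map _ (map_powOne_beta σ) t

variable (σ) in
theorem act₂_map_powOne (t : ⨂[k]^1 V ⊗[k] (⨂[k]^1 V ⊗[k] ⨂[k]^1 V)) :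
    act₂ σ (TensorProduct.map powOne.toLinearMap
        (TensorProduct.map powOne.toLinearMap powOne.toLinearMap) t) =
      TensorProduct.map powOne.toLinearMap
        (TensorProduct.map powOne.toLinearMap powOne.toLinearMap)
        (TensorProduct.map LinearMap.id (beta σ 1 1) t) := by
  rw [act₂, map_map_apply, map_map_apply]
  congr 2
  exact TensorProduct.ext' fun x y => map_powOne_beta σ (x ⊗ₜ y)

theorem beta_one_yang_baxter (hσ : IsBraiding σ)
    (t : ⨂[k]^1 V ⊗[k] (⨂[k]^1 V ⊗[k] ⨂[k]^1 V)) :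
    map₁₂ _ (beta σ 1 1) (TensorProduct.map LinearMap.id (beta σ 1 1)
        (map₁₂ _ (beta σ 1 1) t)) =
      TensorProduct.map LinearMap.id (beta σ 1 1) (map₁₂ _ (beta σ 1 1)
        (TensorProduct.map LinearMap.id (beta σ 1 1) t)) := by
  apply map_powOne_powOne_injective
  rw [← act₁_map_powOne, ← act₂_map_powOne, ← act₁_map_powOne, ← act₂_map_powOne,
    ← act₁_map_powOne, ← act₂_map_powOne]
  exact LinearMap.congr_fun hσ _

theorem powBraid_comp_concatEquiv :
    powBraid σ ∘ₗ (concatEquiv (k := k) (V := V) (N := 2) (m := 1) (n := 1) rfl).toLinearMap =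
      (concatEquiv rfl).toLinearMap ∘ₗ beta σ 1 1 :=
  LinearMap.ext (powBraid_concatEquiv σ)

/-- Once the crossing of two strands with a third is expanded by a hexagon identity, sliding `σ`
through it is the Yang-Baxter equation on three strands. -/
theorem isNatural_powBraid (hσ : IsBraiding σ) : IsNatural σ (powBraid σ) := by
  refine .of_one (fun x y => ?_) (fun x y => ?_) <;>
    obtain ⟨t, rfl⟩ := (concatEquiv (k := k) (V := V) (N := 2) (m := 1) (n := 1) rfl).surjective x
  · have h1 := beta_concat_left_assoc (σ := σ) (M := 2) (m := 1) (m' := 1) (n := 1) rfl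
      (TensorProduct.assoc k _ _ _ (t ⊗ₜ y))
    have h2 := beta_concat_left_assoc (σ := σ) (m := 1) (m' := 1) (n := 1) rfl
      (TensorProduct.assoc k _ _ _ (beta σ 1 1 t ⊗ₜ y))
    rw [LinearEquiv.symm_apply_apply, TensorProduct.map_tmul] at h1 h2
    rw [powBraid_concatEquiv]
    refine h2.trans ?_
    refine Eq.trans ?_ (congrArg _ h1.symm)
    rw [map_map_apply, powBraid_comp_concatEquiv, LinearMap.id_comp]
    have h3 := beta_one_yang_baxter hσ (TensorProduct.assoc k _ _ _ (t ⊗ₜ y))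
    have h4 : map₁₂ _ (beta σ 1 1) (TensorProduct.assoc k _ _ _ (t ⊗ₜ y)) =
      TensorProduct.assoc k _ _ _ (beta σ 1 1 t ⊗ₜ y) := by
      simp [map₁₂]
    rw [h4] at h3
    rw [h3, map_map_apply, LinearMap.id_comp]
  · have h1 := beta_concat_right_assoc (σ := σ) (m := 1) (n := 1) (n' := 1) rfl (y ⊗ₜ t)
    have h2 := beta_concat_right_assoc (σ := σ) (m := 1) (n := 1) (n' := 1) rfl (y ⊗ₜ beta σ 1 1 t)
    rw [TensorProduct.map_tmul] at h1 h2
    rw [powBraid_concatEquiv]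
    refine h2.trans ?_
    refine Eq.trans ?_ (congrArg _ h1.symm)
    rw [map_map_apply, powBraid_comp_concatEquiv, LinearMap.id_comp]
    have h3 := beta_one_yang_baxter hσ (y ⊗ₜ t)
    rw [TensorProduct.map_tmul, LinearMap.id_apply] at h3
    rw [← h3, assoc_symm_map₁₂, map_map_apply, LinearMap.id_comp]

theorem isNatural_braidAt (hσ : IsBraiding σ) (N i : ℕ) : IsNatural σ (braidAt σ N i) := by
  rw [braidAt]
  split_ifs with h
  · exact (IsNatural.cast _).comp (((isNatural_powBraid hσ).applyAt _ _).comp (.cast _))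
  · exact .id N

theorem isNatural_braidBlocks (hσ : IsBraiding σ) (N n m : ℕ) :
    IsNatural σ (braidBlocks σ N n m) := by
  have h : ∀ a n, IsNatural σ (braidPast σ N a n) := by
    intro a n
    induction n with
    | zero => exact .id N
    | succ n ih => exact (isNatural_braidAt hσ N _).comp ih
  induction m with
  | zero => exact .id N
  | succ m ih => exact ih.comp (h m n)

/-- The crossing of the blocks of `m` and `n` strands is a composite of local copies of `σ`, hence
natural, hence slides past the third block. Expanding the crossings with the third block by the
hexagon identity turns this into the Yang-Baxter equation for `β`. -/
theorem beta_yang_baxter (hσ : IsBraiding σ) {m n p : ℕ}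
    (t : ⨂[k]^m V ⊗[k] (⨂[k]^n V ⊗[k] ⨂[k]^p V)) :
    map₁₂ _ (beta σ n p) (TensorProduct.map LinearMap.id (beta σ m p)
        (map₁₂ _ (beta σ m n) t)) =
      TensorProduct.map LinearMap.id (beta σ m n) (map₁₂ _ (beta σ m p)
        (TensorProduct.map LinearMap.id (beta σ n p) t)) := by
  have hF : braidBlocks σ (m + n) n m ∘ₗ (concatEquiv (k := k) (V := V) rfl).toLinearMap =
      (concatEquiv (Nat.add_comm m n)).toLinearMap ∘ₗ beta σ m n :=
    LinearMap.ext fun t => (concatEquiv_beta σ rfl (Nat.add_comm m n) t).symm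
  -- The blocks of `n` and `m` strands on the right are concatenated, which loses nothing, so that
  -- naturality of `braidBlocks` on `m + n` strands applies.
  apply (TensorProduct.congr (LinearEquiv.refl k _)
    (concatEquiv (k := k) (V := V) (Nat.add_comm m n))).injective
  obtain ⟨t, rfl⟩ := (TensorProduct.assoc k _ _ _).surjective t
  induction t using TensorProduct.induction_on with
  | zero => simp only [map_zero]
  | add x y hx hy => simp only [map_add, hx, hy]
  | tmul t y =>
  have h1 := beta_concat_left_assoc (σ := σ) (m := m) (m' := n) (n := p) rfl
    (TensorProduct.assoc k _ _ _ (t ⊗ₜ y))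
  have h2 := beta_concat_left_assoc (σ := σ) (m := n) (m' := m) (n := p) (Nat.add_comm m n)
    (TensorProduct.assoc k _ _ _ (beta σ m n t ⊗ₜ y))
  rw [LinearEquiv.symm_apply_apply, TensorProduct.map_tmul] at h1 h2
  have h4 : map₁₂ _ (beta σ m n) (TensorProduct.assoc k _ _ _ (t ⊗ₜ y)) =
    TensorProduct.assoc k _ _ _ (beta σ m n t ⊗ₜ y) := by
    simp [map₁₂]
  rw [h4]
  rw [LinearEquiv.coe_coe, LinearMap.id_apply] at h1 h2
  have h5 := (isNatural_braidBlocks hσ (m + n) n m).left (concatEquiv rfl t) y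
  rw [← concatEquiv_beta σ rfl (Nat.add_comm m n), h1, h2, map_map_apply, hF] at h5
  refine h5.trans ?_
  change _ = TensorProduct.map LinearMap.id (concatEquiv (Nat.add_comm m n)).toLinearMap _
  rw [map_map_apply]

/-- A binary product as a map `V^{⊗2} → V^{⊗1}`. -/
def powMul (μ : V ⊗[k] V →ₗ[k] V) : ⨂[k]^2 V →ₗ[k] ⨂[k]^1 V :=
  powOne.symm.toLinearMap ∘ₗ μ ∘ₗ powTwo.toLinearMap

theorem powOne_comp_powMul (μ : V ⊗[k] V →ₗ[k] V) :
    (powOne.toLinearMap ∘ₗ powMul μ) ∘ₗ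
      (concatEquiv (k := k) (V := V) (N := 2) (m := 1) (n := 1) rfl).toLinearMap =
      μ ∘ₗ TensorProduct.map powOne.toLinearMap powOne.toLinearMap := by
  refine LinearMap.ext fun t => ?_
  simp only [powMul, LinearMap.comp_apply, LinearEquiv.coe_coe, LinearEquiv.apply_symm_apply]
  exact congrArg μ (powTwo_concatEquiv t)

/-- The two compatibility identities are exactly the two rules for sliding the product past one
strand. -/
theorem isNatural_powMul {μ : V ⊗[k] V →ₗ[k] V} (h : IsBraidCompatible σ μ) :
    IsNatural σ (powMul μ) := by
  refine .of_one (fun x y => ?_) (fun x y => ?_) <;>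
    obtain ⟨t, rfl⟩ := (concatEquiv (k := k) (V := V) (N := 2) (m := 1) (n := 1) rfl).surjective x
    <;> apply map_powOne_injective <;> rw [← map_powOne_beta]
  · have h1 := beta_concat_left_assoc (σ := σ) (m := 1) (m' := 1) (n := 1) rfl
      (TensorProduct.assoc k _ _ _ (t ⊗ₜ y))
    rw [LinearEquiv.symm_apply_apply, TensorProduct.map_tmul] at h1
    refine Eq.trans ?_ (congrArg _ (congrArg _ h1.symm))
    rw [map_map_apply, map_map_apply, powOne_comp_powMul, LinearMap.comp_id, LinearMap.comp_id]
    have h2 := LinearMap.congr_fun h.left (TensorProduct.map powOne.toLinearMap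
        (TensorProduct.map powOne.toLinearMap powOne.toLinearMap)
        (TensorProduct.assoc k _ _ _ (t ⊗ₜ y)))
    simp only [LinearMap.comp_apply, LinearEquiv.coe_coe] at h2
    rw [act₂_map_powOne, act₁_map_powOne, map_map_apply] at h2
    refine Eq.trans ?_ h2
    rw [TensorProduct.map_map_assoc, LinearEquiv.symm_apply_apply, TensorProduct.map_tmul,
      TensorProduct.map_tmul, TensorProduct.map_tmul]
    exact congrArg (fun s => σ (s ⊗ₜ powOne y)) (LinearMap.congr_fun (powOne_comp_powMul μ) t)
  · have h1 := beta_concat_right_assoc (σ := σ) (m := 1) (n := 1) (n' := 1) rfl (y ⊗ₜ t)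
    rw [TensorProduct.map_tmul] at h1
    refine Eq.trans ?_ (congrArg _ (congrArg _ h1.symm))
    rw [map_map_apply, map_map_apply, powOne_comp_powMul, LinearMap.comp_id, LinearMap.comp_id]
    have h2 := LinearMap.congr_fun h.right (TensorProduct.map powOne.toLinearMap
        (TensorProduct.map powOne.toLinearMap powOne.toLinearMap) (y ⊗ₜ t))
    simp only [LinearMap.comp_apply, LinearEquiv.coe_coe] at h2
    rw [act₁_map_powOne, act₂_map_powOne] at h2
    refine Eq.trans ?_ (h2.trans ?_)
    · rw [TensorProduct.map_tmul, TensorProduct.map_tmul, TensorProduct.map_tmul]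
      exact congrArg (fun s => σ (powOne y ⊗ₜ s)) (LinearMap.congr_fun (powOne_comp_powMul μ) t)
    · rw [← TensorProduct.map_map_assoc_symm, map_map_apply]
      rfl

end YangBaxter

-- The braiding `σ_AT` on spaces of decorated trees.

section TreeBraiding

variable {k : Type*} [Field k] {V : Type*} [AddCommGroup V] [Module k V]
  {σ : V ⊗[k] V →ₗ[k] V ⊗[k] V}

theorem treeSpace_hom_ext {X : Set PTree} {M : Type*} [AddCommMonoid M] [Module k M]
    {f g : TreeSpace k V X →ₗ[k] M}
    (h : ∀ T (hT : T ∈ X), f ∘ₗ ofShape T hT = g ∘ₗ ofShape T hT) : f = g :=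
  DirectSum.linearMap_ext k fun T => h T.1 T.2

theorem treeSpace_tensor_hom_ext {X Y : Set PTree} {M : Type*} [AddCommMonoid M] [Module k M]
    {f g : TreeSpace k V X ⊗[k] TreeSpace k V Y →ₗ[k] M}
    (h : ∀ S (hS : S ∈ X) T (hT : T ∈ Y),
      f ∘ₗ TensorProduct.map (ofShape S hS) (ofShape T hT) =
        g ∘ₗ TensorProduct.map (ofShape S hS) (ofShape T hT)) : f = g := by
  refine TensorProduct.ext (treeSpace_hom_ext fun S hS => LinearMap.ext fun x =>
    treeSpace_hom_ext fun T hT => LinearMap.ext fun y => ?_)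
  exact LinearMap.congr_fun (h S hS T hT) (x ⊗ₜ y)

theorem treeSpace_tensor₃_hom_ext {X : Set PTree} {M : Type*} [AddCommMonoid M] [Module k M]
    {f g : TreeSpace k V X ⊗[k] (TreeSpace k V X ⊗[k] TreeSpace k V X) →ₗ[k] M}
    (h : ∀ S (hS : S ∈ X) T (hT : T ∈ X) U (hU : U ∈ X) t,
      f (TensorProduct.map (ofShape S hS)
        (TensorProduct.map (ofShape T hT) (ofShape U hU)) t) =
      g (TensorProduct.map (ofShape S hS)
        (TensorProduct.map (ofShape T hT) (ofShape U hU)) t)) : f = g := by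
  refine TensorProduct.ext (treeSpace_hom_ext fun S hS => LinearMap.ext fun x =>
    treeSpace_tensor_hom_ext fun T hT U hU => TensorProduct.ext' fun y z => ?_)
  exact h S hS T hT U hU (x ⊗ₜ (y ⊗ₜ z))

theorem liftPair_ofShape {X Y : Set PTree} {M : Type*} [AddCommMonoid M] [Module k M]
    (b : ∀ (S : X) (T : Y), ⨂[k]^(S.1.angles) V →ₗ[k] ⨂[k]^(T.1.angles) V →ₗ[k] M)
    {S T : PTree} (hS : S ∈ X) (hT : T ∈ Y) (x : ⨂[k]^S.angles V) (y : ⨂[k]^T.angles V) :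
    liftPair b (ofShape S hS x ⊗ₜ ofShape T hT y) = b ⟨S, hS⟩ ⟨T, hT⟩ x y := by
  rw [liftPair, ofShape, ofShape, TensorProduct.lift.tmul, DirectSum.toModule_lof,
    LinearMap.flip_apply, DirectSum.toModule_lof, LinearMap.flip_apply]

theorem treeBraid_map {X : Set PTree} {S T : PTree} (hS : S ∈ X) (hT : T ∈ X)
    (t : ⨂[k]^S.angles V ⊗[k] ⨂[k]^T.angles V) :
    treeBraid σ X (TensorProduct.map (ofShape S hS) (ofShape T hT) t) =
      TensorProduct.map (ofShape T hT) (ofShape S hS) (beta σ S.angles T.angles t) := by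
  induction t using TensorProduct.induction_on with
  | zero => simp only [map_zero]
  | add x y hx hy => simp only [map_add, hx, hy]
  | tmul x y =>
    rw [TensorProduct.map_tmul, treeBraid, liftPair_ofShape]
    rfl

section Act

variable {X : Set PTree} {S T U : PTree} (hS : S ∈ X) (hT : T ∈ X) (hU : U ∈ X)
  (t : ⨂[k]^S.angles V ⊗[k] (⨂[k]^T.angles V ⊗[k] ⨂[k]^U.angles V))

theorem act₁_treeBraid :
    act₁ (treeBraid σ X) (TensorProduct.map (ofShape S hS)
        (TensorProduct.map (ofShape T hT) (ofShape U hU)) t) =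
      TensorProduct.map (ofShape T hT) (TensorProduct.map (ofShape S hS) (ofShape U hU))
        (map₁₂ _ (beta σ _ _) t) :=
  map₁₂_map _ (treeBraid_map hS hT) t

theorem act₂_treeBraid :
    act₂ (treeBraid σ X) (TensorProduct.map (ofShape S hS)
        (TensorProduct.map (ofShape T hT) (ofShape U hU)) t) =
      TensorProduct.map (ofShape S hS) (TensorProduct.map (ofShape U hU) (ofShape T hT))
        (TensorProduct.map LinearMap.id (beta σ _ _) t) := by
  rw [act₂, map_map_apply, map_map_apply, LinearMap.comp_id, LinearMap.id_comp]
  congr 2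
  exact LinearMap.ext fun s => treeBraid_map hT hU s

end Act

theorem isBraiding_treeBraid (hσ : IsBraiding σ) (X : Set PTree) : IsBraiding (treeBraid σ X) := by
  refine treeSpace_tensor₃_hom_ext fun S hS T hT U hU t => ?_
  simp only [LinearMap.comp_apply]
  rw [act₁_treeBraid, act₂_treeBraid, act₁_treeBraid, act₂_treeBraid, act₁_treeBraid,
    act₂_treeBraid, beta_yang_baxter hσ]

theorem list_sum_apply {M N ι : Type*} [AddCommMonoid M] [Module k M] [AddCommMonoid N] [Module k N]
    (l : List ι) (f : ι → M →ₗ[k] N) (x : M) :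
    (l.map f).sum x = (l.map fun i => f i x).sum := by
  induction l with
  | nil => rfl
  | cons a l ih => simp [ih]

theorem freeOp_map {L : PTree → PTree → List PTree}
    (hL : ∀ {S T U}, U ∈ L S T → U ≠ PTree.leaf ∧ U.angles = S.angles + T.angles) {S T : PTree}
    (hS : S ∈ posShapes) (hT : T ∈ posShapes) :
    freeOp (k := k) (V := V) L hL ∘ₗ TensorProduct.map (ofShape S hS) (ofShape T hT) =
      ((L S T).attach.map fun U => ofShape (X := posShapes) U.1 (hL U.2).1 ∘ₗ
        (concatEquiv (hL U.2).2).toLinearMap).sum := by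
  refine TensorProduct.ext' fun x y => ?_
  rw [LinearMap.comp_apply, TensorProduct.map_tmul, freeOp, liftPair_ofShape, list_sum_apply,
    list_sum_apply, list_sum_apply]
  rfl

section Compat

variable {X : Set PTree} {S T U : PTree} {ι : Type*} (l : List ι) {W : ι → PTree}
  (hW : ∀ i, W i ∈ X)

/-- The shapes of the terms are carried along and only the decorations are braided; each term
concatenates decorations, so each contributes one hexagon identity. -/
theorem treeBraid_list_right (hS : S ∈ X) (h : ∀ i, (W i).angles = T.angles + U.angles)
    (t : ⨂[k]^S.angles V ⊗[k] (⨂[k]^T.angles V ⊗[k] ⨂[k]^U.angles V)) :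
    treeBraid σ X (TensorProduct.map (ofShape S hS) (l.map fun i => ofShape (W i) (hW i) ∘ₗ
        (concatEquiv (h i)).toLinearMap).sum t) =
      TensorProduct.map (l.map fun i => ofShape (W i) (hW i) ∘ₗ
        (concatEquiv (h i)).toLinearMap).sum (ofShape S hS) ((TensorProduct.assoc k _ _ _).symm
          (TensorProduct.map LinearMap.id (beta σ _ _) (map₁₂ _ (beta σ _ _) t))) := by
  induction l with
  | nil => simp
  | cons i l ih =>
    simp only [List.map_cons, List.sum_cons]
    rw [TensorProduct.map_add_left, TensorProduct.map_add_right, LinearMap.add_apply,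
      LinearMap.add_apply, map_add, ih]
    congr 1
    have := treeBraid_map (σ := σ) hS (hW i)
      (TensorProduct.map LinearMap.id (concatEquiv (h i)).toLinearMap t)
    rw [map_map_apply, LinearMap.comp_id, beta_concat_right_assoc, map_map_apply,
      LinearMap.comp_id] at this
    exact this

theorem treeBraid_list_left (hU : U ∈ X) (h : ∀ i, (W i).angles = S.angles + T.angles)
    (t : ⨂[k]^S.angles V ⊗[k] (⨂[k]^T.angles V ⊗[k] ⨂[k]^U.angles V)) :
    treeBraid σ X (TensorProduct.map (l.map fun i => ofShape (W i) (hW i) ∘ₗ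
        (concatEquiv (h i)).toLinearMap).sum (ofShape U hU)
          ((TensorProduct.assoc k _ _ _).symm t)) =
      TensorProduct.map (ofShape U hU) (l.map fun i => ofShape (W i) (hW i) ∘ₗ
        (concatEquiv (h i)).toLinearMap).sum
          (map₁₂ _ (beta σ _ _) (TensorProduct.map LinearMap.id (beta σ _ _) t)) := by
  induction l with
  | nil => simp
  | cons i l ih =>
    simp only [List.map_cons, List.sum_cons]
    rw [TensorProduct.map_add_left, TensorProduct.map_add_right, LinearMap.add_apply,
      LinearMap.add_apply, map_add, ih]
    congr 1
    have := treeBraid_map (σ := σ) (hW i) hU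
      (TensorProduct.map (concatEquiv (h i)).toLinearMap LinearMap.id
        ((TensorProduct.assoc k _ _ _).symm t))
    rw [map_map_apply, LinearMap.comp_id, beta_concat_left_assoc, map_map_apply,
      LinearMap.comp_id] at this
    exact this

end Compat

/-- Holds for every rule `L` on shapes that adds numbers of angles, and so serves all three
products: on decorations each of them is mere concatenation. -/
theorem isBraidCompatible_freeOp {L : PTree → PTree → List PTree}
    (hL : ∀ {S T U}, U ∈ L S T → U ≠ PTree.leaf ∧ U.angles = S.angles + T.angles) :
    IsBraidCompatible (treeBraid σ posShapes) (freeOp (k := k) (V := V) L hL) where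
  right := by
    refine treeSpace_tensor₃_hom_ext fun S hS T hT U hU t => ?_
    simp only [LinearMap.comp_apply, LinearEquiv.coe_coe]
    rw [act₁_treeBraid, act₂_treeBraid, ← TensorProduct.map_map_assoc_symm, map_map_apply,
      map_map_apply, freeOp_map, LinearMap.id_comp]
    exact treeBraid_list_right _ _ _ _ _
  left := by
    refine treeSpace_tensor₃_hom_ext fun S hS T hT U hU t => ?_
    simp only [LinearMap.comp_apply, LinearEquiv.coe_coe]
    rw [act₂_treeBraid, act₁_treeBraid, ← TensorProduct.map_map_assoc_symm, map_map_apply,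
      map_map_apply, freeOp_map, LinearMap.id_comp]
    exact treeBraid_list_left _ _ _ _ _

/-- The map of spaces of trees that sends `(T; x)` to `(φ T; c x)`. -/
def shapeMap {X Y : Set PTree} {φ : PTree → PTree} (hφ : ∀ T ∈ X, φ T ∈ Y)
    (c : ∀ T, ⨂[k]^(PTree.angles T) V →ₗ[k] ⨂[k]^((φ T).angles) V) :
    TreeSpace k V X →ₗ[k] TreeSpace k V Y :=
  DirectSum.toModule k X _ fun T => ofShape (φ T.1) (hφ T.1 T.2) ∘ₗ c T.1

section ShapeMap

variable {X Y : Set PTree} {φ : PTree → PTree} (hφ : ∀ T ∈ X, φ T ∈ Y)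
    (c : ∀ T, ⨂[k]^(PTree.angles T) V →ₗ[k] ⨂[k]^((φ T).angles) V)

theorem shapeMap_comp_ofShape {T : PTree} (hT : T ∈ X) :
    shapeMap hφ c ∘ₗ ofShape T hT = ofShape (φ T) (hφ T hT) ∘ₗ c T :=
  LinearMap.ext fun x => by
    rw [LinearMap.comp_apply, ofShape, shapeMap, DirectSum.toModule_lof]

variable (hXY : Y ⊆ X)

theorem incl_comp_ofShape {T : PTree} (hT : T ∈ Y) :
    (incl hXY ∘ₗ ofShape T hT : _ →ₗ[k] TreeSpace k V X) = ofShape T (hXY hT) :=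
  LinearMap.ext fun x => by
    rw [LinearMap.comp_apply, ofShape, incl, DirectSum.toModule_lof]

/-- `σ_AT` exchanges the shapes and applies `β` to the decorations, so a change of shapes
accompanied by natural maps of decorations slides through it. The one-sided forms serve the
idempotent that projects onto lush trees, the two-sided form the homomorphism property. -/
theorem treeBraid_shapeMap_left (hc : ∀ T, IsNatural σ (c T)) :
    treeBraid σ X ∘ₗ TensorProduct.map (incl hXY ∘ₗ shapeMap hφ c) LinearMap.id =
      TensorProduct.map LinearMap.id (incl hXY ∘ₗ shapeMap hφ c) ∘ₗ treeBraid σ X := by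
  refine treeSpace_tensor_hom_ext fun S hS T hT => TensorProduct.ext' fun x y => ?_
  simp only [LinearMap.comp_apply]
  rw [treeBraid_map, map_map_apply, LinearMap.comp_assoc, shapeMap_comp_ofShape,
    ← LinearMap.comp_assoc, incl_comp_ofShape, map_map_apply, LinearMap.comp_assoc,
    shapeMap_comp_ofShape, ← LinearMap.comp_assoc, incl_comp_ofShape, TensorProduct.map_tmul,
    LinearMap.comp_apply, LinearMap.comp_apply, LinearMap.id_apply, ← TensorProduct.map_tmul,
    treeBraid_map, (hc S).left, map_map_apply]
  rfl

theorem treeBraid_shapeMap_right (hc : ∀ T, IsNatural σ (c T)) :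
    treeBraid σ X ∘ₗ TensorProduct.map LinearMap.id (incl hXY ∘ₗ shapeMap hφ c) =
      TensorProduct.map (incl hXY ∘ₗ shapeMap hφ c) LinearMap.id ∘ₗ treeBraid σ X := by
  refine treeSpace_tensor_hom_ext fun S hS T hT => TensorProduct.ext' fun x y => ?_
  simp only [LinearMap.comp_apply]
  rw [treeBraid_map, map_map_apply, LinearMap.comp_assoc, shapeMap_comp_ofShape,
    ← LinearMap.comp_assoc, incl_comp_ofShape, map_map_apply, LinearMap.comp_assoc,
    shapeMap_comp_ofShape, ← LinearMap.comp_assoc, incl_comp_ofShape, TensorProduct.map_tmul,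
    LinearMap.comp_apply, LinearMap.comp_apply, LinearMap.id_apply, ← TensorProduct.map_tmul,
    treeBraid_map, (hc T).right, map_map_apply]
  rfl

theorem treeBraid_shapeMap (hc : ∀ T, IsNatural σ (c T)) :
    TensorProduct.map (shapeMap hφ c) (shapeMap hφ c) ∘ₗ treeBraid σ X =
      treeBraid σ Y ∘ₗ TensorProduct.map (shapeMap hφ c) (shapeMap hφ c) := by
  refine treeSpace_tensor_hom_ext fun S hS T hT => TensorProduct.ext' fun x y => ?_
  simp only [LinearMap.comp_apply]
  rw [treeBraid_map, map_map_apply, shapeMap_comp_ofShape, shapeMap_comp_ofShape, map_map_apply,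
    shapeMap_comp_ofShape, shapeMap_comp_ofShape, TensorProduct.map_tmul, LinearMap.comp_apply,
    LinearMap.comp_apply, ← TensorProduct.map_tmul, treeBraid_map, (hc S).left, (hc T).right]
  simp only [map_map_apply, LinearMap.id_comp, LinearMap.comp_id]

end ShapeMap

end TreeBraiding

-- The tridendriform axioms for shapes.

namespace PTree

theorem starShapes_leaf_left (T : PTree) : starShapes leaf T = [T] := by
  rw [starShapes]

theorem starShapes_leaf_right (S : PTree) : starShapes S leaf = [S] := by
  cases S <;> rw [starShapes]

/-- Multisets replace lists because the two sides of an axiom list the same shapes in different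
orders. -/
theorem coe_starShapes {S T : PTree} (hS : S ≠ leaf) (hT : T ≠ leaf) :
    (starShapes S T : Multiset PTree) =
      (precShapes S T : Multiset PTree) + (succShapes S T : Multiset PTree) +
        (dotShapes S T : Multiset PTree) := by
  cases S with
  | leaf => exact absurd rfl hS
  | node f m l =>
    cases T with
    | leaf => exact absurd rfl hT
    | node f' m' l' =>
      rw [starShapes, Multiset.coe_add, Multiset.coe_add]
      rfl

theorem coe_precShapes (f : PTree) (m : List PTree) (l T : PTree) :
    (precShapes (node f m l) T : Multiset PTree) =
      (starShapes l T : Multiset PTree).map fun U => node f m U := rfl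

theorem coe_succShapes (S f : PTree) (m : List PTree) (l : PTree) :
    (succShapes S (node f m l) : Multiset PTree) =
      (starShapes S f : Multiset PTree).map fun U => node U m l := by
  cases S <;> rfl

theorem coe_dotShapes (f : PTree) (m : List PTree) (l f' : PTree) (m' : List PTree) (l' : PTree) :
    (dotShapes (node f m l) (node f' m' l') : Multiset PTree) =
      (starShapes l f' : Multiset PTree).map fun U => node f (m ++ U :: m') l' := rfl

theorem bind_singleton_self {α : Type*} (s : Multiset α) : (s.bind fun a => {a}) = s := by
  simpa using Multiset.bind_singleton s id

/-- Associativity of `*` on three given shapes. -/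
def StarAssoc (S T R : PTree) : Prop :=
  ((starShapes S T : Multiset PTree).bind fun U => (starShapes U R : Multiset PTree)) =
    (starShapes T R : Multiset PTree).bind fun U => (starShapes S U : Multiset PTree)

section Axioms

variable (f : PTree) (m : List PTree) (l f' : PTree) (m' : List PTree) (l' f'' : PTree)
  (m'' : List PTree) (l'' S T R : PTree)

/-- Three of the seven axioms, this one, `succShapes_succShapes` and `precShapes_dotShapes`, are
associativity of `*` inside one branch. In the other four the two products act on different
branches, and the axiom interchanges two independent sums. -/
theorem precShapes_precShapes (h : StarAssoc l T R) :
    ((precShapes (node f m l) T : Multiset PTree).bind fun U =>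
        (precShapes U R : Multiset PTree)) =
      (starShapes T R : Multiset PTree).bind fun U =>
        (precShapes (node f m l) U : Multiset PTree) := by
  simp only [coe_precShapes, Multiset.bind_map]
  rw [← Multiset.map_bind, ← Multiset.map_bind, h]

theorem succShapes_precShapes :
    ((succShapes S (node f m l) : Multiset PTree).bind fun U =>
        (precShapes U R : Multiset PTree)) =
      (precShapes (node f m l) R : Multiset PTree).bind fun U =>
        (succShapes S U : Multiset PTree) := by
  simp only [coe_succShapes, coe_precShapes, Multiset.bind_map]
  exact Multiset.bind_map_comm _ _

theorem succShapes_succShapes (h : StarAssoc S T f) :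
    ((starShapes S T : Multiset PTree).bind fun U =>
        (succShapes U (node f m l) : Multiset PTree)) =
      (succShapes T (node f m l) : Multiset PTree).bind fun U =>
        (succShapes S U : Multiset PTree) := by
  simp only [coe_succShapes, Multiset.bind_map]
  rw [← Multiset.map_bind, ← Multiset.map_bind, h]

theorem dotShapes_precShapes :
    ((dotShapes (node f m l) (node f' m' l') : Multiset PTree).bind fun U =>
        (precShapes U R : Multiset PTree)) =
      (precShapes (node f' m' l') R : Multiset PTree).bind fun U =>
        (dotShapes (node f m l) U : Multiset PTree) := by
  simp only [coe_dotShapes, coe_precShapes, Multiset.bind_map]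
  exact Multiset.bind_map_comm _ _

theorem precShapes_dotShapes (h : StarAssoc l T f'') :
    ((precShapes (node f m l) T : Multiset PTree).bind fun U =>
        (dotShapes U (node f'' m'' l'') : Multiset PTree)) =
      (succShapes T (node f'' m'' l'') : Multiset PTree).bind fun U =>
        (dotShapes (node f m l) U : Multiset PTree) := by
  simp only [coe_dotShapes, coe_precShapes, coe_succShapes, Multiset.bind_map]
  rw [← Multiset.map_bind, ← Multiset.map_bind, h]

theorem succShapes_dotShapes :
    ((succShapes S (node f' m' l') : Multiset PTree).bind fun U =>
        (dotShapes U (node f'' m'' l'') : Multiset PTree)) =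
      (dotShapes (node f' m' l') (node f'' m'' l'') : Multiset PTree).bind fun U =>
        (succShapes S U : Multiset PTree) := by
  simp only [coe_dotShapes, coe_succShapes, Multiset.bind_map]
  exact Multiset.bind_map_comm _ _

theorem dotShapes_dotShapes :
    ((dotShapes (node f m l) (node f' m' l') : Multiset PTree).bind fun U =>
        (dotShapes U (node f'' m'' l'') : Multiset PTree)) =
      (dotShapes (node f' m' l') (node f'' m'' l'') : Multiset PTree).bind fun U =>
        (dotShapes (node f m l) U : Multiset PTree) := by
  simp only [coe_dotShapes, Multiset.bind_map, List.append_assoc, List.cons_append]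
  exact Multiset.bind_map_comm _ _

end Axioms

/-- Induction on the total size. If no argument is the leaf, expanding both bracketings gives the
seven axioms, and those that use associativity in a branch use it for smaller triples. -/
theorem starAssoc (S T R : PTree) : StarAssoc S T R := by
  induction hn : sizeOf S + sizeOf T + sizeOf R using Nat.strong_induction_on
    generalizing S T R with
  | _ n ih =>
  subst hn
  cases S with
  | leaf => simp [StarAssoc, starShapes_leaf_left, bind_singleton_self]
  | node f m l =>
  cases T with
  | leaf => simp [StarAssoc, starShapes_leaf_left, starShapes_leaf_right]
  | node f' m' l' =>
  cases R with
  | leaf => simp [StarAssoc, starShapes_leaf_right, bind_singleton_self]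
  | node f'' m'' l'' =>
  have h1 := ih _ (by simp) l (node f' m' l') (node f'' m'' l'') rfl
  have h2 := ih _ (by simp; omega) (node f m l) (node f' m' l') f'' rfl
  have h3 := ih _ (by simp; omega) l (node f' m' l') f'' rfl
  have mem : ∀ {S T U}, S ≠ leaf → T ≠ leaf → U ∈ (starShapes S T : Multiset PTree) →
      U ≠ leaf := by
    intro S T U hS hT hU
    rw [coe_starShapes hS hT, Multiset.mem_add, Multiset.mem_add] at hU
    rcases hU with (hU | hU) | hU
    · exact (mem_precShapes hU).1
    · exact (mem_succShapes hU).1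
    · exact (mem_dotShapes hU).1
  -- Only the outer product is split at this point: the terms with outer `≻` on the left and outer
  -- `≺` on the right contain a full inner `*`, which their axioms consume before the inner products
  -- are split as well.
  rw [StarAssoc, Multiset.bind_congr fun U hU => coe_starShapes (mem (by simp) (by simp) hU)
    (by simp), Multiset.bind_congr (m := (starShapes (node f' m' l') _ : Multiset PTree))
    fun U hU => coe_starShapes (by simp) (mem (by simp) (by simp) hU), Multiset.bind_add,
    Multiset.bind_add, Multiset.bind_add, Multiset.bind_add, succShapes_succShapes _ _ _ _ _ h2,
    ← precShapes_precShapes _ _ _ _ _ h1]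
  rw [coe_starShapes (S := node f m l) (by simp) (by simp),
    coe_starShapes (S := node f' m' l') (by simp) (by simp)]
  simp only [Multiset.add_bind]
  rw [succShapes_precShapes, dotShapes_precShapes, precShapes_dotShapes _ _ _ _ _ _ _ h3,
    succShapes_dotShapes, dotShapes_dotShapes]
  abel

end PTree

-- The free products satisfy the braided tridendriform axioms.

section FreeAxioms

variable {k : Type*} [Field k] {V : Type*} [AddCommGroup V] [Module k V]
  {σ : V ⊗[k] V →ₗ[k] V ⊗[k] V}

open Classical in
variable (k) in
/-- The tree `T` with angular decorations `u` (zero if `T` is not in `X`). -/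
def dec (X : Set PTree) (T : PTree) (u : List V) : TreeSpace k V X :=
  if hT : T ∈ X then ofShape T hT (word k T.angles u) else 0

theorem dec_of_mem {X : Set PTree} {T : PTree} (hT : T ∈ X) (u : List V) :
    dec k X T u = ofShape T hT (word k T.angles u) := dif_pos hT

theorem treeSpace_dec_ext {X : Set PTree} {M : Type*} [AddCommMonoid M] [Module k M]
    {f g : TreeSpace k V X →ₗ[k] M}
    (h : ∀ T ∈ X, ∀ u : List V, u.length = T.angles → f (dec k X T u) = g (dec k X T u)) :
    f = g := by
  refine treeSpace_hom_ext fun T hT => pow_hom_ext fun u hu => ?_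
  have := h T hT u hu
  rwa [dec_of_mem hT] at this

theorem treeSpace_dec_ext₂ {X Y : Set PTree} {M : Type*} [AddCommMonoid M] [Module k M]
    {f g : TreeSpace k V X ⊗[k] TreeSpace k V Y →ₗ[k] M}
    (h : ∀ S ∈ X, ∀ T ∈ Y, ∀ u w : List V, u.length = S.angles → w.length = T.angles →
      f (dec k X S u ⊗ₜ dec k Y T w) = g (dec k X S u ⊗ₜ dec k Y T w)) : f = g := by
  refine TensorProduct.ext (treeSpace_dec_ext fun S hS u hu =>
    treeSpace_dec_ext fun T hT w hw => ?_)
  exact h S hS T hT u w hu hw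

theorem incl_dec {X Y : Set PTree} (h : X ⊆ Y) {T : PTree} (hT : T ∈ X) (u : List V) :
    incl h (dec k X T u) = dec k Y T u := by
  rw [dec_of_mem hT, dec_of_mem (h hT)]
  exact LinearMap.congr_fun (incl_comp_ofShape h hT) _

theorem freeOp_dec {L : PTree → PTree → List PTree}
    (hL : ∀ {S T U}, U ∈ L S T → U ≠ PTree.leaf ∧ U.angles = S.angles + T.angles) {S T : PTree}
    (hS : S ∈ posShapes) (hT : T ∈ posShapes) {u w : List V} (hu : u.length = S.angles)
    (hw : w.length = T.angles) :
    freeOp (k := k) L hL (dec k posShapes S u ⊗ₜ dec k posShapes T w) =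
      ((L S T).map fun U => dec k posShapes U (u ++ w)).sum := by
  rw [dec_of_mem hS, dec_of_mem hT]
  have := LinearMap.congr_fun (freeOp_map (k := k) (V := V) hL hS hT)
    (word k S.angles u ⊗ₜ word k T.angles w)
  rw [LinearMap.comp_apply, TensorProduct.map_tmul, list_sum_apply] at this
  rw [this, ← List.attach_map_val (l := L S T)]
  congr 1
  refine List.map_congr_left fun U _ => ?_
  rw [dec_of_mem (hL U.2).1, ← concat_word (hL U.2).2 hu hw]
  rfl

variable (k) in
/-- The sum of the trees of a multiset of shapes, all decorated by `u`. -/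
def sumDec (s : Multiset PTree) (u : List V) : TreeSpace k V posShapes :=
  (s.map fun U => dec k posShapes U u).sum

section SumDec

variable {L : PTree → PTree → List PTree}
  (hL : ∀ {S T U}, U ∈ L S T → U ≠ PTree.leaf ∧ U.angles = S.angles + T.angles) {S T : PTree}
  (s : Multiset PTree) {u w : List V}

theorem freeOp_sumDec_left (hs : ∀ U ∈ s, U ≠ PTree.leaf ∧ U.angles = u.length)
    (hT : T ∈ posShapes) (hw : w.length = T.angles) :
    freeOp (k := k) L hL (sumDec k s u ⊗ₜ dec k posShapes T w) =
      sumDec k (s.bind fun U => (L U T : Multiset PTree)) (u ++ w) := by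
  induction s using Multiset.induction_on with
  | empty => simp [sumDec]
  | cons U s ih =>
    have h1 := ih fun U hU => hs U (Multiset.mem_cons_of_mem hU)
    have h2 := hs U (Multiset.mem_cons_self _ _)
    simp only [sumDec, Multiset.map_cons, Multiset.sum_cons, Multiset.cons_bind,
      Multiset.map_add, Multiset.sum_add] at h1 ⊢
    rw [TensorProduct.add_tmul, map_add, h1, freeOp_dec hL h2.1 hT h2.2.symm hw,
      Multiset.map_coe, Multiset.sum_coe]

theorem freeOp_sumDec_right (hs : ∀ U ∈ s, U ≠ PTree.leaf ∧ U.angles = w.length)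
    (hS : S ∈ posShapes) (hu : u.length = S.angles) :
    freeOp (k := k) L hL (dec k posShapes S u ⊗ₜ sumDec k s w) =
      sumDec k (s.bind fun U => (L S U : Multiset PTree)) (u ++ w) := by
  induction s using Multiset.induction_on with
  | empty => simp [sumDec]
  | cons U s ih =>
    have h1 := ih fun U hU => hs U (Multiset.mem_cons_of_mem hU)
    have h2 := hs U (Multiset.mem_cons_self _ _)
    simp only [sumDec, Multiset.map_cons, Multiset.sum_cons, Multiset.cons_bind,
      Multiset.map_add, Multiset.sum_add] at h1 ⊢
    rw [TensorProduct.tmul_add, map_add, h1, freeOp_dec hL hS h2.1 hu h2.2.symm,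
      Multiset.map_coe, Multiset.sum_coe]

end SumDec

theorem trilinear_dec_ext {M : Type*} [AddCommMonoid M] [Module k M]
    {f g : TreeSpace k V posShapes ⊗[k] (TreeSpace k V posShapes ⊗[k] TreeSpace k V posShapes)
      →ₗ[k] M}
    (h : ∀ f₁ m₁ l₁ f₂ m₂ l₂ f₃ m₃ l₃, ∀ u v w : List V,
      u.length = (PTree.node f₁ m₁ l₁).angles → v.length = (PTree.node f₂ m₂ l₂).angles →
      w.length = (PTree.node f₃ m₃ l₃).angles →
      f (dec k _ (.node f₁ m₁ l₁) u ⊗ₜ (dec k _ (.node f₂ m₂ l₂) v ⊗ₜ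
        dec k _ (.node f₃ m₃ l₃) w)) =
      g (dec k _ (.node f₁ m₁ l₁) u ⊗ₜ (dec k _ (.node f₂ m₂ l₂) v ⊗ₜ
        dec k _ (.node f₃ m₃ l₃) w))) (x y z : TreeSpace k V posShapes) :
    f (x ⊗ₜ (y ⊗ₜ z)) = g (x ⊗ₜ (y ⊗ₜ z)) := by
  have : f = g := by
    refine TensorProduct.ext (treeSpace_dec_ext fun S hS u hu => treeSpace_dec_ext₂ ?_)
    intro T hT R hR v w hv hw
    cases S with
    | leaf => exact absurd rfl hS
    | node f₁ m₁ l₁ =>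
    cases T with
    | leaf => exact absurd rfl hT
    | node f₂ m₂ l₂ =>
    cases R with
    | leaf => exact absurd rfl hR
    | node f₃ m₃ l₃ => exact h _ _ _ _ _ _ _ _ _ u v w hu hv hw
  rw [this]

/-- Both bracketings decorate every term by the same word `u ++ v ++ w`, so a mixed associativity
law is an identity between multisets of shapes. -/
theorem freeOp_assoc {L₁ L₂ L₃ L₄ : PTree → PTree → List PTree}
    (h₁ : ∀ {S T U}, U ∈ L₁ S T → U ≠ PTree.leaf ∧ U.angles = S.angles + T.angles)
    (h₂ : ∀ {S T U}, U ∈ L₂ S T → U ≠ PTree.leaf ∧ U.angles = S.angles + T.angles)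
    (h₃ : ∀ {S T U}, U ∈ L₃ S T → U ≠ PTree.leaf ∧ U.angles = S.angles + T.angles)
    (h₄ : ∀ {S T U}, U ∈ L₄ S T → U ≠ PTree.leaf ∧ U.angles = S.angles + T.angles)
    (h : ∀ f₁ m₁ l₁ f₂ m₂ l₂ f₃ m₃ l₃,
      ((L₁ (.node f₁ m₁ l₁) (.node f₂ m₂ l₂) : Multiset PTree).bind fun U =>
        (L₂ U (.node f₃ m₃ l₃) : Multiset PTree)) =
      (L₃ (.node f₂ m₂ l₂) (.node f₃ m₃ l₃) : Multiset PTree).bind fun U =>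
        (L₄ (.node f₁ m₁ l₁) U : Multiset PTree)) (x y z : TreeSpace k V posShapes) :
    freeOp L₂ h₂ (freeOp L₁ h₁ (x ⊗ₜ y) ⊗ₜ z) = freeOp L₄ h₄ (x ⊗ₜ freeOp L₃ h₃ (y ⊗ₜ z)) := by
  refine trilinear_dec_ext
    (f := freeOp L₂ h₂ ∘ₗ TensorProduct.map (freeOp L₁ h₁) LinearMap.id ∘ₗ
      (TensorProduct.assoc k _ _ _).symm.toLinearMap)
    (g := freeOp L₄ h₄ ∘ₗ TensorProduct.map LinearMap.id (freeOp L₃ h₃)) ?_ x y z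
  intro f₁ m₁ l₁ f₂ m₂ l₂ f₃ m₃ l₃ u v w hu hv hw
  change freeOp L₂ h₂ (freeOp L₁ h₁ (_ ⊗ₜ _) ⊗ₜ _) = freeOp L₄ h₄ (_ ⊗ₜ freeOp L₃ h₃ (_ ⊗ₜ _))
  have n₁ : PTree.node f₁ m₁ l₁ ∈ posShapes := PTree.noConfusion
  have n₂ : PTree.node f₂ m₂ l₂ ∈ posShapes := PTree.noConfusion
  have n₃ : PTree.node f₃ m₃ l₃ ∈ posShapes := PTree.noConfusion
  rw [freeOp_dec h₁ n₁ n₂ hu hv, freeOp_dec h₃ n₂ n₃ hv hw]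
  have e₁ := freeOp_sumDec_left (k := k) (u := u ++ v) h₂
    (L₁ (.node f₁ m₁ l₁) (.node f₂ m₂ l₂) : Multiset PTree) (fun U hU => ⟨(h₁ hU).1, by
      rw [(h₁ hU).2, List.length_append, hu, hv]⟩) n₃ hw
  have e₂ := freeOp_sumDec_right (k := k) (w := v ++ w) h₄
    (L₃ (.node f₂ m₂ l₂) (.node f₃ m₃ l₃) : Multiset PTree) (fun U hU => ⟨(h₃ hU).1, by
      rw [(h₃ hU).2, List.length_append, hv, hw]⟩) n₁ hu
  refine e₁.trans (Eq.trans ?_ e₂.symm)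
  rw [h, List.append_assoc]

theorem freeOp_add {L L' : PTree → PTree → List PTree}
    (hL : ∀ {S T U}, U ∈ L S T → U ≠ PTree.leaf ∧ U.angles = S.angles + T.angles)
    (hL' : ∀ {S T U}, U ∈ L' S T → U ≠ PTree.leaf ∧ U.angles = S.angles + T.angles)
    (hL'' : ∀ {S T U}, U ∈ L S T ++ L' S T → U ≠ PTree.leaf ∧ U.angles = S.angles + T.angles) :
    freeOp (k := k) (V := V) L hL + freeOp L' hL' = freeOp (fun S T => L S T ++ L' S T) hL'' := by
  refine treeSpace_dec_ext₂ fun S hS T hT u w hu hw => ?_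
  rw [LinearMap.add_apply, freeOp_dec _ hS hT hu hw, freeOp_dec _ hS hT hu hw,
    freeOp_dec _ hS hT hu hw, List.map_append, List.sum_append]

theorem PTree.mem_allShapes {S T U : PTree}
    (hU : U ∈ PTree.precShapes S T ++ PTree.succShapes S T ++ PTree.dotShapes S T) :
    U ≠ PTree.leaf ∧ U.angles = S.angles + T.angles := by
  rw [List.mem_append, List.mem_append] at hU
  rcases hU with (hU | hU) | hU
  · exact PTree.mem_precShapes hU
  · exact PTree.mem_succShapes hU
  · exact PTree.mem_dotShapes hU

theorem star_freeTri : (freeTri σ).star = freeOp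
    (fun S T => PTree.precShapes S T ++ PTree.succShapes S T ++ PTree.dotShapes S T)
      PTree.mem_allShapes := by
  rw [TriData.star, freeTri]
  simp only
  rw [freeOp_add _ _ fun hU => PTree.mem_allShapes (List.mem_append_left _ hU), freeOp_add]

theorem isBraidedTridendriform_freeTri (hσ : IsBraiding σ) :
    IsBraidedTridendriform (freeTri σ) where
  isBraiding := isBraiding_treeBraid hσ _
  compat_prec := isBraidCompatible_freeOp PTree.mem_precShapes
  compat_succ := isBraidCompatible_freeOp PTree.mem_succShapes
  compat_dot := isBraidCompatible_freeOp PTree.mem_dotShapes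
  prec_prec := by
    rw [star_freeTri]
    refine freeOp_assoc PTree.mem_precShapes PTree.mem_precShapes PTree.mem_allShapes
      PTree.mem_precShapes fun f₁ m₁ l₁ f₂ m₂ l₂ f₃ m₃ l₃ => ?_
    rw [PTree.precShapes_precShapes _ _ _ _ _ (PTree.starAssoc _ _ _),
      PTree.coe_starShapes PTree.noConfusion PTree.noConfusion, Multiset.coe_add,
      Multiset.coe_add]
  succ_prec := freeOp_assoc PTree.mem_succShapes PTree.mem_precShapes
    PTree.mem_precShapes PTree.mem_succShapes fun _ _ _ _ _ _ _ _ _ =>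
      PTree.succShapes_precShapes _ _ _ _ _
  succ_succ := by
    rw [star_freeTri]
    refine fun x y z => (freeOp_assoc PTree.mem_allShapes PTree.mem_succShapes PTree.mem_succShapes
      PTree.mem_succShapes (fun f₁ m₁ l₁ f₂ m₂ l₂ f₃ m₃ l₃ => ?_) x y z).symm
    rw [← PTree.succShapes_succShapes _ _ _ _ _ (PTree.starAssoc _ _ _),
      PTree.coe_starShapes PTree.noConfusion PTree.noConfusion, Multiset.coe_add,
      Multiset.coe_add]
  dot_prec := freeOp_assoc PTree.mem_dotShapes PTree.mem_precShapes
    PTree.mem_precShapes PTree.mem_dotShapes fun _ _ _ _ _ _ _ _ _ =>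
      PTree.dotShapes_precShapes _ _ _ _ _ _ _
  prec_dot := freeOp_assoc PTree.mem_precShapes PTree.mem_dotShapes
    PTree.mem_succShapes PTree.mem_dotShapes fun _ _ _ _ _ _ _ _ _ =>
      PTree.precShapes_dotShapes _ _ _ _ _ _ _ (PTree.starAssoc _ _ _)
  succ_dot := freeOp_assoc PTree.mem_succShapes PTree.mem_dotShapes
    PTree.mem_dotShapes PTree.mem_succShapes fun _ _ _ _ _ _ _ _ _ =>
      PTree.succShapes_dotShapes _ _ _ _ _ _ _
  dot_dot := freeOp_assoc PTree.mem_dotShapes PTree.mem_dotShapes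
    PTree.mem_dotShapes PTree.mem_dotShapes fun _ _ _ _ _ _ _ _ _ =>
      PTree.dotShapes_dotShapes _ _ _ _ _ _ _ _ _

end FreeAxioms

-- The collapse of a tree to a lush tree.

namespace PTree

mutual
/-- The lush tree obtained by deleting the leaves that are inner branches of a vertex. -/
def collapse : PTree → PTree
  | leaf => leaf
  | node f m l => node (collapse f) (collapseList m) (collapse l)
/-- The inner branches of a vertex after deletion of the leaves among them. -/
def collapseList : List PTree → List PTree
  | [] => []
  | t :: ts => (if t = leaf then [] else [collapse t]) ++ collapseList ts
end

mutual
/-- For each pair of consecutive angles of a tree, whether they are separated by a leaf that is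
an inner branch of a vertex. -/
def sep : PTree → List Bool
  | leaf => []
  | node f m l => (if f = leaf then [] else sep f ++ [false]) ++
      (sepList m ++ if l = leaf then [] else false :: sep l)
/-- The part of `sep` that belongs to the inner branches of a vertex. -/
def sepList : List PTree → List Bool
  | [] => []
  | t :: ts => (if t = leaf then [true] else false :: (sep t ++ [false])) ++ sepList ts
end

theorem collapseList_append (s t : List PTree) :
    collapseList (s ++ t) = collapseList s ++ collapseList t := by
  induction s with
  | nil => rfl
  | cons a s ih => simp [collapseList, ih]

theorem sepList_append (s t : List PTree) : sepList (s ++ t) = sepList s ++ sepList t := by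
  induction s with
  | nil => rfl
  | cons a s ih => simp [sepList, ih]

theorem collapse_eq_leaf {T : PTree} : collapse T = leaf ↔ T = leaf := by
  cases T <;> simp [collapse]

mutual
-- A tree with `n ≥ 1` angles has `n - 1` gaps between consecutive angles. An inner branch lies
-- between two angles of its vertex: a leaf accounts for one gap, any other branch for its own gaps
-- and the two beside it.
theorem length_sep : ∀ T : PTree, T ≠ leaf → (sep T).length + 1 = T.angles
  | leaf, h => absurd rfl h
  | node f m l, _ => by
    have h1 := length_sep f
    have h2 := length_sep l
    have h3 := length_sepList m
    by_cases hf : f = leaf <;> by_cases hl : l = leaf <;>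
      simp [sep, angles, hf, hl, h3] at * <;> omega
theorem length_sepList : ∀ m : List PTree, (sepList m).length = anglesList m + m.length
  | [] => rfl
  | t :: ts => by
    have h1 := length_sep t
    have h2 := length_sepList ts
    by_cases ht : t = leaf <;> simp [sepList, anglesList, angles, ht, h2] at * <;> omega
end

/-- The number of factors that remain after merging according to a list of separators. -/
def mergeLength : List Bool → ℕ
  | [] => 1
  | false :: s => mergeLength s + 1
  | true :: s => mergeLength s

theorem mergeLength_eq (s : List Bool) : mergeLength s = s.count false + 1 := by
  induction s with
  | nil => rfl
  | cons b s ih => cases b <;> simp [mergeLength, ih]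

mutual
-- The separators `false` mark the gaps that survive the collapse.
theorem count_sep : ∀ T : PTree, T ≠ leaf → (sep T).count false + 1 = T.collapse.angles
  | leaf, h => absurd rfl h
  | node f m l, _ => by
    have h1 := count_sep f
    have h2 := count_sep l
    have h3 := count_sepList m
    by_cases hf : f = leaf <;> by_cases hl : l = leaf <;>
      simp [sep, angles, hf, hl, h3, collapse] at * <;> omega
theorem count_sepList : ∀ m : List PTree, (sepList m).count false =
      anglesList (collapseList m) + (collapseList m).length
  | [] => rfl
  | t :: ts => by
    have h1 := count_sep t
    have h2 := count_sepList ts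
    by_cases ht : t = leaf
    · simp [sepList, ht, h2, collapseList]
    · simp [sepList, anglesList, ht, h2, collapseList] at *
      omega
end

theorem mergeLength_sep {T : PTree} (hT : T ≠ leaf) :
    mergeLength (sep T) = T.collapse.angles := by
  rw [mergeLength_eq, count_sep T hT]

mutual
theorem isLush_collapse : ∀ T : PTree, IsLush T.collapse
  | leaf => .leaf
  | node f m l => .node (isLush_collapse f) (isLush_collapse l)
      (fun t ht => (isLush_collapseList m t ht).1)
      (fun t ht => (isLush_collapseList m t ht).2)
theorem isLush_collapseList : ∀ m : List PTree, ∀ t ∈ collapseList m, IsLush t ∧ t ≠ leaf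
  | [], t, ht => by simp [collapseList] at ht
  | a :: m, t, ht => by
    have h1 := isLush_collapse a
    have h2 := isLush_collapseList m t
    simp only [collapseList, List.mem_append] at ht
    rcases ht with ht | ht
    · split_ifs at ht with ha
      · simp at ht
      · rw [List.mem_singleton] at ht
        rw [ht, Ne, collapse_eq_leaf]
        exact ⟨h1, ha⟩
    · exact h2 ht
end

mutual
-- A lush tree has no inner leaf to delete, so collapse is a retraction and multiplies no
-- decorations there.
theorem collapse_of_isLush : ∀ T : PTree, IsLush T → T.collapse = T ∧ ∀ b ∈ T.sep, b = false
  | leaf, _ => ⟨rfl, by simp [sep]⟩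
  | node f m l, h => by
    rw [isLush_node_iff] at h
    have h1 := collapse_of_isLush f h.1
    have h2 := collapse_of_isLush l h.2.1
    have h3 := collapseList_of_isLush m h.2.2.1 h.2.2.2
    refine ⟨by rw [collapse, h1.1, h2.1, h3.1], fun b hb => ?_⟩
    simp only [sep, List.mem_append] at hb
    rcases hb with hb | hb | hb
    · split_ifs at hb
      · simp at hb
      · rcases List.mem_append.1 hb with hb | hb
        · exact h1.2 b hb
        · simpa using hb
    · exact h3.2 b hb
    · split_ifs at hb
      · simp at hb
      · rcases List.mem_cons.1 hb with hb | hb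
        · exact hb
        · exact h2.2 b hb
theorem collapseList_of_isLush : ∀ m : List PTree, (∀ t ∈ m, IsLush t) → (∀ t ∈ m, t ≠ leaf) →
    collapseList m = m ∧ ∀ b ∈ sepList m, b = false
  | [], _, _ => ⟨rfl, by simp [sepList]⟩
  | t :: m, h, h' => by
    have h1 := collapse_of_isLush t (h t List.mem_cons_self)
    have h2 := collapseList_of_isLush m (fun t ht => h t (List.mem_cons_of_mem _ ht))
      (fun t ht => h' t (List.mem_cons_of_mem _ ht))
    have ht := h' t List.mem_cons_self
    refine ⟨by simp [collapseList, ht, h1.1, h2.1], fun b hb => ?_⟩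
    simp only [sepList, ht, if_false, List.mem_append, List.mem_cons] at hb
    rcases hb with (hb | hb | hb | hb) | hb
    · exact hb
    · exact h1.2 b hb
    · exact hb
    · simp at hb
    · exact h2.2 b hb
end

/-- The shape `U` of a free product of `S` and `T` corresponds to the term `u` of the lush product
of their collapses. -/
def Matches (S T U : PTree) (u : PTree × Bool) : Prop :=
  u.1 = collapse U ∧ sep U = sep S ++ u.2 :: sep T

/-- The relation `Matches` with the necessary modification if `S` or `T` is the leaf. -/
def StarMatches (S T U : PTree) (u : PTree × Bool) : Prop :=
  u.1 = collapse U ∧ (U = leaf ↔ S = leaf ∧ T = leaf) ∧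
    if S = leaf ∨ T = leaf then u.2 = false ∧ sep U = sep S ++ sep T
    else sep U = sep S ++ u.2 :: sep T

theorem forall₂_map_map {α β γ δ : Type*} {R : α → β → Prop} {P : γ → δ → Prop} {l : List α}
    {l' : List β} {g : α → γ} {g' : β → δ} (h : List.Forall₂ R l l')
    (hg : ∀ a b, R a b → P (g a) (g' b)) : List.Forall₂ P (l.map g) (l'.map g') := by
  induction h with
  | nil => exact .nil
  | cons hab _ ih => exact .cons (hg _ _ hab) ih

section Step

variable {f : PTree} {m : List PTree} {l T f' : PTree} {m' : List PTree} {l' S : PTree}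

theorem precShapes_matches (hT : T ≠ leaf)
    (h : List.Forall₂ (StarMatches l T) (starShapes l T) (starTerms l.collapse T.collapse)) :
    List.Forall₂ (Matches (node f m l) T) (precShapes (node f m l) T)
      (precTerms (node f m l).collapse T.collapse) := by
  refine forall₂_map_map h ?_
  rintro U ⟨_, b⟩ ⟨rfl, h2, h3⟩
  refine ⟨rfl, ?_⟩
  by_cases hl : l = leaf <;> simp [hl, hT] at h2 h3 <;> simp [sep, h2, h3, hl]

theorem succTerms_node (S f : PTree) (m : List PTree) (l : PTree) :
    succTerms S (node f m l) = (starTerms S f).map fun u => (node u.1 m l, u.2) := by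
  cases S <;> rfl

theorem succShapes_node (S f : PTree) (m : List PTree) (l : PTree) :
    succShapes S (node f m l) = (starShapes S f).map fun U => node U m l := by
  cases S <;> rfl

theorem succShapes_matches (hS : S ≠ leaf)
    (h : List.Forall₂ (StarMatches S f') (starShapes S f')
      (starTerms S.collapse f'.collapse)) :
    List.Forall₂ (Matches S (node f' m' l')) (succShapes S (node f' m' l'))
      (succTerms S.collapse (node f' m' l').collapse) := by
  rw [collapse, succTerms_node, succShapes_node]
  refine forall₂_map_map h ?_
  rintro U ⟨_, b⟩ ⟨rfl, h2, h3⟩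
  refine ⟨rfl, ?_⟩
  by_cases hl : f' = leaf <;> simp [hl, hS] at h2 h3 <;> simp [sep, h2, h3, hl]

/-- If the two branches that meet are leaves, the free product has one term, with a new inner leaf.
The collapse deletes that leaf and its separator is `true`, which is the merged term of the lush
product. Otherwise the joined branch is not a leaf, so the collapse keeps it. -/
theorem dotShapes_matches
    (h : List.Forall₂ (StarMatches l f') (starShapes l f')
      (starTerms l.collapse f'.collapse)) :
    List.Forall₂ (Matches (node f m l) (node f' m' l'))
      (dotShapes (node f m l) (node f' m' l'))
      (dotTerms (node f m l).collapse (node f' m' l').collapse) := by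
  rw [collapse, collapse, dotTerms, dotShapes]
  split_ifs with hlf
  · rw [collapse_eq_leaf, collapse_eq_leaf] at hlf
    obtain ⟨rfl, rfl⟩ := hlf
    rw [starShapes_leaf_left]
    refine .cons ⟨?_, ?_⟩ .nil
    · simp [collapse, collapseList_append, collapseList]
    · simp [sep, sepList_append, sepList]
  · rw [collapse_eq_leaf, collapse_eq_leaf] at hlf
    refine forall₂_map_map h ?_
    rintro U ⟨_, b⟩ ⟨rfl, h2, h3⟩
    have hU : U ≠ leaf := fun hU => hlf (h2.1 hU)
    refine ⟨?_, ?_⟩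
    · simp [collapse, collapseList_append, collapseList, hU]
    · by_cases hl : l = leaf <;> by_cases hf : f' = leaf <;> simp [hl, hf] at hlf h3 <;>
        simp [sep, sepList_append, sepList, hU, h3, hl, hf]

end Step

/-- Collapse neither creates nor destroys the tree `leaf`, so both recursions take the same cases
and produce corresponding terms in the same order. -/
theorem starShapes_matches (S T : PTree) :
    List.Forall₂ (StarMatches S T) (starShapes S T) (starTerms S.collapse T.collapse) := by
  fun_induction starShapes S T with
  | case1 T =>
    rw [collapse, starTerms]
    exact .cons (by simp [StarMatches, sep]) .nil
  | case2 f m l =>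
    rw [collapse, collapse, starTerms]
    exact .cons (by simp [StarMatches, sep, collapse]) .nil
  | case3 f m l f' m' l' ih1 ih2 ih3 =>
    have key : ∀ {Ls : List PTree} {Lt : List (PTree × Bool)},
        List.Forall₂ (Matches (node f m l) (node f' m' l')) Ls Lt → (∀ U ∈ Ls, U ≠ leaf) →
        List.Forall₂ (StarMatches (node f m l) (node f' m' l')) Ls Lt := by
      intro Ls Lt h hne
      induction h with
      | nil => exact .nil
      | cons hab _ ih =>
        refine .cons ⟨hab.1, ?_, ?_⟩ (ih fun U hU => hne U (List.mem_cons_of_mem _ hU))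
        · simpa using hne _ List.mem_cons_self
        · simpa using hab.2
    have h1 := key (precShapes_matches (f := f) (m := m) (by simp) ih1) fun U hU =>
      (mem_precShapes hU).1
    have h2 := key (succShapes_matches (m' := m') (l' := l') (by simp) ih2) fun U hU =>
      (mem_succShapes hU).1
    have h3 := key (dotShapes_matches (f := f) (m := m) (m' := m') (l' := l') ih3) fun U hU =>
      (mem_dotShapes hU).1
    have := List.rel_append (List.rel_append h1 h2) h3
    rw [collapse, collapse, starTerms]
    exact this

end PTree

-- Merging the letters of a word along separators.

section Words

variable {A : Type*}

/-- Concatenation of words, with multiplication of the last letter of the first word and the first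
letter of the second one. -/
def joinMul [Mul A] : List A → List A → List A
  | [], w => w
  | [a], [] => [a]
  | [a], b :: w => a * b :: w
  | a :: a' :: u, w => a :: joinMul (a' :: u) w

/-- The two ways of joining words. -/
def joinWord [Mul A] : Bool → List A → List A → List A
  | false => fun u w => u ++ w
  | true => joinMul

/-- Multiplies the consecutive letters of a word whose separator is `true`. -/
def mergeWord [Mul A] : List Bool → List A → List A
  | _, [] => []
  | [], a :: u => a :: u
  | b :: s, a :: u => joinWord b [a] (mergeWord s u)

theorem joinMul_append [Mul A] (u : List A) (a b : A) (w : List A) :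
    joinMul (u ++ [a]) (b :: w) = u ++ a * b :: w := by
  induction u with
  | nil => rfl
  | cons c u ih =>
    cases u with
    | nil => rfl
    | cons d u => simpa [joinMul] using ih

/-- Associativity of `A` enters here, when a one-letter middle word is multiplied on both sides. The
middle word must be nonempty: `joinMul` treats an empty word as a unit, whereas across it `a` and
`w` would be joined according to different flags. -/
theorem joinWord_singleton_assoc [Semigroup A] (b c : Bool) (a x : A) (u w : List A) :
    joinWord c [a] (joinWord b (x :: u) w) = joinWord b (joinWord c [a] (x :: u)) w := by
  cases b <;> cases c <;> cases u <;> cases w <;> simp [joinWord, joinMul, mul_assoc]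

theorem exists_mergeWord_eq_cons [Mul A] (s : List Bool) (a : A) (u : List A) :
    ∃ b w, mergeWord s (a :: u) = b :: w := by
  cases s with
  | nil => exact ⟨a, u, rfl⟩
  | cons c s =>
    rw [mergeWord]
    cases c
    · exact ⟨_, _, rfl⟩
    · cases mergeWord s u
      · exact ⟨_, _, rfl⟩
      · exact ⟨_, _, rfl⟩

/-- This makes collapse multiplicative on decorations: the length condition puts `b` exactly at the
gap between `u` and `w`. -/
theorem mergeWord_append [Semigroup A] (s s' : List Bool) (b : Bool) (u w : List A)
    (hu : u.length = s.length + 1) :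
    mergeWord (s ++ b :: s') (u ++ w) = joinWord b (mergeWord s u) (mergeWord s' w) := by
  induction s generalizing u with
  | nil =>
    obtain ⟨a, rfl⟩ := List.length_eq_one_iff.1 hu
    rfl
  | cons c s ih =>
    cases u with
    | nil => simp at hu
    | cons a u =>
    cases u with
    | nil => simp at hu
    | cons a' u =>
    rw [List.cons_append, List.cons_append, mergeWord, ih _ (by simpa using hu), mergeWord]
    obtain ⟨x, v, hv⟩ := exists_mergeWord_eq_cons s a' u
    rw [hv, joinWord_singleton_assoc]

theorem mergeWord_of_false [Mul A] (s : List Bool) (hs : ∀ b ∈ s, b = false) (u : List A) :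
    mergeWord s u = u := by
  induction s generalizing u with
  | nil => cases u <;> rfl
  | cons b s ih =>
    cases u with
    | nil => rfl
    | cons a u =>
      rw [mergeWord, ih (fun b hb => hs b (List.mem_cons_of_mem _ hb)), hs b List.mem_cons_self]
      rfl

theorem length_mergeWord [Mul A] (s : List Bool) (u : List A) (hu : u.length = s.length + 1) :
    (mergeWord s u).length = PTree.mergeLength s := by
  induction s generalizing u with
  | nil =>
    obtain ⟨a, rfl⟩ := List.length_eq_one_iff.1 hu
    rfl
  | cons b s ih =>
    cases u with
    | nil => simp at hu
    | cons a u =>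
    have := ih u (by simpa using hu)
    rw [mergeWord]
    cases b
    · simp [joinWord, PTree.mergeLength, this]
    · rw [PTree.mergeLength, ← this]
      cases u with
      | nil => simp at hu
      | cons c u =>
      obtain ⟨x, v, hv⟩ := exists_mergeWord_eq_cons s c u
      rw [hv]
      rfl

end Words

-- The collapse as a homomorphism onto lush trees.

section Collapse

variable {k : Type*} [Field k] {A : Type*} [NonUnitalRing A] [Module k A] [IsScalarTower k A A]
  [SMulCommClass k A A] {σ : A ⊗[k] A →ₗ[k] A ⊗[k] A}

variable (k A) in
/-- The two ways of joining tensors, on the concatenation of the tensors. -/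
def joinMap {m n N : ℕ} : (b : Bool) → PTree.Fits m n N b → (⨂[k]^(m + n) A →ₗ[k] ⨂[k]^N A)
  | false, h => (TensorPower.cast k A (Eq.symm h)).toLinearMap
  | true, h =>
    (TensorPower.cast k A (show (m - 1) + 1 + (n - 1) = N by
      have : 0 < m ∧ 0 < n ∧ N + 1 = m + n := h
      omega)).toLinearMap ∘ₗ
      applyAt (m - 1) (n - 1) (powMul (LinearMap.mul' k A)) ∘ₗ
      (TensorPower.cast k A (show m + n = (m - 1) + (1 + 1) + (n - 1) by
        have : 0 < m ∧ 0 < n ∧ N + 1 = m + n := h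
        omega)).toLinearMap

theorem join_apply {m n N : ℕ} (b : Bool) (h : PTree.Fits m n N b) (x : ⨂[k]^m A)
    (y : ⨂[k]^n A) : join b h x y = joinMap k A b h (TensorPower.mulEquiv (x ⊗ₜ y)) := by
  cases b <;> rfl

theorem isNatural_joinMap (hσ : IsBraidedAlgebra σ) {m n N : ℕ} (b : Bool)
    (h : PTree.Fits m n N b) : IsNatural σ (joinMap k A b h) := by
  cases b
  · exact .cast _
  · exact (IsNatural.cast _).comp (((isNatural_powMul hσ.compat).applyAt _ _).comp (.cast _))

theorem powMul_word (a b : A) :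
    powMul (LinearMap.mul' k A) (word k 2 [a, b]) = word k 1 [a * b] := by
  have h := concat_word (k := k) (m := 1) (n := 1) (N := 1 + 1) rfl (u := [a]) (w := [b]) rfl rfl
  rw [List.singleton_append] at h
  change powOne.symm (LinearMap.mul' k A (powTwo (word k (1 + 1) [a, b]))) = _
  rw [← h, powTwo_concat, powOne_word, powOne_word, LinearMap.mul'_apply, powOne_symm_apply]

theorem join_word {m n N : ℕ} (b : Bool) (h : PTree.Fits m n N b) {u w : List A}
    (hu : u.length = m) (hw : w.length = n) :
    join b h (word k m u) (word k n w) = word k N (joinWord b u w) := by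
  cases b
  · exact concat_word h hu hw
  · have h' : 0 < m ∧ 0 < n ∧ N + 1 = m + n := h
    rcases List.eq_nil_or_concat u with rfl | ⟨u, a, rfl⟩
    · simp at hu; omega
    rcases w with _ | ⟨c, w⟩
    · simp at hw; omega
    rw [List.concat_eq_append] at hu ⊢
    simp only [List.length_append, List.length_cons, List.length_nil] at hu hw
    rw [join_apply, mulEquiv_word (by simpa using hu) (by simpa using hw), joinMap,
      LinearMap.comp_apply, LinearMap.comp_apply, LinearEquiv.coe_coe, LinearEquiv.coe_coe,
      cast_word]
    -- The two letters to be multiplied are isolated as the middle segment on which `applyAt` acts.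
    have e : word k (m - 1 + (1 + 1) + (n - 1)) (u ++ [a] ++ c :: w) =
        concat (N := m - 1 + 2 + (n - 1)) rfl (concat rfl (word k (m - 1) u) (word k 2 [a, c]))
          (word k (n - 1) w) := by
      rw [concat_word rfl (by omega) (n := 2) rfl, concat_word rfl (by simp; omega) (by omega)]
      simp
    rw [e, applyAt_concat, powMul_word, concat_word rfl (by omega) (n := 1) rfl,
      concat_word rfl (by simp; omega) (by omega), cast_word, joinWord, joinMul_append]
    simp

theorem fits_mergeLength (b : Bool) (s : List Bool) :
    PTree.Fits 1 (PTree.mergeLength s) (PTree.mergeLength (b :: s)) b := by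
  have := PTree.mergeLength_eq s
  cases b <;> simp only [PTree.Fits, PTree.mergeLength] <;> omega

variable (k A) in
/-- Multiplication of consecutive tensor factors whose separator is `true`. -/
def mergeMap : (s : List Bool) → (⨂[k]^(s.length + 1) A →ₗ[k] ⨂[k]^(PTree.mergeLength s) A)
  | [] => LinearMap.id
  | b :: s => joinMap k A b (fits_mergeLength b s) ∘ₗ
      (TensorPower.mulEquiv.toLinearMap ∘ₗ TensorProduct.map LinearMap.id (mergeMap s) ∘ₗ
        (concatEquiv (m := 1) (n := s.length + 1) (Nat.add_comm _ _)).symm.toLinearMap)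

theorem isNatural_mergeMap (hσ : IsBraidedAlgebra σ) (s : List Bool) :
    IsNatural σ (mergeMap k A s) := by
  induction s with
  | nil => exact .id _
  | cons b s ih =>
    refine (isNatural_joinMap hσ b _).comp ((IsNatural.id 1).concat ih (Nat.add_comm _ _) rfl ?_)
    intro x y
    rw [← mulEquiv_tmul, ← concatEquiv_tmul]
    simp only [LinearMap.comp_apply, LinearEquiv.coe_coe, LinearEquiv.symm_apply_apply,
      TensorProduct.map_tmul]

theorem mergeMap_word (s : List Bool) (u : List A) (hu : u.length = s.length + 1) :
    mergeMap k A s (word k _ u) = word k _ (mergeWord s u) := by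
  induction s generalizing u with
  | nil =>
    obtain ⟨a, rfl⟩ := List.length_eq_one_iff.1 hu
    rfl
  | cons b s ih =>
    cases u with
    | nil => simp at hu
    | cons a u =>
    have hu' : u.length = s.length + 1 := by simpa using hu
    have e : word k ((b :: s).length + 1) (a :: u) =
        concatEquiv (m := 1) (n := s.length + 1) (Nat.add_comm _ _)
          (word k 1 [a] ⊗ₜ word k _ u) :=
      (concat_word (Nat.add_comm _ _) (u := [a]) rfl hu').symm
    rw [e]
    simp only [mergeMap, LinearMap.comp_apply, LinearEquiv.coe_coe, LinearEquiv.symm_apply_apply,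
      TensorProduct.map_tmul, LinearMap.id_apply]
    rw [ih u hu', ← join_apply, join_word b _ (m := 1) (u := [a]) rfl (length_mergeWord s u hu')]
    rfl

variable (k A) in
/-- The effect on the decorations of the collapse of a tree to a lush tree. -/
def collapseMap (T : PTree) : ⨂[k]^(T.angles) A →ₗ[k] ⨂[k]^(T.collapse.angles) A :=
  if h : T = .leaf then (TensorPower.cast k A (by rw [h, PTree.collapse])).toLinearMap
  else (TensorPower.cast k A (PTree.mergeLength_sep h)).toLinearMap ∘ₗ mergeMap k A T.sep ∘ₗ
    (TensorPower.cast k A (PTree.length_sep T h).symm).toLinearMap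

theorem isNatural_collapseMap (hσ : IsBraidedAlgebra σ) (T : PTree) :
    IsNatural σ (collapseMap k A T) := by
  rw [collapseMap]
  split_ifs
  · exact .cast _
  · exact (IsNatural.cast _).comp ((isNatural_mergeMap hσ _).comp (.cast _))

/-- Ties the two descriptions of the collapse together: as a composite of natural maps it slides
through the braiding, and as a rule on words it can be compared with the products. -/
theorem collapseMap_word (T : PTree) (u : List A) (hu : u.length = T.angles) :
    collapseMap k A T (word k _ u) = word k _ (mergeWord T.sep u) := by
  rw [collapseMap]
  split_ifs with h
  · subst h
    rw [LinearEquiv.coe_coe, cast_word, List.length_eq_zero_iff.1 hu]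
    rfl
  · rw [LinearMap.comp_apply, LinearMap.comp_apply, LinearEquiv.coe_coe, LinearEquiv.coe_coe,
      cast_word, mergeMap_word _ _ (hu.trans (PTree.length_sep T h).symm), cast_word]

theorem collapse_mem_posLushShapes (T : PTree) (hT : T ∈ posShapes) :
    T.collapse ∈ posLushShapes :=
  ⟨PTree.isLush_collapse T, fun h => hT (PTree.collapse_eq_leaf.1 h)⟩

theorem collapse_mem_lushShapes (T : PTree) (_ : T ∈ allShapes) : T.collapse ∈ lushShapes :=
  PTree.isLush_collapse T

theorem shapeMap_dec {X Y : Set PTree} (hφ : ∀ T ∈ X, T.collapse ∈ Y) {T : PTree} (hT : T ∈ X)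
    {u : List A} (hu : u.length = T.angles) :
    shapeMap hφ (collapseMap k A) (dec k X T u) = dec k Y T.collapse (mergeWord T.sep u) := by
  rw [dec_of_mem hT, dec_of_mem (hφ T hT), ← collapseMap_word T u hu]
  exact LinearMap.congr_fun (shapeMap_comp_ofShape hφ (collapseMap k A) hT) _

theorem shapeMap_comp_incl {X Y : Set PTree} (hφ : ∀ T ∈ X, T.collapse ∈ Y) (h : Y ⊆ X)
    (hY : ∀ T ∈ Y, T.IsLush) : shapeMap hφ (collapseMap k A) ∘ₗ incl h = LinearMap.id := by
  refine treeSpace_dec_ext fun T hT u hu => ?_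
  have := PTree.collapse_of_isLush T (hY T hT)
  rw [LinearMap.comp_apply, incl_dec h hT, shapeMap_dec hφ (h hT) hu, this.1,
    mergeWord_of_false _ this.2]
  rfl

theorem length_mergeWord_sep {T : PTree} (hT : T ≠ .leaf) {u : List A}
    (hu : u.length = T.angles) : (mergeWord T.sep u).length = T.collapse.angles := by
  rw [length_mergeWord _ _ (hu.trans (PTree.length_sep T hT).symm), PTree.mergeLength_sep hT]

theorem lushOp_dec {L : PTree → PTree → List (PTree × Bool)}
    (hL : ∀ {S T}, S.IsLush → T.IsLush → ∀ {u}, u ∈ L S T →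
      (u.1.IsLush ∧ u.1 ≠ PTree.leaf) ∧ PTree.Fits S.angles T.angles u.1.angles u.2)
    {S T : PTree} (hS : S ∈ posLushShapes) (hT : T ∈ posLushShapes) {u w : List A}
    (hu : u.length = S.angles) (hw : w.length = T.angles) :
    lushOp (k := k) L hL (dec k posLushShapes S u ⊗ₜ dec k posLushShapes T w) =
      ((L S T).map fun t => dec k posLushShapes t.1 (joinWord t.2 u w)).sum := by
  rw [dec_of_mem hS, dec_of_mem hT, lushOp]
  erw [liftPair_ofShape]
  rw [list_sum_apply]
  erw [list_sum_apply]
  rw [← List.attach_map_val (l := L S T)]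
  congr 1
  refine List.map_congr_left fun t _ => ?_
  have h := hL hS.1 hT.1 t.2
  rw [dec_of_mem (X := posLushShapes) h.1, ← join_word t.1.2 h.2 hu hw]
  rfl

variable (k A) in
/-- The projection onto the space of lush trees. -/
def collapsePos : TreeSpace k A posShapes →ₗ[k] TreeSpace k A posLushShapes :=
  shapeMap collapse_mem_posLushShapes (collapseMap k A)

/-- Corresponding terms agree after collapse: the shapes by the first half of `Matches`, the
decorations by the second half together with `mergeWord_append`. -/
theorem collapsePos_freeOp {L : PTree → PTree → List PTree}
    (hL : ∀ {S T U}, U ∈ L S T → U ≠ PTree.leaf ∧ U.angles = S.angles + T.angles)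
    {L' : PTree → PTree → List (PTree × Bool)}
    (hL' : ∀ {S T}, S.IsLush → T.IsLush → ∀ {u}, u ∈ L' S T →
      (u.1.IsLush ∧ u.1 ≠ PTree.leaf) ∧ PTree.Fits S.angles T.angles u.1.angles u.2)
    (h : ∀ S T, S ≠ .leaf → T ≠ .leaf →
      List.Forall₂ (PTree.Matches S T) (L S T) (L' S.collapse T.collapse)) :
    collapsePos k A ∘ₗ freeOp L hL =
      lushOp L' hL' ∘ₗ TensorProduct.map (collapsePos k A) (collapsePos k A) := by
  refine treeSpace_dec_ext₂ fun S hS T hT u w hu hw => ?_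
  rw [LinearMap.comp_apply, LinearMap.comp_apply, TensorProduct.map_tmul,
    freeOp_dec hL hS hT hu hw, collapsePos, shapeMap_dec _ hS hu, shapeMap_dec _ hT hw,
    lushOp_dec hL' (collapse_mem_posLushShapes S hS) (collapse_mem_posLushShapes T hT)
      (length_mergeWord_sep hS hu) (length_mergeWord_sep hT hw), map_list_sum, List.map_map]
  congr 1
  have hmem : ∀ U ∈ L S T, U ≠ PTree.leaf ∧ U.angles = (u ++ w).length := fun U hU =>
    ⟨(hL hU).1, by rw [(hL hU).2, List.length_append, hu, hw]⟩
  have hlen := hu.trans (PTree.length_sep S hS).symm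
  have h' := h S T hS hT
  generalize L S T = Ls at h' hmem
  generalize L' S.collapse T.collapse = Lt at h'
  induction h' with
  | nil => rfl
  | @cons U t _ _ hab _ ih =>
    have hU := hmem U List.mem_cons_self
    rw [List.map_cons, List.map_cons, ih fun U hU => hmem U (List.mem_cons_of_mem _ hU),
      Function.comp_apply, shapeMap_dec collapse_mem_posLushShapes hU.1 hU.2.symm, hab.1, hab.2,
      mergeWord_append _ _ _ _ _ hlen]

theorem isTriHom_collapsePos (hσ : IsBraidedAlgebra σ) :
    IsTriHom (freeTri σ) (lushTri σ) (collapsePos k A) where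
  prec := collapsePos_freeOp PTree.mem_precShapes PTree.mem_precTerms fun S T hS hT => by
    cases S with
    | leaf => exact absurd rfl hS
    | node f m l => exact PTree.precShapes_matches hT (PTree.starShapes_matches _ _)
  succ := collapsePos_freeOp PTree.mem_succShapes PTree.mem_succTerms fun S T hS hT => by
    cases T with
    | leaf => exact absurd rfl hT
    | node f m l => exact PTree.succShapes_matches hS (PTree.starShapes_matches _ _)
  dot := collapsePos_freeOp PTree.mem_dotShapes PTree.mem_dotTerms fun S T hS hT => by
    cases S with
    | leaf => exact absurd rfl hS
    | node f m l =>
    cases T with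
    | leaf => exact absurd rfl hT
    | node f' m' l' => exact PTree.dotShapes_matches (PTree.starShapes_matches _ _)
  braid := treeBraid_shapeMap _ _ (isNatural_collapseMap hσ)

end Collapse

-- Transfer along surjections, braided splittings and generated ideals.

section Transfer

variable {k : Type*} [Field k] {R R' R'' : Type*} [AddCommGroup R] [Module k R] [AddCommGroup R']
  [Module k R'] [AddCommGroup R''] [Module k R''] {D : TriData k R} {D' : TriData k R'}
  {D'' : TriData k R''} {f : R →ₗ[k] R'}

theorem IsBraiding.of_surjective {σ : R ⊗[k] R →ₗ[k] R ⊗[k] R} {τ : R' ⊗[k] R' →ₗ[k] R' ⊗[k] R'}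
    (hσ : IsBraiding σ) (hf : Function.Surjective f)
    (h : TensorProduct.map f f ∘ₗ σ = τ ∘ₗ TensorProduct.map f f) : IsBraiding τ := by
  have h₁ := fun t => map₁₂_map (g := τ) f (fun t => (LinearMap.congr_fun h t).symm) t
  have h₂ : ∀ t, act₂ τ (TensorProduct.map f (TensorProduct.map f f) t) =
      TensorProduct.map f (TensorProduct.map f f) (act₂ σ t) := by
    intro t
    rw [act₂, act₂, map_map_apply, map_map_apply, h]
    rfl
  have h₁' : ∀ t, act₁ τ (TensorProduct.map f (TensorProduct.map f f) t) =
      TensorProduct.map f (TensorProduct.map f f) (act₁ σ t) := h₁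
  refine LinearMap.ext fun t => ?_
  obtain ⟨t, rfl⟩ := TensorProduct.map_surjective hf (TensorProduct.map_surjective hf hf) t
  have h₃ := LinearMap.congr_fun hσ t
  simp only [LinearMap.comp_apply] at h₃ ⊢
  rw [h₁', h₂, h₁', h₂, h₁', h₂]
  exact congrArg _ h₃

theorem IsBraidCompatible.of_surjective {σ : R ⊗[k] R →ₗ[k] R ⊗[k] R}
    {τ : R' ⊗[k] R' →ₗ[k] R' ⊗[k] R'} {μ : R ⊗[k] R →ₗ[k] R} {ν : R' ⊗[k] R' →ₗ[k] R'}
    (hσ : IsBraidCompatible σ μ) (hf : Function.Surjective f)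
    (h : TensorProduct.map f f ∘ₗ σ = τ ∘ₗ TensorProduct.map f f)
    (hμ : f ∘ₗ μ = ν ∘ₗ TensorProduct.map f f) : IsBraidCompatible τ ν := by
  have h₁ := fun t => map₁₂_map (g := τ) f (fun t => (LinearMap.congr_fun h t).symm) t
  have h₂ : ∀ t, act₂ τ (TensorProduct.map f (TensorProduct.map f f) t) =
      TensorProduct.map f (TensorProduct.map f f) (act₂ σ t) := by
    intro t
    rw [act₂, act₂, map_map_apply, map_map_apply, h]
    rfl
  have h₁' : ∀ t, act₁ τ (TensorProduct.map f (TensorProduct.map f f) t) =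
      TensorProduct.map f (TensorProduct.map f f) (act₁ σ t) := h₁
  have h' : ∀ t, τ (TensorProduct.map f f t) = TensorProduct.map f f (σ t) :=
    fun t => (LinearMap.congr_fun h t).symm
  have hr : ∀ t, TensorProduct.map LinearMap.id ν (TensorProduct.map f (TensorProduct.map f f) t) =
      TensorProduct.map f f (TensorProduct.map LinearMap.id μ t) := by
    intro t
    rw [map_map_apply, map_map_apply, hμ]
    rfl
  have hl : ∀ t, TensorProduct.map ν LinearMap.id ((TensorProduct.assoc k _ _ _).symm
      (TensorProduct.map f (TensorProduct.map f f) t)) =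
      TensorProduct.map f f (TensorProduct.map μ LinearMap.id
        ((TensorProduct.assoc k _ _ _).symm t)) := by
    intro t
    rw [← TensorProduct.map_map_assoc_symm, map_map_apply, map_map_apply, hμ]
    rfl
  constructor <;> refine LinearMap.ext fun t => ?_ <;>
    obtain ⟨t, rfl⟩ := TensorProduct.map_surjective hf (TensorProduct.map_surjective hf hf) t <;>
    simp only [LinearMap.comp_apply, LinearEquiv.coe_coe]
  · rw [hr, h', h₁', h₂, hl]
    exact congrArg _ (LinearMap.congr_fun hσ.right t)
  · rw [hl, h', h₂, h₁', hr]
    exact congrArg _ (LinearMap.congr_fun hσ.left t)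

/-- All axioms are identities, and a surjection stays surjective on tensor powers. Applied to the
collapse it gives the axioms for lush trees, applied to the projection modulo `I_A` those for the
quotient. -/
theorem IsBraidedTridendriform.of_surjective (hD : IsBraidedTridendriform D)
    (hf : Function.Surjective f) (h : IsTriHom D D' f) : IsBraidedTridendriform D' := by
  have hp : ∀ x y, D'.prec (f x ⊗ₜ f y) = f (D.prec (x ⊗ₜ y)) := fun x y =>
    (LinearMap.congr_fun h.prec (x ⊗ₜ y)).symm
  have hs : ∀ x y, D'.succ (f x ⊗ₜ f y) = f (D.succ (x ⊗ₜ y)) := fun x y =>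
    (LinearMap.congr_fun h.succ (x ⊗ₜ y)).symm
  have hd : ∀ x y, D'.dot (f x ⊗ₜ f y) = f (D.dot (x ⊗ₜ y)) := fun x y =>
    (LinearMap.congr_fun h.dot (x ⊗ₜ y)).symm
  have ht : ∀ x y, D'.star (f x ⊗ₜ f y) = f (D.star (x ⊗ₜ y)) := fun x y => by
    simp only [TriData.star, LinearMap.add_apply, hp, hs, hd, map_add]
  refine ⟨?_, ?_, ?_, ?_, ?_, ?_, ?_, hD.isBraiding.of_surjective hf h.braid,
    hD.compat_prec.of_surjective hf h.braid h.prec, hD.compat_succ.of_surjective hf h.braid h.succ,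
    hD.compat_dot.of_surjective hf h.braid h.dot⟩ <;> intro x y z <;>
    obtain ⟨x, rfl⟩ := hf x <;> obtain ⟨y, rfl⟩ := hf y <;> obtain ⟨z, rfl⟩ := hf z <;>
    simp only [hp, hs, hd, ht]
  · rw [hD.prec_prec]
  · rw [hD.succ_prec]
  · rw [hD.succ_succ]
  · rw [hD.dot_prec]
  · rw [hD.prec_dot]
  · rw [hD.succ_dot]
  · rw [hD.dot_dot]

theorem isTriHom_mkQ (D : TriData k R) (I : Submodule k R) (h : IsBraidedTriIdeal D I) :
    IsTriHom D (quotientData D I h) I.mkQ where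
  prec := TensorProduct.ext' fun _ _ => rfl
  succ := TensorProduct.ext' fun _ _ => rfl
  dot := TensorProduct.ext' fun _ _ => rfl
  braid := by
    refine TensorProduct.ext' fun x y => ?_
    -- The induced braiding is conjugate under this identification to a map on `(R ⊗ R) / (I ⊗ R + R
    -- ⊗ I)`, where the claim is immediate.
    apply (quotTensorEquiv I).injective
    have key : ∀ t : R ⊗[k] R, quotTensorEquiv I (TensorProduct.map I.mkQ I.mkQ t) =
        (tensorSum I).mkQ t := by
      intro t
      induction t using TensorProduct.induction_on with
      | zero => simp only [map_zero]
      | add x y hx hy => simp only [map_add, hx, hy]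
      | tmul x y => rfl
    rw [LinearMap.comp_apply, key]
    change _ = quotTensorEquiv I ((quotTensorEquiv I).symm _)
    rw [LinearEquiv.apply_symm_apply]
    rfl

/-- Since `p` is surjective, the identities for `e` may be tested on images of `p`. With `p` the
collapse and `q` the quotient map, this makes the isomorphism a homomorphism. -/
theorem IsTriHom.of_comp {p : R →ₗ[k] R'} {q : R →ₗ[k] R''} {e : R' →ₗ[k] R''}
    (hp : IsTriHom D D' p) (hq : IsTriHom D D'' q) (hs : Function.Surjective p)
    (h : e ∘ₗ p = q) : IsTriHom D' D'' e := by
  subst h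
  have hs' := TensorProduct.map_surjective (R := k) hs hs
  have op : ∀ {μ : R ⊗[k] R →ₗ[k] R} {μ' : R' ⊗[k] R' →ₗ[k] R'} {μ'' : R'' ⊗[k] R'' →ₗ[k] R''},
      p ∘ₗ μ = μ' ∘ₗ TensorProduct.map p p →
      (e ∘ₗ p) ∘ₗ μ = μ'' ∘ₗ TensorProduct.map (e ∘ₗ p) (e ∘ₗ p) →
      e ∘ₗ μ' = μ'' ∘ₗ TensorProduct.map e e := by
    intro μ μ' μ'' h₁ h₂
    refine LinearMap.ext fun t => ?_
    obtain ⟨t, rfl⟩ := hs' t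
    have h₁ := LinearMap.congr_fun h₁ t
    have h₂ := LinearMap.congr_fun h₂ t
    simp only [LinearMap.comp_apply] at h₁ h₂ ⊢
    rw [← h₁, h₂, map_map_apply]
  refine ⟨op hp.prec hq.prec, op hp.succ hq.succ, op hp.dot hq.dot, ?_⟩
  refine LinearMap.ext fun t => ?_
  obtain ⟨t, rfl⟩ := hs' t
  have h₁ := LinearMap.congr_fun hp.braid t
  have h₂ := LinearMap.congr_fun hq.braid t
  simp only [LinearMap.comp_apply] at h₁ h₂ ⊢
  rw [← h₁, map_map_apply, h₂, map_map_apply]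

theorem tensorSub_range (a b : R →ₗ[k] R) :
    tensorSub (LinearMap.range a) (LinearMap.range b) =
      LinearMap.range (TensorProduct.map a b) := by
  rw [tensorSub, TensorProduct.range_map, TensorProduct.range_map, Submodule.range_subtype,
    Submodule.range_subtype]

theorem tensorSum_range (a : R →ₗ[k] R) :
    tensorSum (LinearMap.range a) = LinearMap.range (TensorProduct.map a LinearMap.id) ⊔
      LinearMap.range (TensorProduct.map LinearMap.id a) := by
  rw [tensorSum, TensorProduct.range_map, TensorProduct.range_map, TensorProduct.range_map,
    TensorProduct.range_map, Submodule.range_subtype]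

theorem isBraidedSubspace_range {σ : R ⊗[k] R →ₗ[k] R ⊗[k] R} {a : R →ₗ[k] R}
    (hl : σ ∘ₗ TensorProduct.map a LinearMap.id = TensorProduct.map LinearMap.id a ∘ₗ σ)
    (hr : σ ∘ₗ TensorProduct.map LinearMap.id a = TensorProduct.map a LinearMap.id ∘ₗ σ) :
    IsBraidedSubspace σ (LinearMap.range a) := by
  rw [IsBraidedSubspace, tensorSum_range]
  refine sup_le ?_ ?_ <;> rintro _ ⟨t, rfl⟩
  · exact Submodule.mem_sup_right ⟨σ t, (LinearMap.congr_fun hl t).symm⟩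
  · exact Submodule.mem_sup_left ⟨σ t, (LinearMap.congr_fun hr t).symm⟩

/-- Sliding `a` and `b` in turn gives `σ (a ⊗ b) = (b ⊗ a) σ`. -/
theorem map_tensorSub_range {σ : R ⊗[k] R →ₗ[k] R ⊗[k] R} {a b : R →ₗ[k] R}
    (hl : σ ∘ₗ TensorProduct.map a LinearMap.id = TensorProduct.map LinearMap.id a ∘ₗ σ)
    (hr : σ ∘ₗ TensorProduct.map LinearMap.id b = TensorProduct.map b LinearMap.id ∘ₗ σ) :
    (tensorSub (LinearMap.range a) (LinearMap.range b)).map σ ≤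
      tensorSub (LinearMap.range b) (LinearMap.range a) := by
  rw [tensorSub_range, tensorSub_range]
  rintro _ ⟨_, ⟨t, rfl⟩, rfl⟩
  refine ⟨σ t, ?_⟩
  have h₁ := LinearMap.congr_fun hl (TensorProduct.map LinearMap.id b t)
  have h₂ := LinearMap.congr_fun hr t
  simp only [LinearMap.comp_apply] at h₁ h₂
  rw [h₂, map_map_apply, map_map_apply] at h₁
  exact h₁.symm

/-- The kernel of `e` is the range of `id - e`, which slides through `σ` as well; the four block
conditions are `map_tensorSub_range` for the four pairs chosen from `e` and `id - e`. -/
theorem isBraidedDirectSum_of_idempotent {σ : R ⊗[k] R →ₗ[k] R ⊗[k] R} (hσ : IsBraiding σ)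
    {e : R →ₗ[k] R} (he : e ∘ₗ e = e)
    (hl : σ ∘ₗ TensorProduct.map e LinearMap.id = TensorProduct.map LinearMap.id e ∘ₗ σ)
    (hr : σ ∘ₗ TensorProduct.map LinearMap.id e = TensorProduct.map e LinearMap.id ∘ₗ σ) :
    IsBraidedDirectSum σ (LinearMap.range e) (LinearMap.ker e) := by
  have subl : TensorProduct.map (LinearMap.id - e) (LinearMap.id : R →ₗ[k] R) =
      LinearMap.id - TensorProduct.map e LinearMap.id :=
    TensorProduct.ext' fun x y => TensorProduct.sub_tmul x (e x) y
  have subr : TensorProduct.map (LinearMap.id : R →ₗ[k] R) (LinearMap.id - e) =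
      LinearMap.id - TensorProduct.map LinearMap.id e :=
    TensorProduct.ext' fun x y => TensorProduct.tmul_sub x y (e y)
  have he' : ∀ x, e (e x) = e x := LinearMap.congr_fun he
  have hker : LinearMap.ker e = LinearMap.range (LinearMap.id - e) := by
    ext x
    constructor
    · intro hx
      exact ⟨x, by simp [LinearMap.mem_ker.1 hx]⟩
    · rintro ⟨y, rfl⟩
      simp [he']
  have hl' : σ ∘ₗ TensorProduct.map (LinearMap.id - e) LinearMap.id =
      TensorProduct.map LinearMap.id (LinearMap.id - e) ∘ₗ σ := by
    rw [subl, subr, LinearMap.comp_sub, hl, LinearMap.sub_comp]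
    rfl
  have hr' : σ ∘ₗ TensorProduct.map LinearMap.id (LinearMap.id - e) =
      TensorProduct.map (LinearMap.id - e) LinearMap.id ∘ₗ σ := by
    rw [subl, subr, LinearMap.comp_sub, hr, LinearMap.sub_comp]
    rfl
  refine ⟨hσ, ⟨?_, ?_⟩, isBraidedSubspace_range hl hr, ?_, map_tensorSub_range hl hr, ?_, ?_, ?_⟩
  · rw [Submodule.disjoint_def]
    rintro _ ⟨x, rfl⟩ hx
    rw [LinearMap.mem_ker, he'] at hx
    exact hx
  · rw [codisjoint_iff, eq_top_iff, hker]
    intro x _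
    exact Submodule.mem_sup.2 ⟨e x, ⟨x, rfl⟩, x - e x, ⟨x, rfl⟩, by abel⟩
  · rw [hker]
    exact isBraidedSubspace_range hl' hr'
  · rw [hker]
    exact map_tensorSub_range hl hr'
  · rw [hker]
    exact map_tensorSub_range hl' hr
  · rw [hker]
    exact map_tensorSub_range hl' hr'

theorem isTriIdeal_ker {p : R →ₗ[k] R'} (hp : IsTriHom D D' p) :
    IsTriIdeal D (LinearMap.ker p) := by
  have op : ∀ {μ : R ⊗[k] R →ₗ[k] R} {μ' : R' ⊗[k] R' →ₗ[k] R'},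
      p ∘ₗ μ = μ' ∘ₗ TensorProduct.map p p → IsIdealFor μ (LinearMap.ker p) := by
    intro μ μ' h x y hy
    rw [LinearMap.mem_ker] at hy
    have h₁ := LinearMap.congr_fun h (x ⊗ₜ y)
    have h₂ := LinearMap.congr_fun h (y ⊗ₜ x)
    rw [LinearMap.comp_apply, LinearMap.comp_apply, TensorProduct.map_tmul, hy] at h₁ h₂
    rw [TensorProduct.tmul_zero, map_zero] at h₁
    rw [TensorProduct.zero_tmul, map_zero] at h₂
    exact ⟨h₁, h₂⟩
  exact ⟨op hp.prec, op hp.succ, op hp.dot⟩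

theorem isTriIdeal_triIdealSpan (D : TriData k R) (s : Set R) :
    IsTriIdeal D (triIdealSpan D s) := by
  have op : ∀ {μ : R ⊗[k] R →ₗ[k] R}, (∀ I, IsTriIdeal D I → IsIdealFor μ I) →
      IsIdealFor μ (triIdealSpan D s) := by
    intro μ h x y hy
    rw [triIdealSpan, Submodule.mem_sInf] at hy
    rw [triIdealSpan, Submodule.mem_sInf, Submodule.mem_sInf]
    exact ⟨fun I hI => (h I hI.1 x y (hy I hI)).1, fun I hI => (h I hI.1 x y (hy I hI)).2⟩
  exact ⟨op fun _ h => h.prec, op fun _ h => h.succ, op fun _ h => h.dot⟩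

theorem subset_triIdealSpan (D : TriData k R) (s : Set R) : s ⊆ triIdealSpan D s := by
  intro x hx
  rw [SetLike.mem_coe, triIdealSpan, Submodule.mem_sInf]
  exact fun I hI => hI.2 hx

/-- An ideal defines a congruence: the difference is `(x - x') y + x' (y - y')`. -/
theorem IsIdealFor.sub_mem {μ : R ⊗[k] R →ₗ[k] R} {I : Submodule k R} (h : IsIdealFor μ I)
    {x x' y y' : R} (hx : x - x' ∈ I) (hy : y - y' ∈ I) :
    μ (x ⊗ₜ y) - μ (x' ⊗ₜ y') ∈ I := by
  have h₁ := (h y _ hx).2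
  have h₂ := (h x' _ hy).1
  rw [TensorProduct.sub_tmul, map_sub] at h₁
  rw [TensorProduct.tmul_sub, map_sub] at h₂
  have := I.add_mem h₁ h₂
  rwa [sub_add_sub_cancel] at this

end Transfer

-- The ideal `I_A` is the kernel of the collapse.

section Ideal

variable {k : Type*} [Field k] {A : Type*} [NonUnitalRing A] [Module k A]
  {σ : A ⊗[k] A →ₗ[k] A ⊗[k] A}

open PTree

theorem node_mem_posShapes (f : PTree) (m : List PTree) (l : PTree) : node f m l ∈ posShapes :=
  PTree.noConfusion

/-- When the branch where two trees are joined is a leaf on one side, the product is a single tree,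
so `≺`, `≻` and `·` act as graftings. Through these, congruences modulo `I_A` pass from small trees
to large ones. -/
theorem prec_dec {f : PTree} {m : List PTree} {T : PTree} (hT : T ≠ leaf) {u w : List A}
    (hu : u.length = (node f m leaf).angles) (hw : w.length = T.angles) :
    (freeTri σ).prec (dec k _ (node f m leaf) u ⊗ₜ dec k _ T w) =
      dec k _ (node f m T) (u ++ w) := by
  rw [freeTri, freeOp_dec _ (node_mem_posShapes _ _ _) hT hu hw, precShapes, starShapes_leaf_left]
  simp

theorem succ_dec {S : PTree} {m : List PTree} {l : PTree} (hS : S ≠ leaf) {u w : List A}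
    (hu : u.length = S.angles) (hw : w.length = (node leaf m l).angles) :
    (freeTri σ).succ (dec k _ S u ⊗ₜ dec k _ (node leaf m l) w) =
      dec k _ (node S m l) (u ++ w) := by
  rw [freeTri, freeOp_dec _ hS (node_mem_posShapes _ _ _) hu hw, succShapes_node,
    starShapes_leaf_right]
  simp

theorem dot_dec {f : PTree} {m : List PTree} {t : PTree} {m' : List PTree} {l : PTree}
    {u w : List A} (hu : u.length = (node f m leaf).angles)
    (hw : w.length = (node t m' l).angles) :
    (freeTri σ).dot (dec k _ (node f m leaf) u ⊗ₜ dec k _ (node t m' l) w) =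
      dec k _ (node f (m ++ t :: m') l) (u ++ w) := by
  rw [freeTri, freeOp_dec _ (node_mem_posShapes _ _ _) (node_mem_posShapes _ _ _) hu hw, dotShapes,
    starShapes_leaf_left]
  simp

theorem corolla_eq_dec (a : A) : corolla (k := k) a = dec k _ (node leaf [] leaf) [a] := by
  rw [dec_of_mem (node_mem_posShapes _ _ _), word_of_eq (by simp [angles, anglesList]), corolla]
  congr 2
  ext i
  have hi : i.val < 1 := by simpa [angles, anglesList] using i.isLt
  simp

theorem isTriIdeal_idealA : IsTriIdeal (freeTri σ) (idealA σ) := isTriIdeal_triIdealSpan _ _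

theorem corolla_dot_sub_mem (v w : A) :
    dec k _ (node leaf [leaf] leaf) [v, w] - dec k _ (node leaf [] leaf) [v * w] ∈ idealA σ := by
  have : (freeTri σ).dot (corolla v ⊗ₜ corolla w) - corolla (v * w) ∈ idealA σ :=
    subset_triIdealSpan _ _ ⟨v, w, rfl⟩
  rw [corolla_eq_dec, corolla_eq_dec, corolla_eq_dec,
    dot_dec (by simp [angles, anglesList]) (by simp [angles, anglesList])] at this
  exact this

/-- A leaf that is the first inner branch of a vertex can be removed modulo the ideal. -/
theorem merge_sub_mem (f : PTree) (m : List PTree) (l : PTree) (u : List A) (v w : A) (r : List A)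
    (hu : u.length = f.angles) (hr : r.length = anglesList m + m.length + l.angles) :
    dec k _ (node f (leaf :: m) l) (u ++ v :: w :: r) - dec k _ (node f m l) (u ++ v * w :: r) ∈
      idealA σ := by
  -- The case of no further branches: the generator for `v` and `w`, with `f` grafted on the left by
  -- `≻`. What remains of the vertex is attached on the right by `≺` or `·`.
  have h₁ : dec k _ (node f [leaf] leaf) (u ++ [v, w]) - dec k _ (node f [] leaf) (u ++ [v * w]) ∈
      idealA σ := by
    by_cases hf : f = leaf
    · subst hf
      rw [List.length_eq_zero_iff.1 hu]
      exact corolla_dot_sub_mem v w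
    · have := isTriIdeal_idealA.succ.sub_mem (x := dec k _ f u) (x' := dec k _ f u) (by simp)
        (corolla_dot_sub_mem (σ := σ) v w)
      rwa [succ_dec hf hu (by simp [angles, anglesList]),
        succ_dec hf hu (by simp [angles, anglesList])] at this
  cases m with
  | nil =>
    by_cases hl : l = leaf
    · subst hl
      simp only [anglesList, List.length_nil, angles, add_zero] at hr
      rw [List.length_eq_zero_iff.1 hr]
      exact h₁
    · have := isTriIdeal_idealA.prec.sub_mem (y := dec k _ l r) (y' := dec k _ l r) h₁ (by simp)
      rw [prec_dec hl (by simp [angles, anglesList, hu]) (by simpa [anglesList] using hr),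
        prec_dec hl (by simp [angles, anglesList, hu]) (by simpa [anglesList] using hr)] at this
      simpa using this
  | cons t m =>
    have hr' : r.length = (node t m l).angles := by
      simp only [anglesList, List.length_cons, angles] at hr ⊢
      omega
    have := isTriIdeal_idealA.dot.sub_mem (y := dec k _ (node t m l) r)
      (y' := dec k _ (node t m l) r) h₁ (by simp)
    rw [dot_dec (by simp [angles, anglesList, hu]) hr',
      dot_dec (by simp [angles, anglesList, hu]) hr'] at this
    simpa using this

theorem mergeWord_first (f : PTree) (s : List Bool) (u w : List A) (hu : u.length = f.angles) :
    mergeWord ((if f = leaf then [] else sep f ++ [false]) ++ s) (u ++ w) =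
      mergeWord (sep f) u ++ mergeWord s w := by
  split_ifs with hf
  · subst hf
    rw [List.length_eq_zero_iff.1 hu]
    rfl
  · rw [List.append_assoc, List.singleton_append,
      mergeWord_append _ _ _ _ _ (hu.trans (length_sep f hf).symm)]
    rfl

theorem length_mergeWord_sep' {T : PTree} {u : List A} (hu : u.length = T.angles) :
    (mergeWord T.sep u).length = T.collapse.angles := by
  by_cases hT : T = leaf
  · subst hT
    rw [List.length_eq_zero_iff.1 hu]
    rfl
  · exact length_mergeWord_sep hT hu

/-- Induction on the size: the tree is a product of smaller trees, each congruent to its collapse,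
and the product of the collapses differs from the collapse of the product by at most one inner leaf.
-/
theorem dec_sub_collapse_mem (T : PTree) (hT : T ≠ leaf) (u : List A) (hu : u.length = T.angles) :
    dec k _ T u - dec k _ T.collapse (mergeWord T.sep u) ∈ idealA σ := by
  induction hn : sizeOf T using Nat.strong_induction_on generalizing T u with
  | _ n ih =>
  subst hn
  cases T with
  | leaf => exact absurd rfl hT
  | node f m l =>
  have h₁ : ∀ (u : List A) (v : A), u.length = f.angles →
      dec k _ (node f [] leaf) (u ++ [v]) -
        dec k _ (node f.collapse [] leaf) (mergeWord f.sep u ++ [v]) ∈ idealA σ := by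
    intro u v hu
    by_cases hf : f = leaf
    · subst hf
      rw [List.length_eq_zero_iff.1 hu]
      simp [collapse, sep, mergeWord]
    · have := isTriIdeal_idealA.succ.sub_mem (y := dec k _ (node leaf [] leaf) [v])
        (y' := dec k _ (node leaf [] leaf) [v]) (ih _ (by simp; omega) f hf u hu rfl) (by simp)
      rwa [succ_dec hf hu (by simp [angles, anglesList]), succ_dec (by rwa [Ne, collapse_eq_leaf])
        (length_mergeWord_sep hf hu) (by simp [angles, anglesList])] at this
  obtain ⟨u, u', rfl, hu₁⟩ : ∃ a b, u = a ++ b ∧ a.length = f.angles :=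
    ⟨u.take f.angles, u.drop f.angles, (List.take_append_drop _ _).symm, by
      rw [List.length_take, hu, angles]; omega⟩
  cases u' with
  | nil => simp [angles] at hu; omega
  | cons v u' =>
  have h₂ := h₁ u v hu₁
  cases m with
  | nil =>
    have hu' : u'.length = l.angles := by
      simp [angles, anglesList] at hu; omega
    have e : mergeWord (sep (node f [] l)) (u ++ v :: u') =
        mergeWord f.sep u ++ v :: mergeWord l.sep u' := by
      rw [sep, mergeWord_first f _ _ _ hu₁]
      by_cases hl : l = leaf
      · subst hl
        rw [List.length_eq_zero_iff.1 hu', if_pos rfl]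
        rfl
      · rw [if_neg hl]
        rfl
    rw [e, collapse, collapseList]
    by_cases hl : l = leaf
    · subst hl
      rw [List.length_eq_zero_iff.1 hu']
      exact h₂
    · have := isTriIdeal_idealA.prec.sub_mem h₂ (ih _ (by simp) l hl u' hu' rfl)
      rw [prec_dec hl (by simp [angles, anglesList, hu₁]) hu',
        prec_dec (by rwa [Ne, collapse_eq_leaf])
          (by simp [angles, anglesList, length_mergeWord_sep' hu₁]) (length_mergeWord_sep hl hu')]
        at this
      simpa using this
  -- The tree is `node f [] leaf` times `node t m l` under `·`; the second factor is smaller, and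
  -- the first is covered by `h₁`.
  | cons t m =>
    have hu' : u'.length = (node t m l).angles := by
      simp only [angles, anglesList, List.length_append, List.length_cons] at hu ⊢; omega
    have h₃ := ih _ (by simp) (node t m l) (by simp) u' hu' rfl
    have h₄ := isTriIdeal_idealA.dot.sub_mem h₂ h₃
    have hlen := length_mergeWord_sep' hu'
    have e : mergeWord (sep (node f (t :: m) l)) (u ++ v :: u') = mergeWord f.sep u ++
        joinWord (decide (t = leaf)) [v] (mergeWord (node t m l).sep u') := by
      rw [sep, mergeWord_first f _ _ _ hu₁]
      congr 1
      by_cases ht : t = leaf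
      · subst ht
        simp [sep, sepList, mergeWord]
      · simp [sep, sepList, mergeWord, ht]
    generalize mergeWord (node t m l).sep u' = c at *
    rw [collapse] at h₄ hlen
    rw [dot_dec (by simp [angles, anglesList, hu₁]) hu',
      dot_dec (by simp [angles, anglesList, length_mergeWord_sep' hu₁]) hlen] at h₄
    simp only [List.append_assoc, List.singleton_append, List.nil_append] at h₄
    rw [e, collapse]
    -- If `t` is a leaf, the product of the collapses still has it as an inner branch, now the first
    -- one, and `merge_sub_mem` removes it. Otherwise the product of the collapses is already the
    -- collapse.
    by_cases ht : t = leaf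
    · subst ht
      cases c with
      | nil => simp only [List.length_nil, angles] at hlen; omega
      | cons w r =>
      have h₅ := merge_sub_mem (σ := σ) f.collapse (collapseList m) l.collapse (mergeWord f.sep u)
        v w r (length_mergeWord_sep' hu₁) (by
          simp only [List.length_cons, angles, collapse] at hlen
          omega)
      have := (idealA σ).add_mem h₄ h₅
      simpa [collapseList, joinWord, joinMul, collapse] using this
    · simpa [ht, collapseList, joinWord] using h₄

variable [IsScalarTower k A A] [SMulCommClass k A A]

theorem idealA_eq_ker (hσ : IsBraidedAlgebra σ) : idealA σ = LinearMap.ker (collapsePos k A) := by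
  refine le_antisymm (sInf_le ⟨isTriIdeal_ker (isTriHom_collapsePos hσ), ?_⟩) fun x hx => ?_
  · rintro _ ⟨a, b, rfl⟩
    rw [SetLike.mem_coe, LinearMap.mem_ker, corolla_eq_dec, corolla_eq_dec, corolla_eq_dec,
      dot_dec (by simp [angles, anglesList]) (by simp [angles, anglesList]), map_sub, collapsePos,
      shapeMap_dec _ (node_mem_posShapes _ _ _) (by simp [angles, anglesList]),
      shapeMap_dec _ (node_mem_posShapes _ _ _) (by simp [angles, anglesList])]
    simp [collapse, collapseList, sep, sepList, mergeWord, joinWord, joinMul]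
  -- Modulo `I_A` the collapse, viewed among all trees, is the identity; hence an element with zero
  -- collapse is zero in the quotient.
  · have h : (idealA σ).mkQ ∘ₗ incl posLushShapes_subset ∘ₗ collapsePos k A =
        (idealA σ).mkQ := by
      refine treeSpace_dec_ext fun T hT u hu => ?_
      rw [LinearMap.comp_apply, LinearMap.comp_apply, collapsePos, shapeMap_dec _ hT hu,
        incl_dec _ (collapse_mem_posLushShapes T hT)]
      exact ((Submodule.Quotient.eq _).2 (dec_sub_collapse_mem T hT u hu)).symm
    have h' := LinearMap.congr_fun h x
    rw [LinearMap.comp_apply, LinearMap.comp_apply, LinearMap.mem_ker.1 hx, map_zero, map_zero]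
      at h'
    exact (Submodule.Quotient.mk_eq_zero _).1 h'.symm

end Ideal

-- Inclusions of tree spaces and the component of the leaf.

section Decomposition

variable {k : Type*} [Field k] {V : Type*} [AddCommGroup V] [Module k V]

theorem leaf_mem_allShapes : PTree.leaf ∈ allShapes := trivial

theorem leaf_mem_lushShapes : PTree.leaf ∈ lushShapes := .leaf

theorem posLushShapes_subset_lushShapes : posLushShapes ⊆ lushShapes := fun _ h => h.1

theorem component_ofShape_self {X : Set PTree} {T : PTree} (hT : T ∈ X) (z : ⨂[k]^T.angles V) :
    DirectSum.component k X (fun T : X => ⨂[k]^(T.1.angles) V) ⟨T, hT⟩ (ofShape T hT z) = z :=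
  DirectSum.component.lof_self k _ _

theorem component_ofShape_of_ne {X : Set PTree} {S T : PTree} (hS : S ∈ X) (hT : T ∈ X)
    (h : S ≠ T) (z : ⨂[k]^S.angles V) :
    DirectSum.component k X (fun T : X => ⨂[k]^(T.1.angles) V) ⟨T, hT⟩ (ofShape S hS z) = 0 := by
  rw [ofShape, DirectSum.component.of, dif_neg]
  exact fun e => h (congrArg Subtype.val e)

theorem component_incl {X Y : Set PTree} (h : X ⊆ Y) {T : PTree} (hT : T ∈ X) :
    DirectSum.component k Y (fun T : Y => ⨂[k]^(T.1.angles) V) ⟨T, h hT⟩ ∘ₗ incl h =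
      DirectSum.component k X (fun T : X => ⨂[k]^(T.1.angles) V) ⟨T, hT⟩ := by
  refine treeSpace_hom_ext fun S hS => LinearMap.ext fun z => ?_
  rw [LinearMap.comp_assoc, incl_comp_ofShape, LinearMap.comp_apply, LinearMap.comp_apply]
  by_cases e : S = T
  · subst e
    rw [component_ofShape_self, component_ofShape_self]
  · rw [component_ofShape_of_ne _ _ e, component_ofShape_of_ne _ _ e]

theorem incl_injective {X Y : Set PTree} (h : X ⊆ Y) :
    Function.Injective (incl (k := k) (V := V) h) := by
  refine (injective_iff_map_eq_zero _).2 fun x hx => DirectSum.ext_component k fun T => ?_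
  rw [← LinearMap.congr_fun (component_incl h T.2) x, LinearMap.comp_apply, hx, map_zero, map_zero]

theorem component_leaf_incl (x : TreeSpace k V posShapes) :
    DirectSum.component k allShapes (fun T : allShapes => ⨂[k]^(T.1.angles) V)
      ⟨PTree.leaf, leaf_mem_allShapes⟩ (incl posShapes_subset x) = 0 := by
  have : DirectSum.component k allShapes (fun T : allShapes => ⨂[k]^(T.1.angles) V)
      ⟨PTree.leaf, leaf_mem_allShapes⟩ ∘ₗ incl posShapes_subset = 0 := by
    refine treeSpace_hom_ext fun S hS => LinearMap.ext fun z => ?_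
    rw [LinearMap.comp_assoc, incl_comp_ofShape, LinearMap.comp_apply]
    exact component_ofShape_of_ne _ _ hS z
  exact LinearMap.congr_fun this x

theorem exists_eq_incl_add_leaf (x : TreeSpace k V allShapes) :
    ∃ y z, x = incl posShapes_subset y + ofShape PTree.leaf leaf_mem_allShapes z := by
  induction x using DirectSum.induction_on with
  | zero => exact ⟨0, 0, by simp⟩
  | add x x' hx hx' =>
    obtain ⟨y, z, rfl⟩ := hx
    obtain ⟨y', z', rfl⟩ := hx'
    exact ⟨y + y', z + z', by rw [map_add, map_add]; abel⟩
  | of T z =>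
    obtain ⟨T, hT⟩ := T
    by_cases h : T = PTree.leaf
    · subst h
      exact ⟨0, z, by rw [map_zero, zero_add]; rfl⟩
    · have h : T ∈ posShapes := h
      exact ⟨ofShape T h z, 0, by
        rw [map_zero, add_zero, ← LinearMap.comp_apply, incl_comp_ofShape]
        rfl⟩

end Decomposition

-- The two direct sums and the isomorphism with the quotient.

section Main

variable {k : Type*} [Field k] {A : Type*} [NonUnitalRing A] [Module k A] [IsScalarTower k A A]
  [SMulCommClass k A A] {σ : A ⊗[k] A →ₗ[k] A ⊗[k] A}

/-- The idempotent is collapse followed by inclusion: inclusion is injective and collapse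
surjective, so its kernel is that of the collapse and its range that of the inclusion. The sets `X`
and `Y` are left open to cover the trees both with and without the leaf. -/
theorem isBraidedDirectSum_collapse (hσ : IsBraidedAlgebra σ) {X Y : Set PTree}
    (hφ : ∀ T ∈ X, T.collapse ∈ Y) (h : Y ⊆ X) (hY : ∀ T ∈ Y, T.IsLush) :
    IsBraidedDirectSum (treeBraid σ X) (LinearMap.range (incl (k := k) (V := A) h))
      (LinearMap.ker (shapeMap hφ (collapseMap k A))) := by
  have hp := LinearMap.congr_fun (shapeMap_comp_incl (k := k) (A := A) hφ h hY)
  simp only [LinearMap.comp_apply, LinearMap.id_apply] at hp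
  have := isBraidedDirectSum_of_idempotent (isBraiding_treeBraid hσ.isBraiding X)
    (e := incl h ∘ₗ shapeMap hφ (collapseMap k A))
    (LinearMap.ext fun x => by simp only [LinearMap.comp_apply, hp])
    (treeBraid_shapeMap_left hφ _ h (isNatural_collapseMap hσ))
    (treeBraid_shapeMap_right hφ _ h (isNatural_collapseMap hσ))
  rwa [LinearMap.range_comp_of_range_eq_top _ (LinearMap.range_eq_top.2 fun x => ⟨_, hp x⟩),
    LinearMap.ker_comp_of_ker_eq_bot _ (LinearMap.ker_eq_bot.2 (incl_injective h))] at this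

theorem collapsePos_incl (x : TreeSpace k A posLushShapes) :
    collapsePos k A (incl posLushShapes_subset x) = x :=
  LinearMap.congr_fun (shapeMap_comp_incl collapse_mem_posLushShapes posLushShapes_subset
    fun _ h => h.1) x

theorem collapsePos_surjective : Function.Surjective (collapsePos k A) :=
  fun x => ⟨_, collapsePos_incl x⟩

theorem collapse_incl_posShapes (x : TreeSpace k A posShapes) :
    shapeMap collapse_mem_lushShapes (collapseMap k A) (incl posShapes_subset x) =
      incl posLushShapes_subset_lushShapes (collapsePos k A x) := by
  have : shapeMap collapse_mem_lushShapes (collapseMap k A) ∘ₗ incl posShapes_subset =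
      incl posLushShapes_subset_lushShapes ∘ₗ collapsePos k A := by
    refine treeSpace_dec_ext fun T hT u hu => ?_
    rw [LinearMap.comp_apply, LinearMap.comp_apply, incl_dec _ hT,
      shapeMap_dec _ (posShapes_subset hT) hu, collapsePos, shapeMap_dec _ hT hu,
      incl_dec _ (collapse_mem_posLushShapes T hT)]
  exact LinearMap.congr_fun this x

/-- Collapse fixes the tree `leaf` and sends no other tree to it, so an element of the kernel has no
leaf component. -/
theorem ker_collapse_allShapes :
    LinearMap.ker (shapeMap collapse_mem_lushShapes (collapseMap k A)) =
      (LinearMap.ker (collapsePos k A)).map (incl posShapes_subset) := by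
  ext x
  constructor
  · intro hx
    obtain ⟨y, z, rfl⟩ := exists_eq_incl_add_leaf x
    have hleaf : shapeMap collapse_mem_lushShapes (collapseMap k A)
        (ofShape PTree.leaf leaf_mem_allShapes z) =
          ofShape PTree.leaf leaf_mem_lushShapes z := by
      have e : ofShape PTree.leaf leaf_mem_allShapes z =
          incl lushShapes_subset (ofShape PTree.leaf leaf_mem_lushShapes z) := by
        rw [← LinearMap.comp_apply, incl_comp_ofShape]
      rw [e]
      exact LinearMap.congr_fun (shapeMap_comp_incl collapse_mem_lushShapes lushShapes_subset
        fun _ h => h) (ofShape PTree.leaf leaf_mem_lushShapes z)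
    rw [LinearMap.mem_ker, map_add, collapse_incl_posShapes, hleaf] at hx
    have h₁ := congrArg (incl lushShapes_subset) hx
    have e : ∀ w : TreeSpace k A posLushShapes,
        incl lushShapes_subset (incl posLushShapes_subset_lushShapes w) =
          incl posShapes_subset (incl posLushShapes_subset w) := by
      refine LinearMap.congr_fun
        (f := incl lushShapes_subset ∘ₗ incl posLushShapes_subset_lushShapes)
        (g := incl posShapes_subset ∘ₗ incl posLushShapes_subset)
        (treeSpace_hom_ext fun T hT => ?_)
      simp only [LinearMap.comp_assoc, incl_comp_ofShape]
    rw [map_add, e, ← LinearMap.comp_apply (incl _) (ofShape _ _), incl_comp_ofShape,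
      map_zero] at h₁
    -- The leaf component of the collapsed element is `z`, because the other summand comes from
    -- trees different from the leaf.
    have hz := congrArg (DirectSum.component k allShapes
      (fun T : allShapes => ⨂[k]^(T.1.angles) A) ⟨PTree.leaf, leaf_mem_allShapes⟩) h₁
    rw [map_add, component_leaf_incl, component_ofShape_self, zero_add, map_zero] at hz
    subst hz
    rw [map_zero, add_zero] at hx ⊢
    exact ⟨y, (injective_iff_map_eq_zero _).1 (incl_injective _) _ hx, rfl⟩
  · rintro ⟨y, hy, rfl⟩
    rw [LinearMap.mem_ker, collapse_incl_posShapes, LinearMap.mem_ker.1 hy, map_zero]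

theorem mkQ_incl_collapsePos (hσ : IsBraidedAlgebra σ) :
    ((idealA σ).mkQ ∘ₗ incl posLushShapes_subset) ∘ₗ collapsePos k A = (idealA σ).mkQ := by
  refine LinearMap.ext fun x => (Submodule.Quotient.eq _).2 ?_
  rw [idealA_eq_ker hσ, LinearMap.mem_ker, map_sub, collapsePos_incl, sub_self]

theorem bijective_mkQ_incl (hσ : IsBraidedAlgebra σ) :
    Function.Bijective ((idealA σ).mkQ ∘ₗ incl posLushShapes_subset) := by
  constructor
  · refine (injective_iff_map_eq_zero _).2 fun x hx => ?_
    have hx : incl posLushShapes_subset x ∈ idealA σ := (Submodule.Quotient.mk_eq_zero _).1 hx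
    rwa [idealA_eq_ker hσ, LinearMap.mem_ker, collapsePos_incl] at hx
  · intro y
    obtain ⟨x, rfl⟩ := (idealA σ).mkQ_surjective y
    exact ⟨_, LinearMap.congr_fun (mkQ_incl_collapsePos hσ) x⟩

end Main

end BraidedTree

end

open BraidedTree in
theorem mainTheorem9 {k : Type*} [Field k] [CharZero k] {A : Type*} [NonUnitalRing A]
    [Module k A] [IsScalarTower k A A] [SMulCommClass k A A]
    (σ : A ⊗[k] A →ₗ[k] A ⊗[k] A) (hσ : IsBraidedAlgebra σ) :
    IsBraidedTridendriform (freeTri σ) ∧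
    IsBraidedTridendriform (lushTri σ) ∧
    (∃ hI : IsBraidedTriIdeal (freeTri σ) (idealA σ),
      IsBraidedTridendriform (quotientData (freeTri σ) (idealA σ) hI) ∧
      ∃ e : TreeSpace k A posLushShapes ≃ₗ[k] TreeSpace k A posShapes ⧸ idealA σ,
        IsTriHom (lushTri σ) (quotientData (freeTri σ) (idealA σ) hI) e.toLinearMap) ∧
    IsBraidedDirectSum (treeBraid σ posShapes)
      (LinearMap.range (incl (k := k) (V := A) posLushShapes_subset)) (idealA σ) ∧
    IsBraidedDirectSum (treeBraid σ allShapes)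
      (LinearMap.range (incl (k := k) (V := A) lushShapes_subset))
      ((idealA σ).map (incl posShapes_subset)) := by
  have hF := isBraidedTridendriform_freeTri hσ.isBraiding
  have hp := isTriHom_collapsePos hσ
  have hpos : IsBraidedDirectSum (treeBraid σ posShapes)
      (LinearMap.range (incl (k := k) (V := A) posLushShapes_subset)) (idealA σ) := by
    rw [idealA_eq_ker hσ]
    exact isBraidedDirectSum_collapse hσ _ _ fun _ h => h.1
  -- That `I_A` is a braided subspace is part of the direct sum decomposition just obtained.
  have hI : IsBraidedTriIdeal (freeTri σ) (idealA σ) := ⟨isTriIdeal_idealA, hpos.snd_braided⟩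
  have hq := isTriHom_mkQ (freeTri σ) (idealA σ) hI
  refine ⟨hF, hF.of_surjective collapsePos_surjective hp,
    ⟨hI, hF.of_surjective (idealA σ).mkQ_surjective hq,
      LinearEquiv.ofBijective _ (bijective_mkQ_incl hσ),
      .of_comp hp hq collapsePos_surjective (mkQ_incl_collapsePos hσ)⟩, hpos, ?_⟩
  rw [idealA_eq_ker hσ, ← ker_collapse_allShapes]
  exact isBraidedDirectSum_collapse hσ _ _ fun _ h => h
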